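/- Let $D\ge 3$. **Graphs.** A $D$-colored graph is a bipartite $D$-regular graph (white and black vertices) whose edges carry colors $1,\dots,D$ such that the $D$ edges at each vertex have distinct colors; a bubble is a connected one. For a $D$-colored graph $\mathcal B$, $2p(\mathcal B)$ is its number of vertices and $\rho(\mathcal B)$ its number of connected components. $\mathcal B_2$ is the bubble with two vertices. $\mathcal B_{4,\{c\}}$ is the bubble with two pairs of vertices, the vertices of a pair being joined by the $D-1$ edges of color $\ne c$ and the two edges of color $c$ joining different pairs. A graph is melonic if it is obtained from $\mathcal B_2$ by successive $(D-1)$-dipole insertions (replace an edge of some color $c$ by two new vertices joined by $D-1$ edges of the colors $\neq c$, each joined by an edge of color $c$ to one of the two ends of the replaced edge); the two vertices of $\mathcal B_2$ and the two vertices of each inserted dipole are the canonical pairs. **Model.** Let $\mathbb T\in\mathbb C^{N^D}$ be a tensor with entries $\mathbb T_{a_1\cdots a_D}$, $1\le a_j\le N$, and let ${\rm Tr}_{\mathcal B}(\mathbb T,\overline{\mathbb T})$ be the invariant obtained by placing $\mathbb T$ at each white and $\overline{\mathbb T}$ at each black vertex and contracting the $c$-th indices along each edge of color $c$. Let $(\mathcal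 B_i)_{i\in I}$ be a finite family of bubbles with $p_i=p(\mathcal B_i)\ge 2$, let $t_i\in\mathbb C$, and let $\langle\cdot\rangle$ be the expectation for the weight $e^{-N^{D-1}S}$, $S={\rm Tr}_{\mathcal B_2}-\sum_{i\in I}\frac{z^{p_i-1}}{p_i}t_i{\rm Tr}_{\mathcal B_i}$, understood as a formal power series in $z$ (expand the non-Gaussian part of the exponential and integrate term by term against the Gaussian measure). The $2p$-point cumulant expands as $W^{(2p)}_{\vec a^1\cdots\vec a^p,\vec b^1\cdots\vec b^p}=\sum_{\mathcal B:\,p(\mathcal B)=p}\bar\delta^{\mathcal B}_{\vec a,\vec b}\,W(\mathcal B;N)$, where the sum is over (not necessarily connected) $D$-colored graphs up to isomorphism and $\bar\delta^{\mathcal B}$ is the symmetrized trace-invariant operator; set $K(\mathcal B;N)=W(\mathcal B;N)/N^{D-2(D-1)p(\mathcal B)-\rho(\mathcal B)}$ and $K_2=K(\mathcal B_2;N)$. Below, $O(N^{-k})$ is meant at each order in $z$, as $N\to\infty$. **Contributions.** A doubled graph $\mathcal G$ on a bubble $\mathcal B$ consists of a partition of the vertices of $\mathcal B$ into parts $\mathcal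 V_\alpha$ with as many white as black vertices, and of a $D$-colored graph $\mathcal B'_\alpha$ on each $\mathcal V_\alpha$. With $F(\mathcal G)$ the number of faces of colors $0c$, $c=1,\dots,D$ (vertices of $\mathcal B$ being joined to their images in the $\mathcal B'_\alpha$ by edges of color $0$), it contributes to $\frac1N\langle{\rm Tr}_{\mathcal B}\rangle$ with $N^{e(\mathcal G)}\prod_\alpha K(\mathcal B'_\alpha;N)$, where $e(\mathcal G)=-1+F(\mathcal G)+\sum_\alpha\bigl(D-2(D-1)p(\mathcal B'_\alpha)-\rho(\mathcal B'_\alpha)\bigr)$. A Gaussian pairing is a doubled graph all of whose parts have two vertices. **Theorem.** Let $\mathcal B$ be a melonic bubble and $p=p(\mathcal B)$. 1. The Gaussian pairing by the canonical pairs has $e=0$. Every other doubled graph has $e\le-(D-2)$, and if $e=-(D-2)$ then it is either a Gaussian pairing with exactly two non-canonical pairs, or it has exactly one part with four vertices, carrying $\mathcal B_{4,\{c\}}$ for some color $c$, all other parts having two vertices. 2. Let $\alpha$ be the number of Gaussian pairings with exactly two non-canonical pairs and $e=-(D-2)$, and let $\alpha'_c$ be the number of doubled graphs with exactly one part with four vertices,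 carrying $\mathcal B_{4,\{c\}}$, all other parts having two vertices, and $e=-(D-2)$. These numbers depend on $\mathcal B$ only, and for every model as above $$\frac1N\langle{\rm Tr}_{\mathcal B}\rangle=\Bigl(1+\frac{\alpha}{N^{D-2}}\Bigr)K_2^{\,p}+\frac1{N^{D-2}}\sum_{c=1}^D\alpha'_c\,K_2^{\,p-2}K(\mathcal B_{4,\{c\}};N)+O(N^{-(D-1)})$$ (for $p=1$ all $\alpha'_c$ vanish and the last sum is absent). 3. If the family $(\mathcal B_i,t_i)_{i\in I}$ is invariant under relabeling of the colors then, with $\alpha'=\sum_c\alpha'_c$ and for every color $c$, $$\frac1N\langle{\rm Tr}_{\mathcal B}\rangle=\Bigl(1+\frac{\alpha}{N^{D-2}}\Bigr)K_2^{\,p}+\frac{\alpha'}{N^{D-2}}K_2^{\,p-2}K(\mathcal B_{4,\{c\}};N)+O(N^{-(D-1)}).$$ 4. If all $\mathcal B_i$ are melonic, there are power series $T,K_2^{\rm NLO},K_{4,\{c\}}^{\rm LO}$ in $z$, independent of $N$, with $K_2=T+N^{-(D-2)}K_2^{\rm NLO}+O(N^{-(D-1)})$ and $K(\mathcal B_{4,\{c\}};N)=K_{4,\{c\}}^{\rm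 LO}+O(N^{-1})$, and $$\frac1N\langle{\rm Tr}_{\mathcal B}\rangle=T^{p}+\frac1{N^{D-2}}\Bigl(p\,T^{p-1}K_2^{\rm NLO}+\alpha\,T^{p}+T^{p-2}\sum_{c=1}^D\alpha'_c\,K_{4,\{c\}}^{\rm LO}\Bigr)+O(N^{-(D-1)}).$$ -/

import Mathlib

open scoped PowerSeries

noncomputable section

namespace RandomTensor

/-! ### Colored graphs, bubbles, melonic bubbles -/

/-- A bipartite `D`-regular properly edge-colored graph with white vertices labelled by `V` and black
vertices labelled by `V`. The edge of color `c` at the white vertex `v` ends at the black vertex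
`B c v`. -/
abbrev ColoredGraph (D : ℕ) (V : Type) := Fin D → Equiv.Perm V

/-- Renaming the white vertices by `e` and the black vertices by `f`. -/
def relabel {D : ℕ} {V V' : Type} (B : ColoredGraph D V) (e f : V ≃ V') : ColoredGraph D V' :=
  fun c => (e.symm.trans (B c)).trans f

/-- The underlying simple graph: `Sum.inl v` is the white vertex `v`, `Sum.inr w` the black vertex
`w`. -/
def toSimpleGraph {D : ℕ} {V : Type} (B : ColoredGraph D V) : SimpleGraph (V ⊕ V) :=
  SimpleGraph.fromRel fun x y => ∃ (c : Fin D) (v : V), x = Sum.inl v ∧ y = Sum.inr (B c v)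

/-- The number `ρ(B)` of connected components. -/
def numComponents {D : ℕ} {V : Type} (B : ColoredGraph D V) : ℕ :=
  Nat.card (toSimpleGraph B).ConnectedComponent

/-- The bubble `B₂`: two vertices joined by `D` edges. -/
def bubbleTwo (D : ℕ) : ColoredGraph D (Fin 1) := fun _ => 1

/-- The bubble `B_{4,C}`: each of the pairs (white `0`, black `0`), (white `1`, black `1`) is joined
by the edges with color outside `C`; the edges with color in `C` go across the pairs. -/
def bubbleFour {D : ℕ} (C : Finset (Fin D)) : ColoredGraph D (Fin 2) :=
  fun c => if c ∈ C then Equiv.swap 0 1 else 1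

/-- Insertion of a `(D-1)`-dipole on the edge of color `c` at the white vertex `v`. The two new
vertices (both called `none`) are joined by the edges of all the colors other than `c`; the edge of
color `c` from `v` to `B c v` is replaced by an edge from `v` to the new black vertex and one from the
new white vertex to `B c v`. -/
def insertDipole {D : ℕ} {V : Type} [DecidableEq V] (B : ColoredGraph D V) (c : Fin D) (v : V) :
    ColoredGraph D (Option V) :=
  fun c' => if c' = c then (Equiv.swap none (some v)).trans (Equiv.optionCongr (B c'))
    else Equiv.optionCongr (B c')

/-- `IsMelonic B σ`: the graph `B` is obtained from the two-vertex bubble by a sequence of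
`(D-1)`-dipole insertions, and `σ` sends each white vertex to the black vertex of its canonical
pair (the two vertices of `B₂`, and the two vertices of each inserted dipole). -/
inductive IsMelonic {D : ℕ} : {V : Type} → ColoredGraph D V → Equiv.Perm V → Prop
  | base : IsMelonic (V := Unit) (fun _ => 1) 1
  | dipole {V : Type} [DecidableEq V] {B : ColoredGraph D V} {σ : Equiv.Perm V}
      (h : IsMelonic B σ) (c : Fin D) (v : V) :
      IsMelonic (insertDipole B c v) (Equiv.optionCongr σ)
  | relabel {V V' : Type} {B : ColoredGraph D V} {σ : Equiv.Perm V}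
      (h : IsMelonic B σ) (e f : V ≃ V') :
      IsMelonic (relabel B e f) ((e.symm.trans σ).trans f)

/-! ### Doubled graphs -/

/-- A doubled graph on the vertices of a bubble: a partition of the vertex set into parts, one for
each cumulant, and on each part a colored graph `B'_α` with as many white as black vertices. The
graphs `B'_α` are recorded together as one colored graph, no edge of which leaves a part. -/
structure DoubledGraph (D : ℕ) (V : Type) where
  graph : ColoredGraph D V
  part : Setoid (V ⊕ V)
  compatible : ∀ (c : Fin D) (v : V), part.r (Sum.inl v) (Sum.inr (graph c v))

/-- The number of cycles of a permutation, fixed points included. -/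
def numCycles {V : Type} (f : Equiv.Perm V) : ℕ :=
  Nat.card (Quotient (Equiv.Perm.SameCycle.setoid f))

/-- The number of faces of colors `0c`, over all `c`, of the graph obtained by joining each vertex of
`B` to its image in `g` by an edge of color `0`. -/
def numFaces {D : ℕ} {V : Type} (B g : ColoredGraph D V) : ℕ :=
  ∑ c, numCycles ((B c)⁻¹ * g c)

/-- The exponent of `N` in the contribution of a doubled graph to `(1/N) ⟨Tr_B⟩`:
`-1 + F + ∑_α (D - 2 (D-1) p_α - ρ(B'_α))`, where `α` runs over the parts. -/
def scalingExponent {D : ℕ} {V : Type} (B : ColoredGraph D V) (G : DoubledGraph D V) : ℤ :=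
  -1 + numFaces B G.graph
    + ((D : ℤ) * Nat.card (Quotient G.part) - 2 * ((D : ℤ) - 1) * Nat.card V
      - numComponents G.graph)

/-- The doubled graph with one part for each connected component of `g`. -/
def DoubledGraph.ofGraph {D : ℕ} {V : Type} (g : ColoredGraph D V) : DoubledGraph D V where
  graph := g
  part := (toSimpleGraph g).reachableSetoid
  compatible c v := by
    refine SimpleGraph.Adj.reachable ?_
    rw [toSimpleGraph, SimpleGraph.fromRel_adj]
    exact ⟨by simp, Or.inl ⟨c, v, rfl, rfl⟩⟩

/-- The Gaussian contribution in which the white vertex `v` is paired with the black vertex `τ v`: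
all parts carry the bubble `B₂`. -/
def gaussianPairing (D : ℕ) {V : Type} (τ : Equiv.Perm V) : DoubledGraph D V :=
  DoubledGraph.ofGraph fun _ => τ

/-- The doubled graph with exactly one `4`-point cumulant, with boundary graph `B_{4,{c}}` on the white
vertices `v, w` and the black vertices `τ v, τ w`; the other vertices are paired by `τ` in `2`-point
cumulants. -/
def singleFourPoint {D : ℕ} {V : Type} [DecidableEq V] (c : Fin D) (τ : Equiv.Perm V) (v w : V) :
    DoubledGraph D V :=
  DoubledGraph.ofGraph fun c' => if c' = c then τ * Equiv.swap v w else τ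

/-- Gaussian pairings with exactly two pairs that are not canonical. -/
def IsNearlyCanonical {D : ℕ} {V : Type} (σ : Equiv.Perm V) (G : DoubledGraph D V) : Prop :=
  ∃ τ : Equiv.Perm V, {v | τ v ≠ σ v}.ncard = 2 ∧ G = gaussianPairing D τ

/-- Doubled graphs with exactly one `4`-point cumulant, of boundary graph `B_{4,{c}}`, and `2`-point
cumulants. -/
def IsSingleFourPoint {D : ℕ} {V : Type} [DecidableEq V] (c : Fin D) (G : DoubledGraph D V) : Prop :=
  ∃ (τ : Equiv.Perm V) (v w : V), v ≠ w ∧ G = singleFourPoint c τ v w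

/-- `α(B)`: the number of Gaussian pairings with exactly two non-canonical pairs that scale as
`N^{-(D-2)}`. -/
def alphaCoeff {D : ℕ} {V : Type} (B : ColoredGraph D V) (σ : Equiv.Perm V) : ℕ :=
  {G : DoubledGraph D V |
    IsNearlyCanonical σ G ∧ scalingExponent B G = -((D : ℤ) - 2)}.ncard

/-- `α'_c(B)`: the number of doubled graphs with exactly one `4`-point cumulant, of boundary graph
`B_{4,{c}}`, and `2`-point cumulants, that scale as `N^{-(D-2)}`. -/
def alphaCoeff' {D : ℕ} {V : Type} [DecidableEq V] (B : ColoredGraph D V) (c : Fin D) : ℕ :=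
  {G : DoubledGraph D V |
    IsSingleFourPoint c G ∧ scalingExponent B G = -((D : ℤ) - 2)}.ncard

/-! ### Tensors and trace invariants -/

abbrev Index (D N : ℕ) := Fin D → Fin N

abbrev Tensor (D N : ℕ) := Index D N → ℂ

/-- The trace-invariant operator `δ^B_{a,b}`. -/
def traceOperator {D N : ℕ} {V : Type} [Fintype V] (B : ColoredGraph D V) (a b : V → Index D N) : ℂ :=
  ∏ c, ∏ v, if a v c = b (B c v) c then 1 else 0

/-- The invariant polynomial `Tr_B`. -/
def traceInvariant {D N : ℕ} {V : Type} [Fintype V] [DecidableEq V] (B : ColoredGraph D V)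
    (T : Tensor D N) : ℂ :=
  ∑ a : V → Index D N, ∑ b : V → Index D N,
    (∏ v, starRingEnd ℂ (T (b v))) * (∏ v, T (a v)) * traceOperator B a b

/-! ### The perturbed Gaussian model -/

/-- A finite family of bubbles `B_i` (connected, with `p_i ≥ 2` white and `p_i` black vertices) and
the couplings `t_i`. The coupling `z` is the formal variable of the perturbative expansion. -/
structure TensorModel (D : ℕ) where
  I : Type
  [fintypeI : Fintype I]
  p : I → ℕ
  two_le : ∀ i, 2 ≤ p i
  bubble : ∀ i, ColoredGraph D (Fin (p i))
  connected : ∀ i, (toSimpleGraph (bubble i)).Connected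
  t : I → ℂ

attribute [instance] TensorModel.fintypeI

/-- All the bubbles in the action are melonic. -/
def TensorModel.Melonic {D : ℕ} (M : TensorModel D) : Prop :=
  ∀ i, ∃ σ, IsMelonic (M.bubble i) σ

/-- The family of bubbles and couplings is invariant under all relabelings of the colors. -/
def TensorModel.ColorInvariant {D : ℕ} (M : TensorModel D) : Prop :=
  ∀ κ : Equiv.Perm (Fin D), ∃ s : Equiv.Perm M.I, ∀ i, M.t (s i) = M.t i ∧
    ∃ e f : Fin (M.p i) ≃ Fin (M.p (s i)),
      (fun c => M.bubble (s i) (κ c)) = relabel (M.bubble i) e f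

/-- The non-quadratic part of `-N^{D-1} S`, that is `N^{D-1} ∑_i (z^{p_i-1}/p_i) t_i Tr_{B_i}(T)`, as a
power series in `z`. -/
def TensorModel.interaction {D : ℕ} (M : TensorModel D) (N : ℕ) (T : Tensor D N) : ℂ⟦X⟧ :=
  ∑ i, PowerSeries.monomial (M.p i - 1)
    ((N : ℂ) ^ (D - 1) * (M.t i / (M.p i : ℂ)) * traceInvariant (M.bubble i) T)

/-- The exponential of a power series without constant term. -/
def expSeries (S : ℂ⟦X⟧) : ℂ⟦X⟧ :=
  PowerSeries.mk fun n =>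
    ∑ k ∈ Finset.range (n + 1), PowerSeries.coeff n (S ^ k) / (k.factorial : ℂ)

/-- The Gaussian integral
`∫ ∏_a (N^{D-1} dT_a dT̄_a / (2πi)) exp (-N^{D-1} Tr_{B₂}(T)) f(T)`, with `Tr_{B₂}(T) = ∑_a |T_a|²`
and `dT_a dT̄_a / (2i)` the Lebesgue measure of the complex plane. -/
def gaussianIntegral (D N : ℕ) (f : Tensor D N → ℂ) : ℂ :=
  ∫ T : Tensor D N, (∏ _a : Index D N, ((N : ℂ) ^ (D - 1) / (Real.pi : ℂ)))
    * Complex.exp (-((N : ℂ) ^ (D - 1) * ∑ a, ((‖T a‖ ^ 2 : ℝ) : ℂ))) * f T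

/-- The perturbative expansion of `∫ [dT̄ dT] exp (-N^{D-1} S) f`: the exponential of the interaction is
expanded in `z` and integrated term by term. -/
def TensorModel.integral {D : ℕ} (M : TensorModel D) (N : ℕ) (f : Tensor D N → ℂ) : ℂ⟦X⟧ :=
  PowerSeries.mk fun n =>
    gaussianIntegral D N fun T => PowerSeries.coeff n (expSeries (M.interaction N T)) * f T

/-- The perturbative expectation `⟨f⟩`, a power series in `z`. -/
def TensorModel.expectation {D : ℕ} (M : TensorModel D) (N : ℕ) (f : Tensor D N → ℂ) : ℂ⟦X⟧ :=
  M.integral N f * (M.integral N fun _ => 1)⁻¹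

/-- The `2p`-point cumulant `W^{(2p)}_{a¹…a^p, b¹…b^p}`: the joint cumulant of the entries
`T_{a¹}, …, T_{a^p}, T̄_{b¹}, …, T̄_{b^p}`, in terms of moments. -/
def TensorModel.cumulant {D : ℕ} (M : TensorModel D) (N p : ℕ) (a b : Fin p → Index D N) : ℂ⟦X⟧ :=
  ∑ π : Finpartition (Finset.univ : Finset (Fin p ⊕ Fin p)),
    ((-1) ^ (π.parts.card - 1) * ((π.parts.card - 1).factorial : ℂ⟦X⟧))
      * ∏ s ∈ π.parts, M.expectation N fun T =>
          ∏ x ∈ s, Sum.elim (fun j => T (a j)) (fun j => starRingEnd ℂ (T (b j))) x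

/-- `w` is a family of coefficients, depending only on the isomorphism class of the colored graph,
of an expansion of the `2p`-point cumulants in trace invariants. (The symmetrized operator of a bubble
is the sum of the operators of the distinct labelled graphs that are isomorphic to it.) -/
def TensorModel.IsInvariantExpansion {D : ℕ} (M : TensorModel D) (N p : ℕ)
    (w : ColoredGraph D (Fin p) → ℂ⟦X⟧) : Prop :=
  (∀ (B : ColoredGraph D (Fin p)) (e f : Equiv.Perm (Fin p)), w (relabel B e f) = w B) ∧
  ∀ a b : Fin p → Index D N,
    M.cumulant N p a b = ∑ B : ColoredGraph D (Fin p), traceOperator B a b • w B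

open Classical in
/-- The coefficient `W(B; N, z, {t_i})` of the trace invariant of `B` in the `2p`-point cumulant.
(The expansion exists, and it is unique for `N ≥ p`.) -/
def TensorModel.W {D : ℕ} (M : TensorModel D) (N : ℕ) {p : ℕ} (B : ColoredGraph D (Fin p)) : ℂ⟦X⟧ :=
  if h : ∃ w, M.IsInvariantExpansion N p w then h.choose B else 0

/-- The rescaled cumulant `K(B; N, z, {t_i}) = W(B; N, z, {t_i}) / N^{D - 2(D-1)p(B) - ρ(B)}`. -/
def TensorModel.K {D : ℕ} (M : TensorModel D) (N : ℕ) {p : ℕ} (B : ColoredGraph D (Fin p)) : ℂ⟦X⟧ :=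
  ((N : ℂ) ^ ((D : ℤ) - 2 * ((D : ℤ) - 1) * p - numComponents B))⁻¹ • M.W N B

/-- `F N = O(N^{-k})` as `N → ∞`, in the sense of perturbation theory: at each order in `z`. -/
def IsPerturbativeBigO (F : ℕ → ℂ⟦X⟧) (k : ℕ) : Prop :=
  ∀ n : ℕ, (fun N : ℕ => PowerSeries.coeff n (F N)) =O[Filter.atTop]
    fun N : ℕ => ((N : ℝ) ^ k)⁻¹

end RandomTensor

end

open RandomTensor
open scoped PowerSeries

open scoped PowerSeries

namespace RandomTensor

set_option linter.unusedSectionVars false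

/-! ### Components and cycles under the contraction of a pair of vertices -/

section Components

variable {D : ℕ} {V X : Type}

/-! Combinatorics. A doubled graph with colored graph `g` has exponent `w(g) - (2(D-1)p + 1) -
D(ρ(g) - #parts)`, where `w = F + (D-1)ρ` (`scalingExponent_eq`). Parts are unions of components, so
a disconnected part costs at least `D`, and the rest is a bound on `w`. It is proved by undoing the
dipole insertions one by one (`weight_insertDipole_le`, `IsMelonic.weight_le`). If all edges of `g`
at the last canonical pair join its two vertices, removing the pair removes `D-1` faces and one
component, so `w` drops by `2(D-1)`. Otherwise either some color joins the pair, and then at most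
one face per color and no component is lost, or none does, and at most one face and one component
are lost: `w` drops by at most `D`, which leaves `g` at least `D-2` below the maximum. Equality
forces the smaller graph to be the canonical pairing, and then either only the dipole color crosses
(`B_{4,{c}}`) or all colors cross together (two re-paired pairs).

Size of the cumulants. Integrals of polynomials are replaced by an algebraic Gaussian functional
obeying Wick's theorem. Cumulants are sums over connected Wick contractions, because both satisfy
the recursion over the block of a given element, which has a unique solution
(`jointCumulant_unique`). In a connected contraction with `k` interaction vertices, the pieces start
as at least `k + 2p` components; identifications that connect different components close no face,
and each remaining one raises the number of closed faces plus boundary components by at most `D-1`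
(`exists_boundary_of_joinConnected`). The power of `N` is then at most `D - 2(D-1)p - ρ`, so at each
order in `z` the coefficients of `K` are polynomials in `1/N` (`exists_polynomial_K`).

Assembly. Indices carrying distinct tags turn trace operators into Kronecker deltas on labelled
graphs, so the coefficients `W` are themselves cumulants at tagged indices. Splitting moments into
cumulants then writes `⟨Tr_B⟩/N` as the sum of the contributions of all doubled graphs
(`expectation_eq_sum_contribution`). The graphs of exponents `0` and `-(D-2)` contribute exactly the
main terms, and the others are `O(N^{-(D-1)})`. In a color-invariant model, permuting the tensor
indices identifies the cumulants on `B_{4,{c}}` for all `c`.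

Melonic models. Integration by parts expresses `K_2` through the `⟨Tr_{B_i}⟩/N`, which equal
`K_2^{p_i}` up to `O(N^{-(D-2)})`. The limit `T` of `K_2` thus solves a fixed point equation;
comparing with it improves the error to `N^{-(D-2)}`, and polynomiality in `1/N` supplies the next
coefficient. -/

/-- The connected component of a vertex. -/
abbrev comp (B : ColoredGraph D V) (u : V ⊕ V) : (toSimpleGraph B).ConnectedComponent :=
  (toSimpleGraph B).connectedComponentMk u

theorem comp_edge (B : ColoredGraph D V) (c : Fin D) (v : V) :
    comp B (Sum.inl v) = comp B (Sum.inr (B c v)) := by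
  refine SimpleGraph.ConnectedComponent.connectedComponentMk_eq_of_adj ?_
  rw [toSimpleGraph, SimpleGraph.fromRel_adj]
  exact ⟨by simp, Or.inl ⟨c, v, rfl, rfl⟩⟩

theorem eq_of_reachable {B : ColoredGraph D V} {α : Type*} {F : V ⊕ V → α}
    (h : ∀ c v, F (Sum.inl v) = F (Sum.inr (B c v))) {u v : V ⊕ V}
    (huv : (toSimpleGraph B).Reachable u v) : F u = F v := by
  obtain ⟨w⟩ := huv
  induction w with
  | nil => rfl
  | cons hadj _ ih =>
    rw [← ih]
    rw [toSimpleGraph, SimpleGraph.fromRel_adj] at hadj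
    rcases hadj.2 with ⟨c, v, rfl, rfl⟩ | ⟨c, v, rfl, rfl⟩
    · exact h c v
    · exact (h c v).symm

/-- Spares the handling of paths: most comparisons of `numComponents` below exhibit a surjection
obtained by such a descent. -/
theorem exists_comp_lift {B : ColoredGraph D V} {α : Type*} {F : V ⊕ V → α}
    (h : ∀ c v, F (Sum.inl v) = F (Sum.inr (B c v))) :
    ∃ f : (toSimpleGraph B).ConnectedComponent → α, ∀ u, f (comp B u) = F u :=
  ⟨SimpleGraph.ConnectedComponent.lift F fun _ _ p _ => eq_of_reachable h ⟨p⟩, fun _ => rfl⟩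

/-- The graph obtained by deleting the white and the black vertex `none` and joining, for each color,
the two edges that ended there. -/
def contract (B : ColoredGraph D (Option X)) : ColoredGraph D X := fun c => Equiv.removeNone (B c)

/-- A new edge joins a neighbour of the black `none` to a neighbour of the white `none`, so it
respects the components of `B` once those of the two deleted vertices are identified (the map `G`).
Only the component of `Sum.inl none` may then be missed. -/
theorem numComponents_le_contract_add_one [Finite X] (hD : 0 < D) (B : ColoredGraph D (Option X)) :
    numComponents B ≤ numComponents (contract B) + 1 := by
  classical
  let G : (toSimpleGraph B).ConnectedComponent → (toSimpleGraph B).ConnectedComponent := fun C =>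
    if C = comp B (Sum.inl none) then comp B (Sum.inr none) else C
  have hG0 : G (comp B (Sum.inl none)) = comp B (Sum.inr none) := if_pos rfl
  have hG1 : G (comp B (Sum.inr none)) = comp B (Sum.inr none) := by
    simp only [G]; split_ifs <;> rfl
  let F : X ⊕ X → (toSimpleGraph B).ConnectedComponent := fun u => G (comp B (u.map some some))
  have hF : ∀ c v, F (Sum.inl v) = F (Sum.inr (contract B c v)) := by
    intro c v
    simp only [F, Sum.map_inl, Sum.map_inr]
    rcases hv : B c (some v) with _ | y
    · have h1 : comp B (Sum.inl (some v)) = comp B (Sum.inr none) := by rw [comp_edge B c, hv]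
      have h2 : comp B (Sum.inr (some (contract B c v))) = comp B (Sum.inl none) := by
        rw [comp_edge B c, contract, Equiv.removeNone_none _ hv]
      rw [h1, h2, hG0, hG1]
    · rw [contract, Equiv.removeNone_some _ ⟨y, hv⟩, ← comp_edge B c]
  obtain ⟨f, hf⟩ := exists_comp_lift hF
  have key : ∀ u : X ⊕ X, comp B (u.map some some) ≠ comp B (Sum.inl none) →
      f (comp _ u) = comp B (u.map some some) := by
    intro u hu; rw [hf]; exact if_neg hu
  rw [numComponents, numComponents, ← Finite.card_option]
  refine Nat.card_le_card_of_surjective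
    (fun o : Option _ => o.elim (comp B (Sum.inl none)) f) fun C => ?_
  induction C using SimpleGraph.ConnectedComponent.ind with | _ u => ?_
  by_cases h0 : comp B u = comp B (Sum.inl none)
  · exact ⟨none, h0.symm⟩
  rcases u with (_ | v) | (_ | v)
  · exact absurd rfl h0
  · exact ⟨some (comp _ (Sum.inl v)), key (Sum.inl v) h0⟩
  · have h1 := comp_edge B ⟨0, hD⟩ ((B ⟨0, hD⟩).symm none)
    rw [Equiv.apply_symm_apply] at h1
    rcases hv : (B ⟨0, hD⟩).symm none with _ | v
    · rw [hv] at h1; exact absurd h1.symm h0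
    · rw [hv] at h1
      refine ⟨some (comp _ (Sum.inl v)), ?_⟩
      simp only [Option.elim_some]
      rw [key (Sum.inl v) (by simpa [h1] using h0)]
      exact h1
  · exact ⟨some (comp _ (Sum.inr v)), key (Sum.inr v) h0⟩

/-- With both deleted vertices in one component no identification is needed, and the edge of color
`c` provides a surviving vertex in it. -/
theorem numComponents_le_contract [Finite X] (B : ColoredGraph D (Option X))
    (h : comp B (Sum.inl none) = comp B (Sum.inr none)) (c : Fin D) (hc : B c none ≠ none) :
    numComponents B ≤ numComponents (contract B) := by
  let F : X ⊕ X → (toSimpleGraph B).ConnectedComponent := fun u => comp B (u.map some some)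
  have hF : ∀ c v, F (Sum.inl v) = F (Sum.inr (contract B c v)) := by
    intro c v
    simp only [F, Sum.map_inl, Sum.map_inr]
    rcases hv : B c (some v) with _ | y
    · rw [comp_edge B c, hv, contract, Equiv.removeNone_none _ hv, ← comp_edge B c, h]
    · rw [contract, Equiv.removeNone_some _ ⟨y, hv⟩, ← comp_edge B c]
  obtain ⟨f, hf⟩ := exists_comp_lift hF
  obtain ⟨y, hy⟩ := Option.ne_none_iff_exists'.mp hc
  have h0 : f (comp _ (Sum.inr y)) = comp B (Sum.inl none) := by
    rw [hf, comp_edge B c, hy]; rfl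
  refine Nat.card_le_card_of_surjective f fun C => ?_
  induction C using SimpleGraph.ConnectedComponent.ind with | _ u => ?_
  rcases u with (_ | v) | (_ | v)
  · exact ⟨_, h0⟩
  · exact ⟨_, hf (Sum.inl v)⟩
  · exact ⟨_, h0.trans h⟩
  · exact ⟨_, hf (Sum.inr v)⟩

/-- Deleting the pair cuts only the components it touches, and every resulting piece contains a
black neighbour of the white `none` (the family `t`). Collapsing these pieces to a single value
gives a map that descends to the components of `B`. -/
theorem numComponents_contract_le [Finite X] (B : ColoredGraph D (Option X)) :
    numComponents (contract B) + 1 ≤ numComponents B + Nat.card {c // B c none ≠ none} := by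
  classical
  have := Fintype.ofFinite X
  let t : {c // B c none ≠ none} → (toSimpleGraph (contract B)).ConnectedComponent := fun c =>
    comp _ (Sum.inr ((B c.1 none).get (Option.isSome_iff_ne_none.2 c.2)))
  have ht : ∀ (c : Fin D) (y : X), B c none = some y → comp _ (Sum.inr y) ∈ Set.range t := by
    intro c y h
    exact ⟨⟨c, by simp [h]⟩, by simp [t, h]⟩
  let F : Option X ⊕ Option X → Option (toSimpleGraph (contract B)).ConnectedComponent :=
    Sum.elim
      (fun o => o.elim none fun v =>
        if comp (contract B) (Sum.inl v) ∈ Set.range t then none else some (comp _ (Sum.inl v)))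
      (fun o => o.elim none fun v =>
        if comp (contract B) (Sum.inr v) ∈ Set.range t then none else some (comp _ (Sum.inr v)))
  have hF : ∀ c v, F (Sum.inl v) = F (Sum.inr (B c v)) := by
    intro c v
    rcases v with _ | v
    · rcases hv : B c none with _ | y
      · rfl
      · simp only [F, Sum.elim_inl, Option.elim_none, Sum.elim_inr, Option.elim_some]
        rw [if_pos (ht c y hv)]
    · have h1 := comp_edge (contract B) c v
      rcases hv : B c (some v) with _ | y
      · have h2 : B c none = some (contract B c v) := (Equiv.removeNone_none _ hv).symm
        have := ht c _ h2
        simp only [F, Sum.elim_inl, Option.elim_some, h1, Sum.elim_inr, Option.elim_none]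
        rw [if_pos this]
      · have h2 : contract B c v = y := by
          apply Option.some_injective
          rw [contract, Equiv.removeNone_some _ ⟨y, hv⟩, hv]
        simp only [F, Sum.elim_inl, Option.elim_some, h1, Sum.elim_inr, h2]
  obtain ⟨f, hf⟩ := exists_comp_lift hF
  have hsurj : ∀ o : Option (toSimpleGraph (contract B)).ConnectedComponent,
      o ∈ Set.range f ∪ some '' Set.range t := by
    rintro (_ | C)
    · exact Or.inl ⟨_, hf (Sum.inl none)⟩
    · by_cases hC : C ∈ Set.range t
      · exact Or.inr ⟨C, hC, rfl⟩
      · left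
        induction C using SimpleGraph.ConnectedComponent.ind with | _ u => ?_
        rcases u with v | v
        · exact ⟨comp B (Sum.inl (some v)), by rw [hf]; simp only [F, Sum.elim_inl, Option.elim_some]; rw [if_neg hC]⟩
        · exact ⟨comp B (Sum.inr (some v)), by rw [hf]; simp only [F, Sum.elim_inr, Option.elim_some]; rw [if_neg hC]⟩
  rw [numComponents, numComponents, ← Finite.card_option, ← Nat.card_sum]
  refine Nat.card_le_card_of_surjective (Sum.elim f fun c => some (t c)) fun o => ?_
  rcases hsurj o with ⟨C, hC⟩ | ⟨_, ⟨c, rfl⟩, hC⟩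
  · exact ⟨Sum.inl C, hC⟩
  · exact ⟨Sum.inr c, hC⟩

theorem comp_inl_surjective [Finite V] (hD : 0 < D) (B : ColoredGraph D V) :
    Function.Surjective fun v => comp B (Sum.inl v) := by
  intro C
  induction C using SimpleGraph.ConnectedComponent.ind with | _ u => ?_
  rcases u with v | v
  · exact ⟨v, rfl⟩
  · refine ⟨(B ⟨0, hD⟩).symm v, ?_⟩
    simp only
    rw [comp_edge B ⟨0, hD⟩, Equiv.apply_symm_apply]

/-- Every component contains a white vertex, so the bound leaves exactly one in each; any two colors
then lead from a black vertex back to the same white vertex. -/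
theorem eq_of_numComponents_eq_card [Finite V] (hD : 0 < D) {B : ColoredGraph D V}
    (h : Nat.card V ≤ numComponents B) (c c' : Fin D) : B c = B c' := by
  have hb : Function.Bijective fun v => comp B (Sum.inl v) :=
    (Nat.bijective_iff_surjective_and_card _).2 ⟨comp_inl_surjective hD B,
      h.antisymm (Nat.card_le_card_of_surjective _ (comp_inl_surjective hD B))⟩
  ext v
  have : (B c).symm (B c' v) = v := by
    apply hb.1
    simp only
    rw [comp_edge B c, Equiv.apply_symm_apply, comp_edge B c']
  rw [← Equiv.apply_symm_apply (B c) (B c' v), this]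

theorem numComponents_const [Finite V] (hD : 0 < D) (σ : Equiv.Perm V) :
    numComponents (fun _ : Fin D => σ) = Nat.card V := by
  refine le_antisymm (Nat.card_le_card_of_surjective _ (comp_inl_surjective hD _)) ?_
  let F : V ⊕ V → V := Sum.elim id σ.symm
  obtain ⟨f, hf⟩ := exists_comp_lift (B := fun _ : Fin D => σ) (F := F) (by simp [F])
  exact Nat.card_le_card_of_surjective f fun v => ⟨_, hf (Sum.inl v)⟩

theorem numComponents_relabel_le [Finite V] {V' : Type} (B : ColoredGraph D V) (e f : V ≃ V') :
    numComponents (relabel B e f) ≤ numComponents B := by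
  let F : V ⊕ V → _ := fun u => comp (relabel B e f) (u.map e f)
  obtain ⟨g, hg⟩ := exists_comp_lift (B := B) (F := F) (by
    intro c v
    simp only [F, Sum.map_inl, Sum.map_inr]
    rw [comp_edge _ c]
    simp [relabel])
  refine Nat.card_le_card_of_surjective g fun C => ?_
  induction C using SimpleGraph.ConnectedComponent.ind with | _ u => ?_
  refine ⟨comp B (u.map e.symm f.symm), ?_⟩
  rw [hg]
  rcases u with u | u <;> simp [F]

theorem numComponents_relabel [Finite V] {V' : Type} (B : ColoredGraph D V) (e f : V ≃ V') :
    numComponents (relabel B e f) = numComponents B := by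
  have := Finite.of_equiv V e
  refine (numComponents_relabel_le B e f).antisymm ?_
  have h : relabel (relabel B e f) e.symm f.symm = B :=
    funext fun c => Equiv.ext fun v => by simp [relabel]
  simpa only [h] using numComponents_relabel_le (relabel B e f) e.symm f.symm

end Components

/-! ### Cycle counts under transpositions and removal of a point. -/

section Cycles

variable {V X : Type}

theorem eq_of_sameCycle {f : Equiv.Perm V} {α : Type*} {F : V → α} (h : ∀ v, F (f v) = F v)
    {u v : V} (huv : f.SameCycle u v) : F u = F v := by
  obtain ⟨n, rfl⟩ := huv
  have hinv : ∀ v, F (f⁻¹ v) = F v := fun v => by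
    rw [← h (f⁻¹ v)]; simp
  induction n with
  | zero => rfl
  | succ n ih => rw [add_comm, zpow_add, zpow_one, Equiv.Perm.mul_apply, h]; exact ih
  | pred n ih =>
    rw [sub_eq_add_neg, add_comm, zpow_add, zpow_neg_one, Equiv.Perm.mul_apply, hinv]; exact ih

/-- The cycle of a permutation through a point. -/
abbrev cyc (f : Equiv.Perm V) (v : V) : Quotient (Equiv.Perm.SameCycle.setoid f) := Quotient.mk _ v

theorem cyc_apply (f : Equiv.Perm V) (v : V) : cyc f (f v) = cyc f v :=
  Quotient.sound (Equiv.Perm.sameCycle_apply_left.2 (Equiv.Perm.SameCycle.refl f v))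

theorem exists_cyc_lift {f : Equiv.Perm V} {α : Type*} {F : V → α} (h : ∀ v, F (f v) = F v) :
    ∃ g : Quotient (Equiv.Perm.SameCycle.setoid f) → α, ∀ v, g (cyc f v) = F v :=
  ⟨Quotient.lift F fun _ _ huv => eq_of_sameCycle h huv, fun _ => rfl⟩

theorem numCycles_one [Finite V] : numCycles (1 : Equiv.Perm V) = Nat.card V := by
  have h1 : Function.Surjective (cyc (1 : Equiv.Perm V)) := Quotient.mk_surjective
  obtain ⟨g, hg⟩ := exists_cyc_lift (f := (1 : Equiv.Perm V)) (F := id) (fun _ => rfl)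
  exact (Nat.card_le_card_of_surjective _ h1).antisymm
    (Nat.card_le_card_of_surjective g fun v => ⟨_, hg v⟩)

theorem numCycles_conj_le {V' : Type} [Finite V] (f : Equiv.Perm V) (e : V ≃ V') :
    numCycles ((e.symm.trans f).trans e) ≤ numCycles f := by
  obtain ⟨g, hg⟩ := exists_cyc_lift (f := f) (F := fun v => cyc ((e.symm.trans f).trans e) (e v))
    (fun v => by rw [← cyc_apply _ (e v)]; simp)
  refine Nat.card_le_card_of_surjective g fun C => ?_
  obtain ⟨v, rfl⟩ := Quotient.mk_surjective C
  exact ⟨cyc f (e.symm v), by rw [hg]; simp⟩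

theorem numCycles_conj {V' : Type} [Finite V] (f : Equiv.Perm V) (e : V ≃ V') :
    numCycles ((e.symm.trans f).trans e) = numCycles f := by
  have := Finite.of_equiv V e
  refine (numCycles_conj_le f e).antisymm ?_
  have h : (e.symm.symm.trans ((e.symm.trans f).trans e)).trans e.symm = f :=
    Equiv.ext fun v => by simp
  simpa only [h] using numCycles_conj_le ((e.symm.trans f).trans e) e.symm

/-- A transposition merges two cycles or splits one. The cycles of `f` map to those of the product
once the cycles of `u` and `v` are identified, and only the cycle of `u` may be missed. -/
theorem numCycles_swap_mul_le [Finite V] [DecidableEq V] (f : Equiv.Perm V) (u v : V) :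
    numCycles (Equiv.swap u v * f) ≤ numCycles f + 1 := by
  classical
  set h := Equiv.swap u v * f with hh
  obtain ⟨g, hg⟩ := exists_cyc_lift (f := f)
    (F := fun y => if cyc h y = cyc h u then cyc h v else cyc h y) (by
      intro y
      have h1 := cyc_apply h y
      by_cases hu : f y = u
      · have : h y = v := by simp [hh, hu]
        rw [this] at h1
        simp [hu, ← h1]
      by_cases hv : f y = v
      · have : h y = u := by simp [hh, hv]
        rw [this] at h1
        simp [hv, ← h1]
      · have : h y = f y := by simp [hh, Equiv.swap_apply_of_ne_of_ne hu hv]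
        rw [this] at h1
        rw [h1])
  rw [numCycles, numCycles, ← Finite.card_option]
  refine Nat.card_le_card_of_surjective (fun o : Option _ => o.elim (cyc h u) g) fun C => ?_
  obtain ⟨y, rfl⟩ := Quotient.mk_surjective C
  by_cases hy : cyc h y = cyc h u
  · exact ⟨none, hy.symm⟩
  · exact ⟨some (cyc f y), by simp only [Option.elim_some]; rw [hg, if_neg hy]⟩

theorem numCycles_removeNone_of_ne [Finite X] (f : Equiv.Perm (Option X)) (h : f none ≠ none) :
    numCycles f = numCycles (Equiv.removeNone f) := by
  obtain ⟨y₀, hy₀⟩ := Option.ne_none_iff_exists'.mp h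
  refine le_antisymm ?_ ?_
  · obtain ⟨g, hg⟩ := exists_cyc_lift (f := Equiv.removeNone f) (F := fun y => cyc f (some y)) (by
      intro y
      rcases hy : f (some y) with _ | z
      · rw [Equiv.removeNone_none _ hy, cyc_apply, ← hy, cyc_apply]
      · rw [Equiv.removeNone_some _ ⟨z, hy⟩, cyc_apply])
    refine Nat.card_le_card_of_surjective g fun C => ?_
    obtain ⟨y, rfl⟩ := Quotient.mk_surjective C
    rcases y with _ | y
    · exact ⟨cyc _ y₀, by rw [hg, ← hy₀, cyc_apply]⟩
    · exact ⟨cyc _ y, hg y⟩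
  · obtain ⟨g, hg⟩ := exists_cyc_lift (f := f)
      (F := fun o => cyc (Equiv.removeNone f) (o.elim y₀ id)) (by
        rintro (_ | y)
        · simp [hy₀]
        · rcases hy : f (some y) with _ | z
          · have := Equiv.removeNone_none _ hy
            rw [hy₀] at this
            rw [← Option.some_injective _ this]
            exact cyc_apply _ y
          · have := Equiv.removeNone_some _ ⟨z, hy⟩
            rw [hy] at this
            rw [← Option.some_injective _ this]
            exact cyc_apply _ y)
    refine Nat.card_le_card_of_surjective g fun C => ?_
    obtain ⟨y, rfl⟩ := Quotient.mk_surjective C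
    exact ⟨cyc f (some y), hg _⟩

theorem numCycles_removeNone_of_eq [Finite X] (f : Equiv.Perm (Option X)) (h : f none = none) :
    numCycles f = numCycles (Equiv.removeNone f) + 1 := by
  have hs : ∀ y, some (Equiv.removeNone f y) = f (some y) := fun y =>
    Equiv.removeNone_some _ (Option.ne_none_iff_exists'.mp fun h' => by
      simpa using f.injective (h'.trans h.symm))
  rw [numCycles, numCycles, ← Finite.card_option]
  refine le_antisymm ?_ ?_
  · obtain ⟨g, hg⟩ := exists_cyc_lift (f := Equiv.removeNone f) (F := fun y => cyc f (some y))
      (fun y => by rw [hs, cyc_apply])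
    refine Nat.card_le_card_of_surjective (fun o : Option _ => o.elim (cyc f none) g) fun C => ?_
    obtain ⟨y, rfl⟩ := Quotient.mk_surjective C
    rcases y with _ | y
    · exact ⟨none, rfl⟩
    · exact ⟨some (cyc _ y), hg y⟩
  · obtain ⟨g, hg⟩ := exists_cyc_lift (f := f)
      (F := fun o : Option X => o.map (cyc (Equiv.removeNone f))) (by
        rintro (_ | y)
        · simp [h]
        · rw [← hs]; simp [cyc_apply])
    refine Nat.card_le_card_of_surjective g fun C => ?_
    rcases C with _ | C
    · exact ⟨cyc f none, hg _⟩
    · obtain ⟨y, rfl⟩ := Quotient.mk_surjective C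
      exact ⟨cyc f (some y), hg _⟩

end Cycles

/-! ### The scaling of the contributions to a melonic bubble -/

section Scaling

variable {D : ℕ} {V X : Type}

theorem removeNone_eq_of_none {f : Equiv.Perm (Option X)} {σ : Equiv.Perm X} (h : f none = none)
    (hσ : Equiv.removeNone f = σ) : f = Equiv.optionCongr σ := by
  subst hσ
  refine Equiv.ext fun o => ?_
  rcases o with _ | x
  · simp [h]
  · have : ∃ x', f (some x) = some x' := Option.ne_none_iff_exists'.mp fun h' => by
      simpa using f.injective (h'.trans h.symm)
    rw [← Equiv.removeNone_some _ this]; rfl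

/-- The two permutations differ at `none` and at its preimage only. This is the origin of the two
non-canonical pairs and of the transposition in `B_{4,{c}}`. -/
theorem ncard_ne_of_removeNone {f : Equiv.Perm (Option X)} {σ : Equiv.Perm X} (h : f none ≠ none)
    (hσ : Equiv.removeNone f = σ) : {v | f v ≠ Equiv.optionCongr σ v}.ncard = 2 := by
  subst hσ
  have : {v | f v ≠ Equiv.optionCongr (Equiv.removeNone f) v} = {none, f.symm none} := by
    ext o
    simp only [Set.mem_ofPred_eq, Set.mem_insert_iff, Set.mem_singleton_iff]
    rcases o with _ | x
    · simp [h]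
    · rcases hx : f (some x) with _ | y
      · have h2 : some x = f.symm none := by rw [← hx]; simp
        exact iff_of_true (by simp) (Or.inr h2)
      · have h1 := Equiv.removeNone_some _ ⟨y, hx⟩
        rw [hx] at h1
        have h2 : some x ≠ f.symm none := fun h' => by rw [h'] at hx; simp at hx
        simp [h1, h2]
  rw [this, Set.ncard_pair]
  intro h'
  apply h
  conv_lhs => rw [h']
  simp

theorem ncard_ne_conj {V' : Type} (σ τ : Equiv.Perm V) (e f : V ≃ V') :
    {v | ((e.symm.trans τ).trans f) v ≠ ((e.symm.trans σ).trans f) v}.ncard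
      = {v | τ v ≠ σ v}.ncard := by
  rw [← Set.ncard_image_of_injective {v | τ v ≠ σ v} e.injective]
  congr 1
  ext v
  simp only [Equiv.trans_apply, ne_eq, EmbeddingLike.apply_eq_iff_eq, Set.mem_ofPred_eq,
    Set.mem_image]
  constructor
  · intro h; exact ⟨e.symm v, h, by simp⟩
  · rintro ⟨w, hw, rfl⟩; simpa using hw

theorem ncard_ne_optionCongr (σ τ : Equiv.Perm V) :
    {v | Equiv.optionCongr τ v ≠ Equiv.optionCongr σ v}.ncard = {v | τ v ≠ σ v}.ncard := by
  rw [← Set.ncard_image_of_injective {v | τ v ≠ σ v} (Option.some_injective V)]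
  congr 1
  ext v
  rcases v with _ | v <;> simp

theorem removeNone_optionCongr_inv_mul (b : Equiv.Perm X) (f : Equiv.Perm (Option X)) :
    Equiv.removeNone ((Equiv.optionCongr b)⁻¹ * f) = b⁻¹ * Equiv.removeNone f := by
  refine Equiv.ext fun x => Option.some_injective _ ?_
  have hb : ∀ o, (Equiv.optionCongr b)⁻¹ o = o.map (b⁻¹ : Equiv.Perm X) := fun o => by
    rw [Equiv.Perm.inv_eq_iff_eq]; rcases o with _ | o <;> simp
  rcases hx : f (some x) with _ | y
  · rw [Equiv.removeNone_none _ (by rw [Equiv.Perm.mul_apply, hb, hx]; rfl), Equiv.Perm.mul_apply, hb,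
      ← Equiv.removeNone_none _ hx]
    rfl
  · rw [Equiv.removeNone_some _ ⟨b⁻¹ y, by rw [Equiv.Perm.mul_apply, hb, hx]; rfl⟩, Equiv.Perm.mul_apply, hb,
      ← Equiv.removeNone_some _ ⟨y, hx⟩]
    rfl

theorem optionCongr_inv_mul_none (b : Equiv.Perm X) (f : Equiv.Perm (Option X)) :
    ((Equiv.optionCongr b)⁻¹ * f) none = none ↔ f none = none := by
  rw [Equiv.Perm.mul_apply, Equiv.Perm.inv_eq_iff_eq]
  simp

theorem numCycles_optionCongr_inv_mul [Finite X] (b : Equiv.Perm X) (f : Equiv.Perm (Option X))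
    [Decidable (f none = none)] :
    numCycles ((Equiv.optionCongr b)⁻¹ * f)
      = numCycles (b⁻¹ * Equiv.removeNone f) + if f none = none then 1 else 0 := by
  split_ifs with h
  · rw [numCycles_removeNone_of_eq _ ((optionCongr_inv_mul_none b f).2 h),
      removeNone_optionCongr_inv_mul]
  · rw [numCycles_removeNone_of_ne _ fun h' => h ((optionCongr_inv_mul_none b f).1 h'),
      removeNone_optionCongr_inv_mul, add_zero]

/-- In the dipole color, the insertion changes the face permutation by one transposition, so faces
are counted by the effect of a swap on cycles. -/
theorem insertDipole_inv_mul [DecidableEq V] (B : ColoredGraph D V) (c : Fin D) (v : V)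
    (f : Equiv.Perm (Option V)) :
    (insertDipole B c v c)⁻¹ * f
      = Equiv.swap none (some v) * ((Equiv.optionCongr (B c))⁻¹ * f) := by
  have : insertDipole B c v c = Equiv.optionCongr (B c) * Equiv.swap none (some v) := by
    simp [insertDipole]; rfl
  rw [this, mul_inv_rev, Equiv.swap_inv, mul_assoc]

/-- The transposition inserts the fixed point `none` into the cycle through `v`, and removing `none`
undoes this. -/
theorem numCycles_insertDipole_eq [Finite V] [DecidableEq V] (B : ColoredGraph D V) (c : Fin D)
    (v : V) (f : Equiv.Perm (Option V)) (hf : f none = none) :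
    numCycles ((insertDipole B c v c)⁻¹ * f) = numCycles ((B c)⁻¹ * Equiv.removeNone f) := by
  rw [insertDipole_inv_mul, ← removeNone_optionCongr_inv_mul]
  have h0 := (optionCongr_inv_mul_none (B c) f).2 hf
  set h := (Equiv.optionCongr (B c))⁻¹ * f
  rw [numCycles_removeNone_of_ne _ (by simp [h0])]
  congr 1
  refine Equiv.ext fun x => Option.some_injective _ ?_
  have hx : ∃ y, h (some x) = some y := Option.ne_none_iff_exists'.mp fun h' => by
    simpa using h.injective (h'.trans h0.symm)
  rw [Equiv.removeNone_some _ hx]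
  obtain ⟨y, hy⟩ := hx
  by_cases hyv : y = v
  · subst hyv
    rw [Equiv.removeNone_none _ (by simp [hy])]
    simp [h0, hy]
  · have : (Equiv.swap none (some v) * h) (some x) = some y := by
      rw [Equiv.Perm.mul_apply, hy, Equiv.swap_apply_of_ne_of_ne (by simp) (by simpa using hyv)]
    rw [Equiv.removeNone_some _ ⟨y, this⟩, this, hy]

theorem numCycles_insertDipole_le [Finite V] [DecidableEq V] (B : ColoredGraph D V) (c : Fin D)
    (v : V) (f : Equiv.Perm (Option V)) (hf : f none ≠ none) :
    numCycles ((insertDipole B c v c)⁻¹ * f) ≤ numCycles ((B c)⁻¹ * Equiv.removeNone f) + 1 := by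
  rw [insertDipole_inv_mul, ← removeNone_optionCongr_inv_mul]
  rw [← numCycles_removeNone_of_ne _ fun h' => hf ((optionCongr_inv_mul_none (B c) f).1 h')]
  exact numCycles_swap_mul_le _ _ _

/-- A color other than `c` gains a face when `g` joins the new pair in that color; the color `c` can
gain one only when `g` does not. The single equivalence in the indicator encodes both cases. -/
theorem numFaces_insertDipole_le [Finite V] [DecidableEq V] (B : ColoredGraph D V) (c : Fin D)
    (v : V) (g : ColoredGraph D (Option V)) :
    numFaces (insertDipole B c v) g ≤ numFaces B (contract g)
      + ∑ c', if (c' = c ↔ g c' none ≠ none) then 1 else 0 := by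
  classical
  rw [numFaces, numFaces, ← Finset.sum_add_distrib]
  refine Finset.sum_le_sum fun c' _ => ?_
  by_cases hc : c' = c
  · subst hc
    by_cases hf : g c' none = none
    · rw [numCycles_insertDipole_eq _ _ _ _ hf]; simp [contract]
    · simpa [hf, contract] using numCycles_insertDipole_le B c' v _ hf
  · rw [insertDipole, if_neg hc, numCycles_optionCongr_inv_mul]
    simp [hc, contract]

theorem numFaces_insertDipole_of_none [Finite V] [DecidableEq V] (B : ColoredGraph D V) (c : Fin D)
    (v : V) (g : ColoredGraph D (Option V)) (hg : ∀ c', g c' none = none) :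
    numFaces (insertDipole B c v) g + 1 = numFaces B (contract g) + D := by
  classical
  have : ∀ c', numCycles ((insertDipole B c v c')⁻¹ * g c') + (if c' = c then 1 else 0)
      = numCycles ((B c')⁻¹ * contract g c') + 1 := by
    intro c'
    by_cases hc : c' = c
    · subst hc
      rw [numCycles_insertDipole_eq _ _ _ _ (hg c')]; simp [contract]
    · rw [insertDipole, if_neg hc, numCycles_optionCongr_inv_mul]
      simp [hc, contract, hg]
  have h2 := Finset.sum_congr rfl fun c' (_ : c' ∈ Finset.univ) => this c'
  rw [Finset.sum_add_distrib, Finset.sum_add_distrib] at h2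
  simpa [numFaces] using h2

theorem numFaces_relabel [Finite V] {V' : Type} (B : ColoredGraph D V) (e f : V ≃ V')
    (g : ColoredGraph D V) : numFaces (relabel B e f) (relabel g e f) = numFaces B g := by
  refine Finset.sum_congr rfl fun c _ => ?_
  rw [← numCycles_conj ((B c)⁻¹ * g c) e]
  congr 1
  refine Equiv.ext fun v => ?_
  rw [Equiv.Perm.mul_apply, Equiv.Perm.inv_eq_iff_eq]
  simp [relabel]

/-- Gaussian pairings, or graphs with a single four-point component, next to the pairing `σ`. -/
def IsLeading (σ : Equiv.Perm V) (g : ColoredGraph D V) : Prop :=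
  (∃ τ : Equiv.Perm V, {v | τ v ≠ σ v}.ncard = 2 ∧ g = fun _ => τ) ∨
    ∃ (c : Fin D) (τ τ' : Equiv.Perm V), {v | τ' v ≠ τ v}.ncard = 2 ∧
      g = fun c' => if c' = c then τ' else τ

theorem IsLeading.relabel {V' : Type} {σ : Equiv.Perm V} {g : ColoredGraph D V}
    (h : IsLeading σ g) (e f : V ≃ V') :
    IsLeading ((e.symm.trans σ).trans f) (relabel g e f) := by
  rcases h with ⟨τ, h, rfl⟩ | ⟨c, τ, τ', h, rfl⟩
  · exact Or.inl ⟨(e.symm.trans τ).trans f, by rw [ncard_ne_conj, h], rfl⟩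
  · refine Or.inr ⟨c, (e.symm.trans τ).trans f, (e.symm.trans τ').trans f,
      by rw [ncard_ne_conj, h], ?_⟩
    funext c'
    simp only [RandomTensor.relabel]
    split_ifs <;> rfl

theorem IsLeading.optionCongr {σ : Equiv.Perm V} {g : ColoredGraph D V} (h : IsLeading σ g) :
    IsLeading (Equiv.optionCongr σ) fun c => Equiv.optionCongr (g c) := by
  rcases h with ⟨τ, h, rfl⟩ | ⟨c, τ, τ', h, rfl⟩
  · exact Or.inl ⟨Equiv.optionCongr τ, by rw [ncard_ne_optionCongr, h], rfl⟩
  · refine Or.inr ⟨c, Equiv.optionCongr τ, Equiv.optionCongr τ',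
      by rw [ncard_ne_optionCongr, h], ?_⟩
    funext c'
    by_cases hc : c' = c <;> simp [hc]

theorem IsMelonic.finite {B : ColoredGraph D V} {σ : Equiv.Perm V} (h : IsMelonic B σ) :
    Finite V := by
  induction h with
  | base => infer_instance
  | dipole h c v ih => infer_instance
  | relabel h e f ih => exact Finite.of_equiv _ e

/-- `F + (D-1) ρ`, which determines the exponent of the leading contribution of a graph. -/
noncomputable def weight (B g : ColoredGraph D V) : ℤ := numFaces B g + ((D : ℤ) - 1) * numComponents g

/-- The pair brings one face for each of the `D - 1` colors `≠ c`, and one component, which weighs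
`D - 1`. -/
theorem weight_insertDipole_of_none [Finite V] [DecidableEq V] (hD : 0 < D) (B : ColoredGraph D V)
    (c : Fin D) (v : V) (g : ColoredGraph D (Option V)) (hg : ∀ c', g c' none = none) :
    weight (insertDipole B c v) g = weight B (contract g) + 2 * ((D : ℤ) - 1) := by
  have h1 : (numFaces (insertDipole B c v) g : ℤ) + 1 = numFaces B (contract g) + D := by
    exact_mod_cast numFaces_insertDipole_of_none B c v g hg
  have h2 := numComponents_contract_le g
  have h3 := numComponents_le_contract_add_one hD g
  have : IsEmpty {c // g c none ≠ none} := ⟨fun c => c.2 (hg _)⟩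
  rw [Nat.card_of_isEmpty] at h2
  have h4 : (numComponents g : ℤ) = numComponents (contract g) + 1 := by omega
  rw [weight, weight, h4]
  linear_combination h1

/-- If no color of `g` joins the new pair, the gain is at most one face and one component, `1 + (D -
1)`. If some color does, no component is gained and each color gains at most one face. Both bounds
equal `D`, which is `D - 2` short of the gain `2 (D - 1)` of a pair joined in all colors. -/
theorem weight_insertDipole_le [Finite V] [DecidableEq V] (hD : 3 ≤ D) (B : ColoredGraph D V)
    (c : Fin D) (v : V) (g : ColoredGraph D (Option V)) (hg : ∃ c', g c' none ≠ none) :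
    weight (insertDipole B c v) g ≤ weight B (contract g) + D ∧
      (weight (insertDipole B c v) g = weight B (contract g) + D →
        (∀ c', c' = c ↔ g c' none ≠ none) ∨
        ((∀ c', g c' none ≠ none) ∧ numComponents g = numComponents (contract g) + 1)) := by
  classical
  have h1 := numFaces_insertDipole_le B c v g
  set δ : Fin D → ℕ := fun c' => if (c' = c ↔ g c' none ≠ none) then 1 else 0 with hδ
  have hsum : (∑ c', if (c' = c ↔ g c' none ≠ none) then 1 else 0) = ∑ c', δ c' := rfl
  rw [hsum] at h1
  have hD1 : (0 : ℤ) ≤ (D : ℤ) - 1 := by omega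
  by_cases h0 : ∀ c', g c' none ≠ none
  · have h2 : ∑ c', δ c' = 1 := by simp [hδ, h0]
    have h3 := numComponents_le_contract_add_one (by omega) g
    have h4 : (numComponents g : ℤ) ≤ numComponents (contract g) + 1 := by exact_mod_cast h3
    have h5 := mul_le_mul_of_nonneg_left h4 hD1
    have h6 : (numFaces (insertDipole B c v) g : ℤ) ≤ numFaces B (contract g) + 1 := by
      rw [h2] at h1; exact_mod_cast h1
    rw [weight, weight]
    refine ⟨by linarith, fun h7 => Or.inr ⟨h0, ?_⟩⟩
    by_contra h8
    have h9 : (numComponents g : ℤ) ≤ numComponents (contract g) := by omega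
    have := mul_le_mul_of_nonneg_left h9 hD1
    have : (3 : ℤ) ≤ D := by exact_mod_cast hD
    linarith
  · push Not at h0
    obtain ⟨c₀, hc₀⟩ := h0
    obtain ⟨c₁, hc₁⟩ := hg
    have h2 := numComponents_le_contract g (by rw [comp_edge g c₀, hc₀]) c₁ hc₁
    have h4 : (numComponents g : ℤ) ≤ numComponents (contract g) := by exact_mod_cast h2
    have h5 := mul_le_mul_of_nonneg_left h4 hD1
    have hle : ∀ c', δ c' ≤ 1 := fun c' => by simp only [hδ]; split_ifs <;> simp
    have h3 : ∑ c', δ c' ≤ D := by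
      simpa using Finset.sum_le_sum fun c' (_ : c' ∈ Finset.univ) => hle c'
    have h6 : (numFaces (insertDipole B c v) g : ℤ) ≤ numFaces B (contract g) + ∑ c', δ c' := by
      exact_mod_cast h1
    rw [weight, weight]
    have h3' : ((∑ c', δ c' : ℕ) : ℤ) ≤ D := by exact_mod_cast h3
    refine ⟨by push_cast at *; linarith, fun h7 => Or.inl fun c' => ?_⟩
    have h8 : ∑ c', δ c' = ∑ _c' : Fin D, 1 := by
      refine le_antisymm (by simpa using h3) ?_
      have : (D : ℤ) ≤ ((∑ c', δ c' : ℕ) : ℤ) := by push_cast at *; linarith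
      simpa using (by exact_mod_cast this : D ≤ ∑ c', δ c')
    have h9 := (Finset.sum_eq_sum_iff_of_le fun c' _ => hle c').1 h8 c' (Finset.mem_univ _)
    by_contra h10
    simp [hδ, h10] at h9

/-- Removing the last dipole either preserves the distance to the maximum or accounts by itself for
a distance of at least `D - 2`. In the second case, a distance of exactly `D - 2` forces the
contracted graph to be canonical and the local bound to be sharp. -/
theorem IsMelonic.weight_le (hD : 3 ≤ D) {B : ColoredGraph D V} {σ : Equiv.Perm V}
    (h : IsMelonic B σ) (g : ColoredGraph D V) :
    ((g = fun _ => σ) → weight B g = 2 * ((D : ℤ) - 1) * Nat.card V + 1) ∧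
    ((g ≠ fun _ => σ) →
      weight B g ≤ 2 * ((D : ℤ) - 1) * Nat.card V + 1 - ((D : ℤ) - 2) ∧
      (weight B g = 2 * ((D : ℤ) - 1) * Nat.card V + 1 - ((D : ℤ) - 2) → IsLeading σ g)) := by
  have hD3 : (3 : ℤ) ≤ D := by exact_mod_cast hD
  induction h with
  | base =>
    have hg : g = fun _ => 1 := Subsingleton.elim _ _
    refine ⟨fun _ => ?_, fun h => absurd hg h⟩
    subst hg
    rw [weight, numComponents_const (by omega), numFaces]
    simp [numCycles_one]; ring
  | @dipole V _ B σ h c v ih =>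
    have := h.finite
    have hcard : (Nat.card (Option V) : ℤ) = Nat.card V + 1 := by simp [Finite.card_option]
    rw [hcard]
    have hle : weight B (contract g) ≤ 2 * ((D : ℤ) - 1) * Nat.card V + 1 := by
      by_cases hc : contract g = fun _ => σ
      · exact ((ih _).1 hc).le
      · have := ((ih _).2 hc).1; linarith
    by_cases hg : ∀ c', g c' none = none
    · have hw := weight_insertDipole_of_none (by omega) B c v g hg
      have hiff : (g = fun _ => Equiv.optionCongr σ) ↔ contract g = fun _ => σ := by
        constructor
        · rintro rfl; funext c'; simp [contract]
        · intro h'; funext c'; exact removeNone_eq_of_none (hg c') (congrFun h' c')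
      have hgc : g = fun c => Equiv.optionCongr (contract g c) :=
        funext fun c' => removeNone_eq_of_none (hg c') rfl
      rw [hw]
      refine ⟨fun h1 => ?_, fun h1 => ⟨?_, fun h2 => ?_⟩⟩
      · rw [(ih _).1 (hiff.1 h1)]; ring
      · have := ((ih _).2 fun h' => h1 (hiff.2 h')).1; linarith
      · rw [hgc]
        exact (((ih _).2 fun h' => h1 (hiff.2 h')).2 (by linarith)).optionCongr
    · push Not at hg
      have hw := weight_insertDipole_le hD B c v g hg
      refine ⟨?_, fun _ => ⟨by linarith [hw.1], fun h2 => ?_⟩⟩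
      · rintro rfl; simp at hg
      · have hmax : weight B (contract g) = 2 * ((D : ℤ) - 1) * Nat.card V + 1 := by
          linarith [hw.1]
        have hσ : contract g = fun _ => σ := by
          by_contra hc
          have := ((ih _).2 hc).1; linarith
        -- Either only the color `c` crosses, or all colors cross and there are as many components
        -- as white vertices, which forces one permutation for all colors.
        rcases hw.2 (by linarith) with h3 | ⟨h3, h4⟩
        · refine Or.inr ⟨c, Equiv.optionCongr σ, g c, ncard_ne_of_removeNone ((h3 c).1 rfl)
            (congrFun hσ c), funext fun c' => ?_⟩
          by_cases hc : c' = c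
          · simp [hc]
          · rw [if_neg hc]
            exact removeNone_eq_of_none (not_not.1 fun h' => hc ((h3 c').2 h')) (congrFun hσ c')
        · rw [hσ, numComponents_const (by omega)] at h4
          have h5 := eq_of_numComponents_eq_card (B := g) (by omega)
            (by rw [h4, Finite.card_option])
          exact Or.inl ⟨g c, ncard_ne_of_removeNone (h3 c) (congrFun hσ c),
            funext fun c' => h5 c' c⟩
  | @relabel V V' B σ h e f ih =>
    have := h.finite
    set g₀ := RandomTensor.relabel g e.symm f.symm with hg₀
    have hg : g = RandomTensor.relabel g₀ e f :=
      funext fun c => Equiv.ext fun v => by simp [hg₀, RandomTensor.relabel]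
    have hiff : (g = fun _ => (e.symm.trans σ).trans f) ↔ g₀ = fun _ => σ := by
      constructor
      · intro h1; rw [hg₀, h1]
        exact funext fun c => Equiv.ext fun v => by simp [RandomTensor.relabel]
      · intro h1; rw [hg, h1]; rfl
    have hw : weight (RandomTensor.relabel B e f) g = weight B g₀ := by
      rw [hg, weight, weight, numFaces_relabel, numComponents_relabel]
    rw [hw, ← Nat.card_congr e, ne_eq, hiff]
    refine ⟨(ih g₀).1, fun h1 => ⟨((ih g₀).2 h1).1, fun h2 => ?_⟩⟩
    rw [hg]
    exact (((ih g₀).2 h1).2 h2).relabel e f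

/-- Parts are unions of components; with equal numbers they are the components, and the partition
carries no further data. -/
theorem card_quotient_part_le [Finite V] (G : DoubledGraph D V) :
    Nat.card (Quotient G.part) ≤ numComponents G.graph ∧
      (Nat.card (Quotient G.part) = numComponents G.graph →
        G = DoubledGraph.ofGraph G.graph) := by
  obtain ⟨f, hf⟩ := exists_comp_lift (B := G.graph) (F := fun u => (Quotient.mk G.part u))
    fun c v => Quotient.sound (G.compatible c v)
  have hs : Function.Surjective f := fun C => by
    obtain ⟨u, rfl⟩ := Quotient.mk_surjective C
    exact ⟨_, hf u⟩
  refine ⟨Nat.card_le_card_of_surjective f hs, fun h => ?_⟩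
  have hb : Function.Bijective f := (Nat.bijective_iff_surjective_and_card f).2 ⟨hs, h.symm⟩
  obtain ⟨g, part, hG⟩ := G
  have : part = (toSimpleGraph g).reachableSetoid := by
    ext u v
    change _ ↔ (toSimpleGraph g).Reachable u v
    rw [← SimpleGraph.ConnectedComponent.eq]
    refine ⟨fun h => hb.1 ?_, fun h => ?_⟩
    · rw [hf, hf]; exact Quotient.sound h
    · have := congrArg f h
      rw [hf, hf] at this
      exact Quotient.exact this
  subst this
  rfl

/-- Separates the cost `D` of every component beyond one per part. As `D > D - 2`, disconnected
parts never reach the subleading order, and `weight` decides the rest. -/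
theorem scalingExponent_eq (B : ColoredGraph D V) (G : DoubledGraph D V) :
    scalingExponent B G = weight B G.graph - (2 * ((D : ℤ) - 1) * Nat.card V + 1)
      - D * (numComponents G.graph - Nat.card (Quotient G.part)) := by
  rw [scalingExponent, weight]; ring

theorem card_quotient_ofGraph (g : ColoredGraph D V) :
    Nat.card (Quotient (DoubledGraph.ofGraph g).part) = numComponents g := rfl

theorem eq_mul_swap_of_ncard [Finite V] [DecidableEq V] {τ τ' : Equiv.Perm V}
    (h : {v | τ' v ≠ τ v}.ncard = 2) : ∃ v w, v ≠ w ∧ τ' = τ * Equiv.swap v w := by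
  have := Fintype.ofFinite V
  have hs : (τ⁻¹ * τ').support.card = 2 := by
    rw [← h, ← Set.ncard_coe_finset]
    congr 1
    ext v
    simp [Equiv.symm_apply_eq]
  obtain ⟨v, w, hvw, h⟩ := Equiv.Perm.card_support_eq_two.1 hs
  exact ⟨v, w, hvw, by rw [← h]; simp⟩

theorem scaling_of_melonic [Finite V] [DecidableEq V] (hD : 3 ≤ D) {B : ColoredGraph D V}
    {σ : Equiv.Perm V} (hB : IsMelonic B σ) :
    scalingExponent B (gaussianPairing D σ) = 0 ∧
      ∀ G : DoubledGraph D V, G ≠ gaussianPairing D σ →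
        scalingExponent B G ≤ -((D : ℤ) - 2) ∧
        (scalingExponent B G = -((D : ℤ) - 2) →
          IsNearlyCanonical σ G ∨ ∃ c, IsSingleFourPoint c G) := by
  have hD3 : (3 : ℤ) ≤ D := by exact_mod_cast hD
  refine ⟨?_, fun G hG => ?_⟩
  · rw [scalingExponent_eq, gaussianPairing, card_quotient_ofGraph]
    simp [DoubledGraph.ofGraph, (hB.weight_le hD _).1 rfl]
  · rw [scalingExponent_eq]
    obtain ⟨h1, h2⟩ := card_quotient_part_le G
    by_cases heq : Nat.card (Quotient G.part) = numComponents G.graph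
    · have hne : G.graph ≠ fun _ => σ := fun h => hG (by rw [h2 heq, h]; rfl)
      have h3 := (hB.weight_le hD _).2 hne
      rw [heq, sub_self, mul_zero]
      refine ⟨by linarith [h3.1], fun h4 => ?_⟩
      rw [h2 heq]
      rcases h3.2 (by linarith) with ⟨τ, hτ, hg⟩ | ⟨c, τ, τ', hτ, hg⟩
      · exact Or.inl ⟨τ, hτ, by rw [hg]; rfl⟩
      · obtain ⟨v, w, hvw, rfl⟩ := eq_mul_swap_of_ncard hτ
        exact Or.inr ⟨c, τ, v, w, hvw, by rw [hg]; rfl⟩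
    · have h3 : (Nat.card (Quotient G.part) : ℤ) + 1 ≤ numComponents G.graph := by omega
      have h4 : weight B G.graph ≤ 2 * ((D : ℤ) - 1) * Nat.card V + 1 := by
        by_cases hc : G.graph = fun _ => σ
        · exact ((hB.weight_le hD _).1 hc).le
        · have := ((hB.weight_le hD _).2 hc).1; linarith
      have h5 : (D : ℤ) * 1 ≤ D * (numComponents G.graph - Nat.card (Quotient G.part)) :=
        mul_le_mul_of_nonneg_left (by linarith) (by linarith)
      exact ⟨by linarith, fun _ => by linarith⟩

end Scaling

/-! ### Summation over internal indices -/

section Amplitude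

variable {D N : ℕ} {V X R : Type}

theorem traceOperator_relabel {V' : Type} [Fintype V] [Fintype V'] (B : ColoredGraph D V)
    (e f : V ≃ V') (a b : V' → Index D N) :
    traceOperator (relabel B e f) a b = traceOperator B (a ∘ e) (b ∘ f) := by
  refine Finset.prod_congr rfl fun c _ => ?_
  rw [← Equiv.prod_comp e]
  refine Finset.prod_congr rfl fun v _ => ?_
  simp [relabel]

/-- If the edge joins the two copies of the summed vertex, the index is free and gives `N`;
otherwise the deltas of the incoming and outgoing edges compose into one. -/
theorem sum_option_prod [Fintype X] (f : Equiv.Perm (Option X)) [Decidable (f none = none)]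
    (u v : X → Fin N) :
    ∑ i : Fin N, ∏ y : Option X, (if y.elim i u = (f y).elim i v then 1 else 0 : ℂ)
      = (if f none = none then (N : ℂ) else 1)
        * ∏ x, if u x = v (Equiv.removeNone f x) then 1 else 0 := by
  split_ifs with h
  · have : ∀ i : Fin N, (∏ y : Option X, (if y.elim i u = (f y).elim i v then 1 else 0 : ℂ))
        = ∏ x, if u x = v (Equiv.removeNone f x) then 1 else 0 := by
      intro i
      rw [Fintype.prod_option, h]
      simp only [Option.elim_none, if_true, one_mul]
      refine Finset.prod_congr rfl fun x _ => ?_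
      rw [← Equiv.removeNone_some f (Option.ne_none_iff_exists'.mp fun h' => by
        simpa using f.injective (h'.trans h.symm))]
      rfl
    rw [Finset.sum_congr rfl fun i _ => this i]
    simp
  · obtain ⟨y₀, hy₀⟩ := Option.ne_none_iff_exists'.mp h
    simp only [Fintype.prod_option, hy₀, Option.elim_none, Option.elim_some, ite_mul, one_mul,
      zero_mul, Finset.sum_ite_eq', Finset.mem_univ, if_true]
    refine Finset.prod_congr rfl fun x _ => ?_
    rcases hx : f (some x) with _ | y
    · have := Equiv.removeNone_none _ hx
      rw [hy₀] at this
      rw [Option.some_injective _ this]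
      congr
    · have := Equiv.removeNone_some _ ⟨y, hx⟩
      rw [hx] at this
      rw [Option.some_injective _ this]
      congr

theorem sum_traceOperator_option [Fintype X] (B : ColoredGraph D (Option X))
    (a b : X → Index D N) :
    ∑ i : Index D N, traceOperator B (fun o => o.elim i a) (fun o => o.elim i b)
      = (N : ℂ) ^ (Nat.card {c // B c none = none}) * traceOperator (contract B) a b := by
  classical
  have h := Finset.prod_univ_sum (fun _ : Fin D => (Finset.univ : Finset (Fin N)))
    (fun c j => ∏ o : Option X, (if o.elim j (fun x => a x c) = (B c o).elim j (fun x => b x c)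
      then 1 else 0 : ℂ))
  rw [Fintype.piFinset_univ] at h
  have h2 : ∀ (o : Option X) (i : Index D N) (a : X → Index D N) (c : Fin D),
      o.elim i a c = o.elim (i c) fun x => a x c := by
    rintro (_ | o) i a c <;> rfl
  simp only [traceOperator, h2]
  rw [← h]
  simp only [sum_option_prod, Finset.prod_mul_distrib]
  congr 1
  rw [Finset.prod_ite, Finset.prod_const_one, mul_one, Finset.prod_const, Nat.card_eq_fintype_card,
    Fintype.card_subtype]

/-- Moving `Option` out of a sum. -/
def optionSum (A R : Type) : Option A ⊕ R ≃ Option (A ⊕ R) where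
  toFun := Sum.elim (fun o => o.map Sum.inl) (fun r => some (Sum.inr r))
  invFun o := o.elim (Sum.inl none) (Sum.elim (fun a => Sum.inl (some a)) Sum.inr)
  left_inv := by rintro ((_ | a) | r) <;> rfl
  right_inv := by rintro (_ | (a | r)) <;> rfl

/-- Singling out the internal vertex `s`. -/
def pickVertex {n : ℕ} (R : Type) (s : Fin (n + 1)) : Fin (n + 1) ⊕ R ≃ Option (Fin n ⊕ R) :=
  (Equiv.sumCongr (finSuccEquiv' s) (Equiv.refl R)).trans (optionSum (Fin n) R)

theorem pickVertex_self {n : ℕ} (s : Fin (n + 1)) : pickVertex R s (Sum.inl s) = none := by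
  simp [pickVertex, optionSum]

theorem elim_insertNth {n : ℕ} (s : Fin (n + 1)) (i : Index D N) (x : Fin n → Index D N)
    (a : R → Index D N) :
    Sum.elim (Fin.insertNth (α := fun _ => Index D N) s i x) a
      = (fun o : Option (Fin n ⊕ R) => o.elim i (Sum.elim x a)) ∘ pickVertex R s := by
  funext y
  rcases y with y | r
  · rcases Fin.eq_self_or_eq_succAbove s y with rfl | ⟨j, rfl⟩ <;> simp [pickVertex, optionSum]
  · simp [pickVertex, optionSum]

theorem sum_traceOperator_succ [Fintype R] {n : ℕ} (s : Fin (n + 1))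
    (B : ColoredGraph D (Fin (n + 1) ⊕ R)) (a b : R → Index D N) :
    ∑ x : Fin (n + 1) → Index D N, traceOperator B (Sum.elim x a) (Sum.elim x b)
      = (N : ℂ) ^ (Nat.card {c // relabel B (pickVertex R s) (pickVertex R s) c none = none})
        * ∑ x : Fin n → Index D N,
          traceOperator (contract (relabel B (pickVertex R s) (pickVertex R s)))
            (Sum.elim x a) (Sum.elim x b) := by
  rw [← Equiv.sum_comp (Fin.insertNthEquiv (fun _ => Index D N) s), Fintype.sum_prod_type,
    Finset.sum_comm, Finset.mul_sum]
  refine Finset.sum_congr rfl fun x _ => ?_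
  rw [← sum_traceOperator_option]
  refine Finset.sum_congr rfl fun i _ => ?_
  rw [traceOperator_relabel, ← elim_insertNth, ← elim_insertNth]
  rfl

/-- Every sum over internal indices is a power of `N` times a trace operator. -/
theorem exists_boundary [Fintype R] (hD : 0 < D) (n : ℕ) (B : ColoredGraph D (Fin n ⊕ R)) :
    ∃ (b : ColoredGraph D R) (E : ℕ),
      (∀ (N : ℕ) (x y : R → Index D N), ∑ i : Fin n → Index D N,
        traceOperator B (Sum.elim i x) (Sum.elim i y) = (N : ℂ) ^ E * traceOperator b x y) ∧
      E + numComponents b ≤ (D - 1) * n + numComponents B := by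
  induction n with
  | zero =>
    refine ⟨relabel B (Equiv.emptySum (Fin 0) R) (Equiv.emptySum (Fin 0) R), 0, ?_, ?_⟩
    · intro N x y
      rw [Fintype.sum_unique, pow_zero, one_mul, traceOperator_relabel]
      congr 1 <;>
      · funext y
        rcases y with y | y
        · exact y.elim0
        · rfl
    · rw [numComponents_relabel]; simp
  | succ n ih =>
    set B' := relabel B (pickVertex R 0) (pickVertex R 0) with hB'
    obtain ⟨b, E, h1, h2⟩ := ih (contract B')
    refine ⟨b, Nat.card {c // B' c none = none} + E, ?_, ?_⟩
    · intro N x y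
      rw [sum_traceOperator_succ 0, h1, pow_add, mul_assoc]
    -- With `L` colors leaving the vertex there are `D - L` closed faces and at most `L - 1`
    -- additional components, so one summation raises their total by at most `D - 1`.
    · have h3 := numComponents_contract_le B'
      have h4 : Nat.card {c // B' c none = none} + Nat.card {c // B' c none ≠ none} = D := by
        classical
        rw [Nat.card_eq_fintype_card, Nat.card_eq_fintype_card, Fintype.card_subtype_compl,
          Fintype.card_fin]
        have := Fintype.card_subtype_le fun c => B' c none = none
        simp at this
        omega
      rw [hB', numComponents_relabel, ← hB'] at h3
      rw [mul_add, mul_one]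
      omega

/-- The graph obtained by adding an edge between the white and the black copy of each internal vertex
is connected. -/
def JoinConnected {n : ℕ} (B : ColoredGraph D (Fin n ⊕ R)) : Prop :=
  ∀ (α : Type) (F : (Fin n ⊕ R) ⊕ (Fin n ⊕ R) → α),
    (∀ c v, F (Sum.inl v) = F (Sum.inr (B c v))) →
    (∀ s, F (Sum.inl (Sum.inl s)) = F (Sum.inr (Sum.inl s))) → ∀ u v, F u = F v

/-- The edges of colors `c` and `c'` at the white `none` lie on one bicolored cycle. It stays in the
component of the white `none`, hence avoids the black `none`, and away from `none` its edges survive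
the contraction and transport the value of `F` from `y` to `y'`. If the values differed, the
iteration of `g` would never return to `none`, against finite order. -/
theorem apply_inr_eq_of_contract [Finite X] {B : ColoredGraph D (Option X)}
    (h : comp B (Sum.inl none) ≠ comp B (Sum.inr none)) {α : Type} {F : X ⊕ X → α}
    (hF : ∀ c v, F (Sum.inl v) = F (Sum.inr (contract B c v))) {c c' : Fin D} {y y' : X}
    (hy : B c none = some y) (hy' : B c' none = some y') : F (Sum.inr y) = F (Sum.inr y') := by
  by_contra hne
  set g : Equiv.Perm (Option X) := (B c).trans (B c').symm with hg
  let G : Option X → Prop := fun w => comp B (Sum.inl w) = comp B (Sum.inl none) ∧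
    ∃ z, B c w = some z ∧ F (Sum.inr z) = F (Sum.inr y)
  have step : ∀ w, G w → G (g w) ∧ g w ≠ none := by
    rintro w ⟨hw1, z, hw2, hw3⟩
    have h1 : B c' (g w) = B c w := by simp [hg]
    have h2 : comp B (Sum.inl (g w)) = comp B (Sum.inl none) := by
      rw [comp_edge B c', h1, ← comp_edge, hw1]
    rcases hu : g w with _ | u
    · rw [hu, hy', hw2] at h1
      rw [← Option.some_injective _ h1] at hw3
      exact absurd hw3.symm hne
    · rw [hu] at h1 h2
      refine ⟨⟨h2, ?_⟩, by simp⟩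
      rcases hz : B c (some u) with _ | z'
      · rw [comp_edge B c, hz] at h2
        exact absurd h2.symm h
      · refine ⟨z', rfl, ?_⟩
        have h3 : contract B c u = z' := Option.some_injective _ <| by
          rw [contract, Equiv.removeNone_some _ ⟨z', hz⟩, hz]
        have h4 : contract B c' u = z := Option.some_injective _ <| by
          rw [contract, Equiv.removeNone_some _ ⟨z, h1.trans hw2⟩, h1, hw2]
        rw [← hw3, ← h3, ← h4, ← hF, ← hF]
  have hG : ∀ n : ℕ, G ((g ^ n) none) := by
    intro n
    induction n with
    | zero => exact ⟨rfl, y, hy, rfl⟩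
    | succ n ih => rw [pow_succ', Equiv.Perm.mul_apply]; exact (step _ ih).1
  obtain ⟨n, hn, hgn⟩ := isOfFinOrder_iff_pow_eq_one.1 (isOfFinOrder_of_finite g)
  obtain ⟨m, rfl⟩ := Nat.exists_eq_succ_of_ne_zero hn.ne'
  have := (step _ (hG m)).2
  rw [← Equiv.Perm.mul_apply, ← pow_succ', hgn] at this
  exact this rfl

/-- `F` extends to the deleted pair by its value at the black neighbours of the white `none`. These
values agree by `apply_inr_eq_of_contract`, which is where the two copies must lie in different
components. -/
theorem JoinConnected.contract [Finite R] (hD : 0 < D) {n : ℕ}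
    {B : ColoredGraph D (Fin (n + 1) ⊕ R)}
    (hB : JoinConnected B) (s : Fin (n + 1))
    (h : comp (relabel B (pickVertex R s) (pickVertex R s)) (Sum.inl none)
      ≠ comp (relabel B (pickVertex R s) (pickVertex R s)) (Sum.inr none)) :
    JoinConnected (contract (relabel B (pickVertex R s) (pickVertex R s))) := by
  intro α F h1 h2
  set e := pickVertex R s with he
  set B' := relabel B e e with hB'
  have hne : ∀ c, B' c none ≠ none := fun c h' => h (by rw [comp_edge B' c, h'])
  obtain ⟨y₀, hy₀⟩ := Option.ne_none_iff_exists'.mp (hne ⟨0, hD⟩)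
  have hval : ∀ c y, B' c none = some y → F (Sum.inr y) = F (Sum.inr y₀) := fun c y hy =>
    apply_inr_eq_of_contract h h1 hy hy₀
  let F' : Option (Fin n ⊕ R) ⊕ Option (Fin n ⊕ R) → α := Sum.elim
    (fun o => o.elim (F (Sum.inr y₀)) fun u => F (Sum.inl u))
    (fun o => o.elim (F (Sum.inr y₀)) fun u => F (Sum.inr u))
  have hF' : ∀ c v, F' (Sum.inl v) = F' (Sum.inr (B' c v)) := by
    intro c v
    rcases v with _ | v
    · obtain ⟨y, hy⟩ := Option.ne_none_iff_exists'.mp (hne c)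
      rw [hy]
      exact (hval c y hy).symm
    · rcases hv : B' c (some v) with _ | y
      · change F (Sum.inl v) = F (Sum.inr y₀)
        rw [h1 c v]
        exact hval c _ (Equiv.removeNone_none _ hv).symm
      · change F (Sum.inl v) = F (Sum.inr y)
        rw [h1 c v]
        congr 2
        apply Option.some_injective
        rw [RandomTensor.contract, Equiv.removeNone_some _ ⟨y, hv⟩, hv]
  have key := hB α (fun u => F' (u.map e e)) (fun c v => by
    have := hF' c (e v)
    simp only [hB', relabel, Equiv.trans_apply, Equiv.symm_apply_apply] at this
    exact this) (fun t => by
    simp only [Sum.map_inl, Sum.map_inr]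
    rcases ht : e (Sum.inl t) with _ | (t' | r)
    · rfl
    · exact h2 t'
    · exfalso
      have : Sum.inl t = e.symm (some (Sum.inr r)) := by rw [← ht]; simp
      simp [he, pickVertex, optionSum] at this)
  have key2 : ∀ u v, F' u = F' v := fun u v => by
    have := key (u.map e.symm e.symm) (v.map e.symm e.symm)
    have h3 : ∀ u : Option (Fin n ⊕ R) ⊕ Option (Fin n ⊕ R),
        (u.map e.symm e.symm).map e e = u := by
      rintro (u | u) <;> simp
    simpa only [h3] using this
  intro u v
  have h4 : ∀ u : (Fin n ⊕ R) ⊕ (Fin n ⊕ R), F u = F' (u.map some some) := by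
    rintro (u | u) <;> rfl
  rw [h4, h4, key2]

/-- The exponent of `N` in the amplitude of a connected graph. -/
theorem exists_boundary_of_joinConnected [Fintype R] (hD : 0 < D) (n : ℕ)
    (B : ColoredGraph D (Fin n ⊕ R)) (hB : JoinConnected B) :
    ∃ (b : ColoredGraph D R) (E : ℕ),
      (∀ (N : ℕ) (x y : R → Index D N), ∑ i : Fin n → Index D N,
        traceOperator B (Sum.elim i x) (Sum.elim i y) = (N : ℂ) ^ E * traceOperator b x y) ∧
      E + numComponents b + (D - 1) * numComponents B ≤ (D - 1) * n + D := by
  induction n with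
  | zero =>
    obtain ⟨b, E, h1, h2⟩ := exists_boundary hD 0 B
    refine ⟨b, E, h1, ?_⟩
    have : numComponents B ≤ 1 := by
      rw [numComponents, Finite.card_le_one_iff_subsingleton]
      refine ⟨fun C C' => ?_⟩
      induction C using SimpleGraph.ConnectedComponent.ind
      induction C' using SimpleGraph.ConnectedComponent.ind
      exact hB _ (comp B) (comp_edge B) (fun s => s.elim0) _ _
    have h3 : (D - 1) * numComponents B ≤ D - 1 := by
      simpa using Nat.mul_le_mul_left (D - 1) this
    omega
  | succ n ih =>
    -- Vertices whose copies lie in different components are summed first: they close no face, and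
    -- the loss of at most one component is paid for by the decrease of `n`. When none is left,
    -- `JoinConnected` means that the graph is connected.
    by_cases hs : ∃ s : Fin (n + 1), comp (relabel B (pickVertex R s) (pickVertex R s)) (Sum.inl none)
      ≠ comp (relabel B (pickVertex R s) (pickVertex R s)) (Sum.inr none)
    · obtain ⟨s, hs⟩ := hs
      set B' := relabel B (pickVertex R s) (pickVertex R s) with hB'
      obtain ⟨b, E, h1, h2⟩ := ih _ (hB.contract hD s hs)
      have : IsEmpty {c // B' c none = none} := ⟨fun c => hs (by rw [comp_edge B' c, c.2])⟩
      refine ⟨b, E, fun N x y => ?_, ?_⟩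
      · rw [sum_traceOperator_succ s, h1, ← hB', Nat.card_of_isEmpty, pow_zero, one_mul]
      · have h3 := numComponents_le_contract_add_one hD B'
        rw [hB', numComponents_relabel, ← hB'] at h3
        have h4 := Nat.mul_le_mul_left (D - 1) h3
        rw [← hB'] at h2
        rw [mul_add, mul_one] at h4 ⊢
        omega
    · push Not at hs
      obtain ⟨b, E, h1, h2⟩ := exists_boundary hD _ B
      refine ⟨b, E, h1, ?_⟩
      have : numComponents B ≤ 1 := by
        rw [numComponents, Finite.card_le_one_iff_subsingleton]
        refine ⟨fun C C' => ?_⟩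
        induction C using SimpleGraph.ConnectedComponent.ind
        induction C' using SimpleGraph.ConnectedComponent.ind
        refine hB _ (comp B) (comp_edge B) (fun s => ?_) _ _
        have := hs s
        set e := pickVertex R s with he
        obtain ⟨g, hg⟩ := exists_comp_lift (B := relabel B e e)
          (F := fun u => comp B (u.map e.symm e.symm)) (by
            intro c v
            simp only [Sum.map_inl, Sum.map_inr]
            rw [comp_edge _ c]; simp [relabel])
        have h3 := congrArg g this
        rw [hg, hg] at h3
        have h4 : e.symm none = Sum.inl s := by
          rw [Equiv.symm_apply_eq, he, pickVertex_self]
        simpa only [Sum.map_inl, Sum.map_inr, h4] using h3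
      have h3 : (D - 1) * numComponents B ≤ D - 1 := by
        simpa using Nat.mul_le_mul_left (D - 1) this
      omega

end Amplitude

/-! ### Joint cumulants -/

section Cumulants

variable {Λ A R : Type*} [dΛ : DecidableEq Λ] [CommRing R]

/-- The joint cumulant attached to a family of joint moments `m`. -/
def jointCumulant (m : Finset Λ → R) (S : Finset Λ) : R :=
  ∑ π : Finpartition S, ((-1) ^ (π.parts.card - 1) * ((π.parts.card - 1).factorial : R))
    * ∏ s ∈ π.parts, m s

/-- The subsets of `S` that contain `x`. -/
def rootedSubsets (S : Finset Λ) (x : Λ) : Finset (Finset Λ) := S.powerset.filter (x ∈ ·)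

theorem mem_rootedSubsets {S b : Finset Λ} {x : Λ} : b ∈ rootedSubsets S x ↔ b ⊆ S ∧ x ∈ b := by
  simp [rootedSubsets]

theorem sum_finpartition_of_mem {M : Type*} [AddCommMonoid M] (S b : Finset Λ) (hb : b.Nonempty)
    (hbS : b ⊆ S) (f : Finset (Finset Λ) → M) :
    ∑ π : Finpartition S with b ∈ π.parts, f π.parts
      = ∑ π : Finpartition (S \ b), f (insert b π.parts) := by
  have hnot : ∀ π : Finpartition (S \ b), b ∉ π.parts := fun π h => by
    obtain ⟨x, hx⟩ := hb
    exact (Finset.mem_sdiff.1 (π.le h hx)).2 hx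
  refine Finset.sum_bij'
    (i := fun π hπ => Finpartition.ofExistsUnique (π.parts.erase b) (s := S \ b) ?_ ?_ ?_)
    (j := fun π _ => π.extend (b := b) (c := S) hb.ne_empty Finset.sdiff_disjoint
      (by simpa using hbS)) ?_ ?_ ?_ ?_ ?_
  · intro p hp x hx
    have hπ' := (Finset.mem_filter.1 hπ).2
    refine Finset.mem_sdiff.2 ⟨π.le (Finset.mem_of_mem_erase hp) hx, fun hxb => ?_⟩
    exact Finset.ne_of_mem_erase hp (π.eq_of_mem_parts (Finset.mem_of_mem_erase hp) hπ' hx hxb)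
  · intro x hx
    rw [Finset.mem_sdiff] at hx
    obtain ⟨t, ⟨ht, hxt⟩, huniq⟩ := π.existsUnique_mem hx.1
    refine ⟨t, ⟨Finset.mem_erase.2 ⟨fun h => hx.2 (h ▸ hxt), ht⟩, hxt⟩, fun t' ht' => ?_⟩
    exact huniq t' ⟨Finset.mem_of_mem_erase ht'.1, ht'.2⟩
  · exact fun h => π.empty_notMem_parts (Finset.mem_of_mem_erase h)
  · simp
  · intro π _
    simp [Finpartition.extend]
  · intro π hπ
    ext1
    simp [Finpartition.extend, Finpartition.ofExistsUnique,
      Finset.insert_erase (Finset.mem_filter.1 hπ).2]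
  · intro π hπ
    ext1
    simp [Finpartition.extend, Finpartition.ofExistsUnique, Finset.erase_insert (hnot π)]
  · intro π hπ
    simp [Finpartition.ofExistsUnique, Finset.insert_erase (Finset.mem_filter.1 hπ).2]

theorem sum_finpartition_rooted {M : Type*} [AddCommMonoid M] {S : Finset Λ} {x : Λ} (hx : x ∈ S)
    (f : Finset (Finset Λ) → M) :
    ∑ π : Finpartition S, f π.parts
      = ∑ b ∈ rootedSubsets S x, ∑ π : Finpartition (S \ b), f (insert b π.parts) := by
  have h1 : ∀ b ∈ rootedSubsets S x, ∑ π : Finpartition (S \ b), f (insert b π.parts)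
      = ∑ π : Finpartition S, if b ∈ π.parts then f π.parts else 0 := by
    intro b hb
    rw [mem_rootedSubsets] at hb
    rw [← sum_finpartition_of_mem S b ⟨x, hb.2⟩ hb.1, Finset.sum_filter]
  rw [Finset.sum_congr rfl h1, Finset.sum_comm]
  refine Finset.sum_congr rfl fun π _ => ?_
  rw [Finset.sum_eq_single (π.part x)]
  · rw [if_pos (π.part_mem.2 hx)]
  · intro b hb hne
    rw [if_neg]
    intro hbπ
    exact hne (π.part_eq_of_mem hbπ (mem_rootedSubsets.1 hb).2).symm
  · intro h
    exact absurd (mem_rootedSubsets.2 ⟨π.part_subset x, (π.mem_part_self).2 hx⟩) h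

/-- Both sides sum over partitions with a marked block avoiding `x`, of which each partition has one
fewer than its number of blocks. -/
theorem sum_finpartition_unrooted {M : Type*} [AddCommMonoid M] {S : Finset Λ} {x : Λ}
    (hx : x ∈ S) (f : Finset (Finset Λ) → M) :
    ∑ b ∈ (rootedSubsets S x).erase S, ∑ π : Finpartition b, f (insert (S \ b) π.parts)
      = ∑ π : Finpartition S, (π.parts.card - 1) • f π.parts := by
  have h1 : ∀ b ∈ (rootedSubsets S x).erase S,
      ∑ π : Finpartition b, f (insert (S \ b) π.parts)
      = ∑ π : Finpartition S, if S \ b ∈ π.parts then f π.parts else 0 := by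
    intro b hb
    rw [Finset.mem_erase, mem_rootedSubsets] at hb
    have h2 : S \ (S \ b) = b := by simpa using hb.2.1
    have h3 := sum_finpartition_of_mem S (S \ b)
      (Finset.sdiff_nonempty.2 fun h => hb.1 (hb.2.1.antisymm h)) Finset.sdiff_subset f
    rw [h2] at h3
    rw [← h3, Finset.sum_filter]
  rw [Finset.sum_congr rfl h1, Finset.sum_comm]
  refine Finset.sum_congr rfl fun π _ => ?_
  rw [← Finset.card_erase_of_mem (π.part_mem.2 hx), ← Finset.sum_const, ← Finset.sum_filter]
  refine Finset.sum_bij' (fun b _ => S \ b) (fun b _ => S \ b) ?_ ?_ ?_ ?_ ?_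
  · intro b hb
    simp only [Finset.mem_filter, Finset.mem_erase, mem_rootedSubsets] at hb ⊢
    refine ⟨fun h => ?_, hb.2⟩
    have := (π.mem_part_self).2 hx
    rw [← h] at this
    exact (Finset.mem_sdiff.1 this).2 hb.1.2.2
  · intro b hb
    simp only [Finset.mem_filter, Finset.mem_erase, mem_rootedSubsets] at hb ⊢
    have hbS := π.subset hb.2
    refine ⟨⟨fun h => ?_, Finset.sdiff_subset, Finset.mem_sdiff.2 ⟨hx, fun h => ?_⟩⟩, ?_⟩
    · have := Finset.sdiff_sdiff_eq_self hbS
      rw [h, Finset.sdiff_self] at this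
      exact π.empty_notMem_parts (this ▸ hb.2)
    · exact hb.1 (π.part_eq_of_mem hb.2 h).symm
    · rw [Finset.sdiff_sdiff_eq_self hbS]; exact hb.2
  · intro b hb
    simp only [Finset.mem_filter, Finset.mem_erase, mem_rootedSubsets] at hb
    exact Finset.sdiff_sdiff_eq_self hb.1.2.1
  · intro b hb
    exact Finset.sdiff_sdiff_eq_self (π.subset (Finset.mem_of_mem_erase hb))
  · intro b hb; rfl

/-- The moments in terms of the cumulants, by the block of a given element. -/
theorem moment_eq_sum_rooted {m : Finset Λ → R} (hm : m ∅ = 1) {S : Finset Λ} {x : Λ}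
    (hx : x ∈ S) : m S = ∑ b ∈ rootedSubsets S x, jointCumulant m b * m (S \ b) := by
  have hS : S ∈ rootedSubsets S x := mem_rootedSubsets.2 ⟨subset_rfl, hx⟩
  rw [← Finset.add_sum_erase _ _ hS, Finset.sdiff_self, hm, mul_one]
  -- Here `P` is a partition of `b` together with the block `S \ b`, hence `P.card - 2`. Multiplied
  -- by the `P.card - 1` choices of the marked block, this coefficient is opposite to the one of `P`
  -- in the cumulant, so only the one-block partition survives.
  have h1 : ∀ b ∈ (rootedSubsets S x).erase S, jointCumulant m b * m (S \ b)
      = ∑ π : Finpartition b,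
        (fun P : Finset (Finset Λ) => ((-1) ^ (P.card - 2) * ((P.card - 2).factorial : R))
          * ∏ s ∈ P, m s) (insert (S \ b) π.parts) := by
    intro b hb
    rw [Finset.mem_erase, mem_rootedSubsets] at hb
    rw [jointCumulant, Finset.sum_mul]
    refine Finset.sum_congr rfl fun π _ => ?_
    have hnot : S \ b ∉ π.parts := fun h => by
      obtain ⟨y, hy⟩ := Finset.sdiff_nonempty.2 fun h => hb.1 (hb.2.1.antisymm h)
      exact (Finset.mem_sdiff.1 hy).2 (π.le h hy)
    simp only
    rw [Finset.prod_insert hnot, Finset.card_insert_of_notMem hnot]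
    rw [show π.parts.card + 1 - 2 = π.parts.card - 1 by omega]
    ring
  rw [Finset.sum_congr rfl h1, sum_finpartition_unrooted hx fun P : Finset (Finset Λ) =>
      ((-1) ^ (P.card - 2) * ((P.card - 2).factorial : R)) * ∏ s ∈ P, m s, jointCumulant,
    ← Finset.sum_add_distrib, Finset.sum_eq_single (Finpartition.indiscrete (a := S)
      (Finset.ne_empty_of_mem hx))]
  · simp [Finpartition.indiscrete]
  · intro π _ hπ
    have hcard : 2 ≤ π.parts.card := by
      by_contra hlt
      have h0 : 0 < π.parts.card := Finset.card_pos.2 ⟨_, π.part_mem.2 hx⟩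
      obtain ⟨t, ht⟩ := Finset.card_eq_one.1 (by omega : π.parts.card = 1)
      apply hπ
      ext1
      have := π.sup_parts
      rw [ht, Finset.sup_singleton, id] at this
      rw [ht, this]; rfl
    obtain ⟨k, hk⟩ := Nat.exists_eq_add_of_le hcard
    rw [hk, show 2 + k - 1 = k + 1 by omega, show 2 + k - 2 = k by omega, nsmul_eq_mul,
      Nat.factorial_succ]
    push_cast
    ring
  · simp

/-- In the recursion the term `b = S` has coefficient `m ∅ = 1`, so strong induction solves it, and
the root `x` may vary with `S`. Connected pairings, relabelled families and perturbative series are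
all recognized as cumulants this way. -/
theorem jointCumulant_unique {m c : Finset Λ → R} (hm : m ∅ = 1)
    (hc : ∀ S : Finset Λ, S.Nonempty → ∃ x ∈ S, m S = ∑ b ∈ rootedSubsets S x, c b * m (S \ b))
    {S : Finset Λ} (hS : S.Nonempty) : c S = jointCumulant m S := by
  induction S using Finset.strongInduction with
  | H S ih =>
    obtain ⟨x, hx, h1⟩ := hc S hS
    have h2 := moment_eq_sum_rooted hm hx
    have hmem : S ∈ rootedSubsets S x := mem_rootedSubsets.2 ⟨subset_rfl, hx⟩
    rw [← Finset.add_sum_erase _ _ hmem, Finset.sdiff_self, hm, mul_one] at h1 h2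
    have h3 : ∑ b ∈ (rootedSubsets S x).erase S, c b * m (S \ b)
        = ∑ b ∈ (rootedSubsets S x).erase S, jointCumulant m b * m (S \ b) := by
      refine Finset.sum_congr rfl fun b hb => ?_
      rw [Finset.mem_erase, mem_rootedSubsets] at hb
      rw [ih b (hb.2.1.ssubset_of_ne hb.1) ⟨x, hb.2.2⟩]
    rw [h3] at h1
    exact add_right_cancel (h1.symm.trans h2)

theorem moment_eq_sum_finpartition {m : Finset Λ → R} (hm : m ∅ = 1) (S : Finset Λ) :
    m S = ∑ π : Finpartition S, ∏ s ∈ π.parts, jointCumulant m s := by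
  induction S using Finset.strongInduction with
  | H S ih =>
    rcases S.eq_empty_or_nonempty with rfl | ⟨x, hx⟩
    · rw [hm]
      have : ∀ π : Finpartition (∅ : Finset Λ), π.parts = ∅ := fun π =>
        π.parts_eq_empty_iff.2 rfl
      have hu : Unique (Finpartition (∅ : Finset Λ)) :=
        inferInstanceAs (Unique (Finpartition (⊥ : Finset Λ)))
      rw [Fintype.sum_unique, this, Finset.prod_empty]
    · rw [sum_finpartition_rooted hx fun P => ∏ s ∈ P, jointCumulant m s,
        moment_eq_sum_rooted hm hx]
      refine Finset.sum_congr rfl fun b hb => ?_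
      rw [mem_rootedSubsets] at hb
      rw [ih (S \ b) (Finset.sdiff_ssubset hb.1 ⟨x, hb.2⟩), Finset.mul_sum]
      refine Finset.sum_congr rfl fun π _ => ?_
      rw [Finset.prod_insert]
      exact fun h => (Finset.mem_sdiff.1 (π.le h hb.2)).2 hb.2

theorem jointCumulant_map {Λ' : Type*} [DecidableEq Λ'] (e : Λ' ↪ Λ) {m : Finset Λ → R}
    (hm : m ∅ = 1) {S : Finset Λ'} (hS : S.Nonempty) :
    jointCumulant m (S.map e) = jointCumulant (fun s => m (s.map e)) S := by
  refine jointCumulant_unique (c := fun S => jointCumulant m (S.map e)) (by simpa using hm) ?_ hS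
  rintro S ⟨x, hx⟩
  refine ⟨x, hx, ?_⟩
  rw [moment_eq_sum_rooted hm (Finset.mem_map_of_mem e hx)]
  symm
  refine Finset.sum_bij (fun b _ => b.map e) ?_ ?_ ?_ ?_
  · intro b hb
    rw [mem_rootedSubsets] at hb ⊢
    exact ⟨Finset.map_subset_map.2 hb.1, Finset.mem_map_of_mem e hb.2⟩
  · intro b _ b' _ h
    exact Finset.map_injective e h
  · intro b hb
    rw [mem_rootedSubsets] at hb
    obtain ⟨u, hu, rfl⟩ := Finset.subset_map_iff.1 hb.1
    exact ⟨u, mem_rootedSubsets.2 ⟨hu, by simpa using hb.2⟩, rfl⟩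
  · intro b _
    simp only [Finset.map_sdiff]

variable [Fintype Λ] [CommRing A] [Algebra R A]

theorem prod_parts_update (E : A →ₗ[R] R) (π : Finpartition (Finset.univ : Finset Λ)) (i : Λ)
    (X : Λ → A) (y : A) :
    ∏ s ∈ π.parts, E (∏ x ∈ s, Function.update X i y x)
      = E (y * ∏ x ∈ (π.part i).erase i, X x)
        * ∏ s ∈ π.parts.erase (π.part i), E (∏ x ∈ s, X x) := by
  have hi : i ∈ π.part i := (π.mem_part_self).2 (Finset.mem_univ i)
  have hne : ∀ s : Finset Λ, i ∉ s → ∏ x ∈ s, Function.update X i y x = ∏ x ∈ s, X x := by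
    intro s hs
    refine Finset.prod_congr rfl fun x hx => ?_
    rw [Function.update_of_ne]
    rintro rfl; exact hs hx
  rw [← Finset.mul_prod_erase _ _ (π.part_mem.2 (Finset.mem_univ i)),
    ← Finset.mul_prod_erase (π.part i) _ hi, Function.update_self,
    hne _ (Finset.notMem_erase i _)]
  congr 1
  refine Finset.prod_congr rfl fun s hs => ?_
  rw [hne s]
  intro his
  rw [Finset.mem_erase] at hs
  exact hs.1 (π.part_eq_of_mem hs.2 his).symm

/-- The joint cumulant of a family of random variables, as a multilinear map. -/
def cumulantMultilinear (E : A →ₗ[R] R) : MultilinearMap R (fun _ : Λ => A) R where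
  toFun X := jointCumulant (fun s => E (∏ x ∈ s, X x)) Finset.univ
  map_update_add' := by
    intro inst X i y z
    cases Subsingleton.elim inst dΛ
    simp only [jointCumulant]
    rw [← Finset.sum_add_distrib]
    refine Finset.sum_congr rfl fun π _ => ?_
    have h := prod_parts_update E π i X
    rw [h, h, h, add_mul, map_add]
    ring
  map_update_smul' := by
    intro inst X i r y
    cases Subsingleton.elim inst dΛ
    simp only [jointCumulant]
    rw [Finset.smul_sum]
    refine Finset.sum_congr rfl fun π _ => ?_
    have h := prod_parts_update E π i X
    rw [h, h, smul_mul_assoc, map_smul, smul_eq_mul, smul_eq_mul]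
    ring

end Cumulants

/-! ### The Gaussian functional on polynomials -/

section GaussianFunctional

variable {ι R : Type} [Fintype ι] [DecidableEq ι] [CommRing R] [Algebra ℂ R]

/-- The Gaussian moment `⟨T^a T̄^b⟩` of a single complex variable. -/
noncomputable def singleMoment (lam : ℂ) (a b : ℕ) : ℂ :=
  if a = b then (a.factorial : ℂ) / lam ^ a else 0

/-- The Gaussian moment of the monomial `∏_i T_i^{s (inl i)} T̄_i^{s (inr i)}`. -/
noncomputable def gaussianMoment (lam : ℂ) (s : ι ⊕ ι →₀ ℕ) : ℂ :=
  ∏ i, singleMoment lam (s (Sum.inl i)) (s (Sum.inr i))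

/-- The Gaussian functional with covariance `lam⁻¹` on the polynomials in the variables
`T_i = X (inl i)`, `T̄_i = X (inr i)`. -/
noncomputable def gaussianFunctional (R : Type) [CommRing R] [Algebra ℂ R] (lam : ℂ) :
    MvPolynomial (ι ⊕ ι) R →ₗ[R] R :=
  (MvPolynomial.basisMonomials (ι ⊕ ι) R).constr R fun s => algebraMap ℂ R (gaussianMoment lam s)

theorem gaussianFunctional_monomial (lam : ℂ) (s : ι ⊕ ι →₀ ℕ) (r : R) :
    gaussianFunctional R lam (MvPolynomial.monomial s r)
      = r * algebraMap ℂ R (gaussianMoment lam s) := by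
  have h : MvPolynomial.monomial s r = r • MvPolynomial.basisMonomials (ι ⊕ ι) R s := by
    rw [MvPolynomial.coe_basisMonomials, MvPolynomial.smul_monomial, smul_eq_mul, mul_one]
  rw [h, map_smul, gaussianFunctional, Module.Basis.constr_basis, smul_eq_mul]

theorem gaussianFunctional_one (lam : ℂ) :
    gaussianFunctional (ι := ι) R lam 1 = 1 := by
  rw [← MvPolynomial.C_1, ← MvPolynomial.monomial_zero', gaussianFunctional_monomial]
  simp [gaussianMoment, singleMoment]

/-- Integration by parts on monomials, from the recursion of the factorial. The truncated
subtraction does no harm: its prefactor vanishes when `s (Sum.inr i) = 0`. -/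
theorem gaussianMoment_add_single {lam : ℂ} (hl : lam ≠ 0) (i : ι) (s : ι ⊕ ι →₀ ℕ) :
    gaussianMoment lam (Finsupp.single (Sum.inl i) 1 + s)
      = lam⁻¹ * (s (Sum.inr i) * gaussianMoment lam (s - Finsupp.single (Sum.inr i) 1)) := by
  have h0 : ∀ f : ι → ℂ, ∏ j, f j = f i * ∏ j ∈ Finset.univ.erase i, f j := fun f =>
    (Finset.mul_prod_erase _ _ (Finset.mem_univ i)).symm
  rw [gaussianMoment, gaussianMoment, h0, h0]
  have h1 : ∀ j ∈ Finset.univ.erase i,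
      singleMoment lam ((Finsupp.single (Sum.inl i) 1 + s : ι ⊕ ι →₀ ℕ) (Sum.inl j))
        ((Finsupp.single (Sum.inl i) 1 + s : ι ⊕ ι →₀ ℕ) (Sum.inr j))
      = singleMoment lam ((s - Finsupp.single (Sum.inr i) 1 : ι ⊕ ι →₀ ℕ) (Sum.inl j))
        ((s - Finsupp.single (Sum.inr i) 1 : ι ⊕ ι →₀ ℕ) (Sum.inr j)) := by
    intro j hj
    have hji : i ≠ j := fun h => Finset.ne_of_mem_erase hj h.symm
    simp [hji]
  rw [Finset.prod_congr rfl h1]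
  rw [← mul_assoc, ← mul_assoc]
  congr 1
  simp only [singleMoment, Finsupp.add_apply, Finsupp.single_apply, Finsupp.tsub_apply, if_true, reduceCtorEq,
    if_false, zero_add, tsub_zero]
  rcases hr : s (Sum.inr i) with _ | k
  · rw [if_neg (by omega)]; simp
  · by_cases hk : s (Sum.inl i) = k
    · rw [if_pos (by omega), if_pos (by omega), hk, add_comm 1 k, Nat.factorial_succ, pow_succ]
      push_cast
      field_simp
    · rw [if_neg (by omega), if_neg (by omega)]; simp

theorem gaussianFunctional_X_mul {lam : ℂ} (hl : lam ≠ 0) (i : ι) (P : MvPolynomial (ι ⊕ ι) R) :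
    gaussianFunctional R lam (MvPolynomial.X (Sum.inl i) * P)
      = lam⁻¹ • gaussianFunctional R lam (MvPolynomial.pderiv (Sum.inr i) P) := by
  induction P using MvPolynomial.induction_on' with
  | monomial s r =>
    rw [MvPolynomial.X, MvPolynomial.monomial_mul, one_mul, MvPolynomial.pderiv_monomial,
      gaussianFunctional_monomial, gaussianFunctional_monomial, gaussianMoment_add_single hl,
      Algebra.smul_def, map_mul, map_mul, map_natCast]
    ring
  | add P Q hP hQ => rw [mul_add, map_add, hP, hQ, map_add, map_add, smul_add]

variable {W B : Type} [DecidableEq W] [DecidableEq B]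

/-- `s` is a perfect matching between `A` and `A'`. -/
def IsMatching (A : Finset W) (A' : Finset B) (s : Finset (W × B)) : Prop :=
  s ⊆ A ×ˢ A' ∧ (∀ w ∈ A, ∃! b, (w, b) ∈ s) ∧ ∀ b ∈ A', ∃! w, (w, b) ∈ s

open Classical in
/-- The perfect matchings between `A` and `A'`. -/
noncomputable def matchings (A : Finset W) (A' : Finset B) : Finset (Finset (W × B)) :=
  (A ×ˢ A').powerset.filter (IsMatching A A')

open Classical in
theorem mem_matchings {A : Finset W} {A' : Finset B} {s : Finset (W × B)} :
    s ∈ matchings A A' ↔ IsMatching A A' s := by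
  rw [matchings, Finset.mem_filter, Finset.mem_powerset]
  exact ⟨fun h => h.2, fun h => ⟨h.1, h⟩⟩

theorem IsMatching.erase {A : Finset W} {A' : Finset B} {w : W} (hw : w ∉ A) {b : B}
    {s : Finset (W × B)} (h : IsMatching (insert w A) A' s) (hb : (w, b) ∈ s) :
    IsMatching A (A'.erase b) (s.erase (w, b)) := by
  obtain ⟨h1, h2, h3⟩ := h
  have hbA := (Finset.mem_product.1 (h1 hb)).2
  refine ⟨?_, ?_, ?_⟩
  · rintro ⟨w', b'⟩ hp
    rw [Finset.mem_erase] at hp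
    have h4 := Finset.mem_product.1 (h1 hp.2)
    simp only [Finset.mem_insert] at h4
    have hw' : w' ≠ w := by
      rintro rfl
      exact hp.1 (by rw [(h2 w' (Finset.mem_insert_self _ _)).unique hp.2 hb])
    have hb' : b' ≠ b := by
      rintro rfl
      exact hp.1 (by rw [(h3 b' hbA).unique hp.2 hb])
    simp only [Finset.mem_product, Finset.mem_erase]
    exact ⟨h4.1.resolve_left hw', hb', h4.2⟩
  · intro w' hw'
    have hne : w' ≠ w := fun h => hw (h ▸ hw')
    obtain ⟨b', hb', hu⟩ := h2 w' (Finset.mem_insert_of_mem hw')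
    exact ⟨b', by simp [hb', hne], fun b'' h'' => hu b'' (Finset.mem_of_mem_erase h'')⟩
  · intro b' hb'
    rw [Finset.mem_erase] at hb'
    obtain ⟨w', hw', hu⟩ := h3 b' hb'.2
    exact ⟨w', by simp [hw', hb'.1], fun w'' h'' => hu w'' (Finset.mem_of_mem_erase h'')⟩

theorem IsMatching.insert {A : Finset W} {A' : Finset B} {w : W} (hw : w ∉ A) {b : B}
    (hb : b ∈ A') {s : Finset (W × B)} (h : IsMatching A (A'.erase b) s) :
    IsMatching (insert w A) A' (insert (w, b) s) := by
  obtain ⟨h1, h2, h3⟩ := h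
  have hs : ∀ {w' b'}, (w', b') ∈ s → w' ∈ A ∧ b' ≠ b ∧ b' ∈ A' := fun hp => by
    simpa using h1 hp
  refine ⟨?_, ?_, ?_⟩
  · intro p hp
    rcases Finset.mem_insert.1 hp with rfl | hp
    · simp [hb]
    · have := hs hp
      simp [this.1, this.2.2]
  · intro w' hw'
    rcases Finset.mem_insert.1 hw' with rfl | hw'
    · refine ⟨b, by simp, fun b' hb' => ?_⟩
      rcases Finset.mem_insert.1 hb' with h | h
      · exact (Prod.mk.inj h).2
      · exact absurd (hs h).1 hw
    · obtain ⟨b', hb', hu⟩ := h2 w' hw'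
      refine ⟨b', by simp [hb'], fun b'' h'' => ?_⟩
      rcases Finset.mem_insert.1 h'' with h | h
      · exact absurd ((Prod.mk.inj h).1 ▸ hw') hw
      · exact hu b'' h
  · intro b' hb'
    by_cases hbb : b' = b
    · subst hbb
      refine ⟨w, by simp, fun w' hw' => ?_⟩
      rcases Finset.mem_insert.1 hw' with h | h
      · exact (Prod.mk.inj h).1
      · exact absurd rfl (hs h).2.1
    · obtain ⟨w', hw', hu⟩ := h3 b' (Finset.mem_erase.2 ⟨hbb, hb'⟩)
      refine ⟨w', by simp [hw'], fun w'' h'' => ?_⟩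
      rcases Finset.mem_insert.1 h'' with h | h
      · exact absurd (Prod.mk.inj h).2 hbb
      · exact hu w'' h

/-- Sorting matchings by the partner of `w` mirrors the Leibniz rule of `pderiv_prod_X_inr`; Wick's
theorem compares the two. -/
theorem sum_matchings_insert {M : Type*} [AddCommMonoid M] {A : Finset W} {A' : Finset B} {w : W}
    (hw : w ∉ A) (f : Finset (W × B) → M) :
    ∑ s ∈ matchings (insert w A) A', f s
      = ∑ b ∈ A', ∑ s ∈ matchings A (A'.erase b), f (insert (w, b) s) := by
  have h1 : ∀ b ∈ A', ∑ s ∈ matchings A (A'.erase b), f (insert (w, b) s)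
      = ∑ s ∈ matchings (insert w A) A' with (w, b) ∈ s, f s := by
    intro b hb
    have hnot : ∀ s ∈ matchings A (A'.erase b), (w, b) ∉ s := fun s hs h =>
      hw (Finset.mem_product.1 ((mem_matchings.1 hs).1 h)).1
    refine Finset.sum_bij' (fun s _ => insert (w, b) s) (fun s _ => s.erase (w, b)) ?_ ?_ ?_ ?_ ?_
    · intro s hs
      simp only [Finset.mem_filter, mem_matchings, Finset.mem_insert_self, and_true]
      exact (mem_matchings.1 hs).insert hw hb
    · intro s hs
      rw [Finset.mem_filter, mem_matchings] at hs
      exact mem_matchings.2 (hs.1.erase hw hs.2)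
    · intro s hs
      exact Finset.erase_insert (hnot s hs)
    · intro s hs
      exact Finset.insert_erase (Finset.mem_filter.1 hs).2
    · intro s hs; rfl
  rw [Finset.sum_congr rfl h1]
  simp only [Finset.sum_filter]
  rw [Finset.sum_comm]
  refine Finset.sum_congr rfl fun s hs => ?_
  rw [mem_matchings] at hs
  obtain ⟨b, hb, hu⟩ := hs.2.1 w (Finset.mem_insert_self _ _)
  rw [Finset.sum_eq_single b]
  · rw [if_pos hb]
  · intro b' _ hne
    rw [if_neg fun h => hne (hu b' h)]
  · intro h
    exact absurd (Finset.mem_product.1 (hs.1 hb)).2 h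

theorem matchings_empty (A' : Finset B) :
    matchings (∅ : Finset W) A' = if A' = ∅ then {∅} else ∅ := by
  ext s
  rw [mem_matchings]
  split_ifs with h
  · subst h
    simp [IsMatching]
  · simp only [Finset.notMem_empty, iff_false]
    rintro ⟨h1, -, h3⟩
    obtain ⟨b, hb⟩ := Finset.nonempty_iff_ne_empty.2 h
    obtain ⟨w, hw, -⟩ := h3 b hb
    simpa using h1 hw

theorem pderiv_prod_X_inr (i : ι) (A : Finset W) (x : W → ι) (A' : Finset B) (y : B → ι) :
    MvPolynomial.pderiv (Sum.inr i) ((∏ w ∈ A, MvPolynomial.X (Sum.inl (x w)))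
        * ∏ b ∈ A', (MvPolynomial.X (Sum.inr (y b)) : MvPolynomial (ι ⊕ ι) R))
      = ∑ b ∈ A', (if i = y b then 1 else 0 : ℂ) • ((∏ w ∈ A, MvPolynomial.X (Sum.inl (x w)))
        * ∏ b ∈ A'.erase b, MvPolynomial.X (Sum.inr (y b))) := by
  have h1 : ∀ A : Finset W, MvPolynomial.pderiv (Sum.inr i)
      (∏ w ∈ A, (MvPolynomial.X (Sum.inl (x w)) : MvPolynomial (ι ⊕ ι) R)) = 0 := by
    intro A
    induction A using Finset.induction_on with
    | empty => simp
    | insert w A hw ih =>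
      rw [Finset.prod_insert hw, Derivation.leibniz, ih, MvPolynomial.pderiv_X_of_ne (by simp)]
      simp
  have h2 : ∀ A' : Finset B, MvPolynomial.pderiv (Sum.inr i)
      (∏ b ∈ A', (MvPolynomial.X (Sum.inr (y b)) : MvPolynomial (ι ⊕ ι) R))
      = ∑ b ∈ A', (if i = y b then 1 else 0 : ℂ) • ∏ b ∈ A'.erase b, MvPolynomial.X (Sum.inr (y b)) := by
    intro A'
    induction A' using Finset.induction_on with
    | empty => simp
    | insert b A' hb ih =>
      rw [Finset.prod_insert hb, Derivation.leibniz, ih, Finset.sum_insert hb,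
        Finset.erase_insert hb, MvPolynomial.pderiv_X, smul_eq_mul, smul_eq_mul, Finset.mul_sum,
        add_comm]
      congr 1
      · by_cases h : i = y b
        · simp [h]
        · simp [h, Ne.symm h]
      · refine Finset.sum_congr rfl fun b' hb' => ?_
        have hne : b ≠ b' := fun h => hb (h ▸ hb')
        rw [Finset.erase_insert_of_ne hne, Finset.prod_insert (by simp [hb]), mul_smul_comm]
  rw [Derivation.leibniz, h1, h2, smul_zero, add_zero, smul_eq_mul, Finset.mul_sum]
  refine Finset.sum_congr rfl fun b _ => ?_
  rw [mul_smul_comm]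

/-- Wick's theorem. -/
theorem gaussianFunctional_prod {lam : ℂ} (hl : lam ≠ 0) (A : Finset W) (x : W → ι)
    (A' : Finset B) (y : B → ι) :
    gaussianFunctional R lam ((∏ w ∈ A, MvPolynomial.X (Sum.inl (x w)))
        * ∏ b ∈ A', MvPolynomial.X (Sum.inr (y b)))
      = ∑ s ∈ matchings A A', ∏ q ∈ s, algebraMap ℂ R (if x q.1 = y q.2 then lam⁻¹ else 0) := by
  induction A using Finset.induction_on generalizing A' with
  | empty =>
    rw [Finset.prod_empty, one_mul, matchings_empty]
    split_ifs with h
    · simp [h, gaussianFunctional_one]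
    -- Only conjugate variables are left, so the exponents at `y b` differ and the moment vanishes;
    -- there is no matching either.
    · obtain ⟨b, hb⟩ := Finset.nonempty_iff_ne_empty.2 h
      have : ∏ b ∈ A', (MvPolynomial.X (Sum.inr (y b)) : MvPolynomial (ι ⊕ ι) R)
          = MvPolynomial.monomial (∑ b ∈ A', Finsupp.single (Sum.inr (y b)) 1) 1 := by
        rw [MvPolynomial.monomial_sum_one]; rfl
      rw [this, gaussianFunctional_monomial, gaussianMoment,
        Finset.prod_eq_zero (Finset.mem_univ (y b))]
      · simp
      · rw [singleMoment, if_neg]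
        simp only [Finsupp.coe_finsetSum, Finset.sum_apply, Finsupp.single_apply]
        simp only [reduceCtorEq, if_false, Finset.sum_const_zero]
        refine (Finset.sum_pos' (fun _ _ => Nat.zero_le _) ⟨b, hb, by simp⟩).ne
  | insert w A hw ih =>
    rw [Finset.prod_insert hw, mul_assoc, gaussianFunctional_X_mul hl, pderiv_prod_X_inr,
      sum_matchings_insert hw, map_sum, Finset.smul_sum]
    refine Finset.sum_congr rfl fun b hb => ?_
    have hnot : ∀ s ∈ matchings A (A'.erase b), (w, b) ∉ s := fun s hs h =>
      hw (Finset.mem_product.1 ((mem_matchings.1 hs).1 h)).1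
    rw [LinearMap.map_smul_of_tower, ih, smul_smul, Algebra.smul_def, Finset.mul_sum]
    refine Finset.sum_congr rfl fun s hs => ?_
    rw [Finset.prod_insert (hnot s hs)]
    congr 2
    simp

end GaussianFunctional

/-! ### Cumulants as sums over connected pairings -/

section ConnectedPairings

variable {Λ W B R : Type} [DecidableEq Λ] [Fintype W] [Fintype B] [DecidableEq W] [DecidableEq B]
  [CommRing R]

/-- The elements with label in `U`. -/
def legs (l : W → Λ) (U : Finset Λ) : Finset W := Finset.univ.filter fun w => l w ∈ U

theorem mem_legs {l : W → Λ} {U : Finset Λ} {w : W} : w ∈ legs l U ↔ l w ∈ U := by simp [legs]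

/-- Two labels are linked by the pairs in `s`. -/
def Linked (lw : W → Λ) (lb : B → Λ) (s : Finset (W × B)) : Λ → Λ → Prop :=
  Relation.EqvGen fun a b => ∃ q ∈ s, lw q.1 = a ∧ lb q.2 = b

/-- The sum over all the pairings of the legs with labels in `U`. -/
noncomputable def pairingMoment (lw : W → Λ) (lb : B → Λ) (φ : W → B → R) (U : Finset Λ) : R :=
  ∑ s ∈ matchings (legs lw U) (legs lb U), ∏ q ∈ s, φ q.1 q.2

open Classical in
/-- The sum over the connected pairings of the legs with labels in `U`. -/
noncomputable def connectedMoment (lw : W → Λ) (lb : B → Λ) (φ : W → B → R) (U : Finset Λ) : R :=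
  ∑ s ∈ matchings (legs lw U) (legs lb U) with ∀ a ∈ U, ∀ b ∈ U, Linked lw lb s a b,
    ∏ q ∈ s, φ q.1 q.2

theorem Linked.mono {lw : W → Λ} {lb : B → Λ} {s t : Finset (W × B)} (h : s ⊆ t) {a b : Λ}
    (hab : Linked lw lb s a b) : Linked lw lb t a b := by
  induction hab with
  | rel a b h' => obtain ⟨q, hq, h'⟩ := h'; exact Relation.EqvGen.rel _ _ ⟨q, h hq, h'⟩
  | refl a => exact Relation.EqvGen.refl a
  | symm a b _ ih => exact Relation.EqvGen.symm _ _ ih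
  | trans a b c _ _ ih1 ih2 => exact Relation.EqvGen.trans _ _ _ ih1 ih2

/-- No pair crosses the boundary of `U`, so a chain of links starting in `U` stays there and uses
only pairs inside `U`. -/
theorem Linked.mem_iff {lw : W → Λ} {lb : B → Λ} {s : Finset (W × B)} {U : Finset Λ}
    (hU : ∀ q ∈ s, lw q.1 ∈ U ↔ lb q.2 ∈ U) {a b : Λ} (hab : Linked lw lb s a b) :
    (a ∈ U ↔ b ∈ U) ∧ (a ∈ U → Linked lw lb (s.filter fun q => lw q.1 ∈ U) a b) := by
  induction hab with
  | rel a b h =>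
    obtain ⟨q, hq, rfl, rfl⟩ := h
    exact ⟨hU q hq, fun h => Relation.EqvGen.rel _ _ ⟨q, by simp [hq, h], rfl, rfl⟩⟩
  | refl a => exact ⟨Iff.rfl, fun _ => Relation.EqvGen.refl a⟩
  | symm a b _ ih => exact ⟨ih.1.symm, fun h => Relation.EqvGen.symm _ _ (ih.2 (ih.1.2 h))⟩
  | trans a b c _ _ ih1 ih2 =>
    exact ⟨ih1.1.trans ih2.1, fun h => Relation.EqvGen.trans _ _ _ (ih1.2 h) (ih2.2 (ih1.1.1 h))⟩

theorem IsMatching.filter {lw : W → Λ} {lb : B → Λ} {U V : Finset Λ} {s : Finset (W × B)}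
    (h : IsMatching (legs lw U) (legs lb U) s) (p : Λ → Prop) [DecidablePred p]
    (hV : ∀ a, a ∈ V ↔ a ∈ U ∧ p a) (hs : ∀ q ∈ s, p (lw q.1) ↔ p (lb q.2)) :
    IsMatching (legs lw V) (legs lb V) (s.filter fun q => p (lw q.1)) := by
  obtain ⟨h1, h2, h3⟩ := h
  refine ⟨?_, ?_, ?_⟩
  · intro q hq
    rw [Finset.mem_filter] at hq
    have h4 := h1 hq.1
    rw [Finset.mem_product, mem_legs, mem_legs] at h4 ⊢
    rw [hV, hV]
    exact ⟨⟨h4.1, hq.2⟩, h4.2, (hs q hq.1).1 hq.2⟩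
  · intro w hw
    rw [mem_legs, hV] at hw
    obtain ⟨b, hb, hu⟩ := h2 w (mem_legs.2 hw.1)
    exact ⟨b, Finset.mem_filter.2 ⟨hb, hw.2⟩, fun b' hb' => hu b' (Finset.mem_filter.1 hb').1⟩
  · intro b hb
    rw [mem_legs, hV] at hb
    obtain ⟨w, hw, hu⟩ := h3 b (mem_legs.2 hb.1)
    exact ⟨w, Finset.mem_filter.2 ⟨hw, (hs _ hw).2 hb.2⟩,
      fun w' hw' => hu w' (Finset.mem_filter.1 hw').1⟩

theorem IsMatching.union {lw : W → Λ} {lb : B → Λ} {U V : Finset Λ} (hV : V ⊆ U)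
    {s t : Finset (W × B)} (hs : IsMatching (legs lw V) (legs lb V) s)
    (ht : IsMatching (legs lw (U \ V)) (legs lb (U \ V)) t) :
    IsMatching (legs lw U) (legs lb U) (s ∪ t) := by
  have hs1 : ∀ {w b}, (w, b) ∈ s → lw w ∈ V ∧ lb b ∈ V := fun h => by
    simpa [mem_legs] using hs.1 h
  have ht1 : ∀ {w b}, (w, b) ∈ t → (lw w ∈ U ∧ lw w ∉ V) ∧ lb b ∈ U ∧ lb b ∉ V := fun h => by
    simpa [mem_legs] using ht.1 h
  refine ⟨?_, ?_, ?_⟩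
  · rintro ⟨w, b⟩ hq
    simp only [Finset.mem_product, mem_legs]
    rcases Finset.mem_union.1 hq with h | h
    · exact ⟨hV (hs1 h).1, hV (hs1 h).2⟩
    · exact ⟨(ht1 h).1.1, (ht1 h).2.1⟩
  · intro w hw
    rw [mem_legs] at hw
    by_cases hwV : lw w ∈ V
    · obtain ⟨b, hb, hu⟩ := hs.2.1 w (mem_legs.2 hwV)
      refine ⟨b, Finset.mem_union_left _ hb, fun b' hb' => ?_⟩
      rcases Finset.mem_union.1 hb' with h | h
      · exact hu b' h
      · exact absurd hwV (ht1 h).1.2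
    · obtain ⟨b, hb, hu⟩ := ht.2.1 w (mem_legs.2 (Finset.mem_sdiff.2 ⟨hw, hwV⟩))
      refine ⟨b, Finset.mem_union_right _ hb, fun b' hb' => ?_⟩
      rcases Finset.mem_union.1 hb' with h | h
      · exact absurd (hs1 h).1 hwV
      · exact hu b' h
  · intro b hb
    rw [mem_legs] at hb
    by_cases hbV : lb b ∈ V
    · obtain ⟨w, hw, hu⟩ := hs.2.2 b (mem_legs.2 hbV)
      refine ⟨w, Finset.mem_union_left _ hw, fun w' hw' => ?_⟩
      rcases Finset.mem_union.1 hw' with h | h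
      · exact hu w' h
      · exact absurd hbV (ht1 h).2.2
    · obtain ⟨w, hw, hu⟩ := ht.2.2 b (mem_legs.2 (Finset.mem_sdiff.2 ⟨hb, hbV⟩))
      refine ⟨w, Finset.mem_union_right _ hw, fun w' hw' => ?_⟩
      rcases Finset.mem_union.1 hw' with h | h
      · exact absurd (hs1 h).2 hbV
      · exact hu w' h

-- A pairing splits uniquely into its restriction to the cluster of `x`, which is connected, and an
-- arbitrary pairing of the remaining labels. This is the recursion that characterizes cumulants.
open Classical in
theorem pairingMoment_eq_sum_rooted (lw : W → Λ) (lb : B → Λ) (φ : W → B → R) {U : Finset Λ}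
    {x : Λ} (hx : x ∈ U) :
    pairingMoment lw lb φ U
      = ∑ V ∈ rootedSubsets U x, connectedMoment lw lb φ V * pairingMoment lw lb φ (U \ V) := by
  let cl : Finset (W × B) → Finset Λ := fun s => U.filter fun a => Linked lw lb s x a
  have hcl : ∀ s ∈ matchings (legs lw U) (legs lb U), cl s ∈ rootedSubsets U x := fun s _ =>
    mem_rootedSubsets.2 ⟨Finset.filter_subset _ _,
      Finset.mem_filter.2 ⟨hx, Relation.EqvGen.refl x⟩⟩
  rw [pairingMoment, ← Finset.sum_fiberwise_of_maps_to hcl]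
  refine Finset.sum_congr rfl fun V hV => ?_
  rw [mem_rootedSubsets] at hV
  rw [connectedMoment, pairingMoment, Finset.sum_mul_sum, ← Finset.sum_product']
  have hlab : ∀ s ∈ matchings (legs lw U) (legs lb U), cl s = V →
      ∀ q ∈ s, (lw q.1 ∈ V ↔ lb q.2 ∈ V) := by
    intro s hs hc q hq
    have h1 := (mem_matchings.1 hs).1 hq
    rw [Finset.mem_product, mem_legs, mem_legs] at h1
    have h2 : Linked lw lb s (lw q.1) (lb q.2) := Relation.EqvGen.rel _ _ ⟨q, hq, rfl, rfl⟩
    rw [← hc, Finset.mem_filter, Finset.mem_filter]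
    exact ⟨fun h => ⟨h1.2, Relation.EqvGen.trans _ _ _ h.2 h2⟩,
      fun h => ⟨h1.1, Relation.EqvGen.trans _ _ _ h.2 (Relation.EqvGen.symm _ _ h2)⟩⟩
  refine Finset.sum_bij'
    (fun s _ => (s.filter (fun q => lw q.1 ∈ V), s.filter (fun q => lw q.1 ∉ V)))
    (fun p _ => p.1 ∪ p.2) ?_ ?_ ?_ ?_ ?_
  · intro s hs
    rw [Finset.mem_filter] at hs
    have hl := hlab s hs.1 hs.2
    have hm := mem_matchings.1 hs.1
    simp only [Finset.mem_product, Finset.mem_filter, mem_matchings]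
    refine ⟨⟨hm.filter (· ∈ V) (fun a => ⟨fun h => ⟨hV.1 h, h⟩, fun h => h.2⟩) hl, ?_⟩,
      hm.filter (· ∉ V) (fun a => Finset.mem_sdiff) fun q hq => not_congr (hl q hq)⟩
    intro a ha b hb
    have h1 : ∀ a ∈ V, Linked lw lb s x a := fun a ha => by
      rw [← hs.2] at ha
      exact (Finset.mem_filter.1 ha).2
    exact Relation.EqvGen.trans _ _ _
      (Relation.EqvGen.symm _ _ (((h1 a ha).mem_iff hl).2 hV.2)) (((h1 b hb).mem_iff hl).2 hV.2)
  · rintro ⟨s, t⟩ hst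
    simp only [Finset.mem_product, Finset.mem_filter, mem_matchings] at hst
    obtain ⟨⟨hs, hc⟩, ht⟩ := hst
    simp only [Finset.mem_filter, mem_matchings]
    refine ⟨hs.union hV.1 ht, ?_⟩
    ext a
    simp only [cl, Finset.mem_filter]
    constructor
    · rintro ⟨_, ha⟩
      refine ((ha.mem_iff (U := V) fun q hq => ?_).1).1 hV.2
      rcases Finset.mem_union.1 hq with h | h
      · have := hs.1 h
        rw [Finset.mem_product, mem_legs, mem_legs] at this
        exact iff_of_true this.1 this.2
      · have := ht.1 h
        rw [Finset.mem_product, mem_legs, mem_legs, Finset.mem_sdiff, Finset.mem_sdiff] at this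
        exact iff_of_false this.1.2 this.2.2
    · intro ha
      exact ⟨hV.1 ha, (hc x hV.2 a ha).mono Finset.subset_union_left⟩
  · intro s hs
    exact Finset.filter_union_filter_not_eq _ s
  · rintro ⟨s, t⟩ hst
    simp only [Finset.mem_product, Finset.mem_filter, mem_matchings] at hst
    have h1 : ∀ q ∈ s, lw q.1 ∈ V := fun q hq =>
      mem_legs.1 (Finset.mem_product.1 (hst.1.1.1 hq)).1
    have h2 : ∀ q ∈ t, lw q.1 ∉ V := fun q hq =>
      (Finset.mem_sdiff.1 (mem_legs.1 (Finset.mem_product.1 (hst.2.1 hq)).1)).2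
    simp only [Finset.filter_union]
    rw [Finset.filter_true_of_mem h1, Finset.filter_false_of_mem h2,
      Finset.filter_true_of_mem h2, Finset.filter_false_of_mem fun q hq => not_not.2 (h1 q hq)]
    simp
  · intro s hs
    exact (Finset.prod_filter_mul_prod_filter_not s _ _).symm

theorem pairingMoment_empty (lw : W → Λ) (lb : B → Λ) (φ : W → B → R) :
    pairingMoment lw lb φ ∅ = 1 := by
  have h1 : legs lw (∅ : Finset Λ) = ∅ := by simp [legs]
  have h2 : legs lb (∅ : Finset Λ) = ∅ := by simp [legs]
  rw [pairingMoment, h1, h2, matchings_empty, if_pos rfl]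
  simp

theorem connectedMoment_eq_jointCumulant (lw : W → Λ) (lb : B → Λ) (φ : W → B → R)
    {U : Finset Λ} (hU : U.Nonempty) :
    connectedMoment lw lb φ U = jointCumulant (pairingMoment lw lb φ) U :=
  jointCumulant_unique (pairingMoment_empty lw lb φ)
    (fun _ ⟨x, hx⟩ => ⟨x, hx, pairingMoment_eq_sum_rooted lw lb φ hx⟩) hU

end ConnectedPairings

/-! ### Complete matchings as permutations. -/

section Permutations

variable {Q R : Type} [Fintype Q] [DecidableEq Q] [CommRing R]

/-- The graph of a permutation. -/
def permGraph (τ : Equiv.Perm Q) : Finset (Q × Q) := Finset.univ.image fun w => (w, τ w)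

theorem mem_permGraph {τ : Equiv.Perm Q} {q : Q × Q} : q ∈ permGraph τ ↔ τ q.1 = q.2 := by
  rcases q with ⟨w, b⟩
  simp [permGraph]

open Classical in
theorem sum_matchings_univ (P : Finset (Q × Q) → Prop) (φ : Q → Q → R) :
    ∑ s ∈ matchings (Finset.univ : Finset Q) Finset.univ with P s, ∏ q ∈ s, φ q.1 q.2
      = ∑ τ : Equiv.Perm Q with P (permGraph τ), ∏ w, φ w (τ w) := by
  symm
  refine Finset.sum_bij (fun τ _ => permGraph τ) ?_ ?_ ?_ ?_
  · intro τ hτ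
    rw [Finset.mem_filter] at hτ ⊢
    refine ⟨mem_matchings.2 ⟨by simp, fun w _ => ⟨τ w, mem_permGraph.2 rfl, fun b hb => ?_⟩,
      fun b _ => ⟨τ.symm b, mem_permGraph.2 (by simp), fun w hw => ?_⟩⟩, hτ.2⟩
    · exact (mem_permGraph.1 hb).symm
    · rw [Equiv.eq_symm_apply]; exact mem_permGraph.1 hw
  · intro τ _ τ' _ h
    refine Equiv.ext fun w => ?_
    have : (w, τ w) ∈ permGraph τ' := by rw [← h, mem_permGraph]
    exact (mem_permGraph.1 this).symm
  · intro s hs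
    rw [Finset.mem_filter, mem_matchings] at hs
    obtain ⟨⟨-, h2, h3⟩, hP⟩ := hs
    choose f hf hfu using fun w => h2 w (Finset.mem_univ w)
    choose g hg hgu using fun b => h3 b (Finset.mem_univ b)
    let τ : Equiv.Perm Q := ⟨f, g, fun w => (hgu _ w (hf w)).symm, fun b => (hfu _ b (hg b)).symm⟩
    have : permGraph τ = s := by
      ext ⟨w, b⟩
      rw [mem_permGraph]
      exact ⟨fun h => by rw [← show f w = b from h]; exact hf w, fun h => (hfu w b h).symm⟩
    exact ⟨τ, Finset.mem_filter.2 ⟨Finset.mem_univ _, by rwa [this]⟩, this⟩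
  · intro τ _
    rw [permGraph, Finset.prod_image]
    intro w _ w' _ h
    exact (Prod.mk.inj h).1

end Permutations

/-! ### Gaussian integrals of polynomials -/

section GaussianIntegral

open MeasureTheory

theorem integrable_norm_pow_mul_exp {l : ℝ} (hl : 0 < l) (k : ℕ) :
    Integrable fun z : ℂ => ‖z‖ ^ k * Real.exp (-(l * ‖z‖ ^ 2)) := by
  have h1 : Integrable fun z : ℂ => Real.exp (-(l / 2 * ‖z‖ ^ 2)) := by
    have := (GaussianFourier.integrable_cexp_neg_mul_sq_norm_add (V := ℂ) (b := (l / 2 : ℝ))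
      (by simpa using hl) 0 0).norm
    refine this.congr (Filter.Eventually.of_forall fun z => ?_)
    simp only [Complex.norm_exp]
    congr 1
    simp [← Complex.ofReal_pow]
  have hcont : Continuous fun z : ℂ => ‖z‖ ^ k * Real.exp (-(l * ‖z‖ ^ 2)) := by fun_prop
  refine (h1.const_mul (1 + k.factorial / (l / 2) ^ k)).mono' hcont.aestronglyMeasurable
    (Filter.Eventually.of_forall fun z => ?_)
  rw [Real.norm_of_nonneg (by positivity)]
  -- One half of the Gaussian absorbs the power of `‖z‖`, the other half remains as the integrable
  -- majorant.
  have h2 : Real.exp (-(l * ‖z‖ ^ 2))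
      = Real.exp (-(l / 2 * ‖z‖ ^ 2)) * Real.exp (-(l / 2 * ‖z‖ ^ 2)) := by
    rw [← Real.exp_add]; congr 1; ring
  rw [h2, ← mul_assoc]
  refine mul_le_mul_of_nonneg_right ?_ (Real.exp_pos _).le
  have h3 : ‖z‖ ^ k ≤ 1 + (‖z‖ ^ 2) ^ k := by
    rcases le_total ‖z‖ 1 with h | h
    · have := pow_le_one₀ (norm_nonneg z) h (n := k)
      have : 0 ≤ (‖z‖ ^ 2) ^ k := by positivity
      linarith
    · rw [← pow_mul]
      have := pow_le_pow_right₀ h (show k ≤ 2 * k by omega)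
      linarith
  have h4 := Real.pow_div_factorial_le_exp (x := l / 2 * ‖z‖ ^ 2) (by positivity) k
  have h5 : (‖z‖ ^ 2) ^ k ≤ k.factorial / (l / 2) ^ k * Real.exp (l / 2 * ‖z‖ ^ 2) := by
    rw [mul_pow, div_le_iff₀ (by positivity)] at h4
    rw [div_mul_eq_mul_div, le_div_iff₀ (by positivity)]
    linarith
  have h6 : Real.exp (-(l / 2 * ‖z‖ ^ 2)) ≤ 1 := by
    rw [Real.exp_le_one_iff]; have := norm_nonneg z; nlinarith [sq_nonneg ‖z‖]
  calc ‖z‖ ^ k * Real.exp (-(l / 2 * ‖z‖ ^ 2))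
      ≤ (1 + k.factorial / (l / 2) ^ k * Real.exp (l / 2 * ‖z‖ ^ 2))
        * Real.exp (-(l / 2 * ‖z‖ ^ 2)) :=
        mul_le_mul_of_nonneg_right (by linarith) (Real.exp_pos _).le
    _ = Real.exp (-(l / 2 * ‖z‖ ^ 2)) + k.factorial / (l / 2) ^ k := by
        rw [add_mul, one_mul, mul_assoc, ← Real.exp_add, add_neg_cancel, Real.exp_zero, mul_one]
    _ ≤ _ := by linarith

/-- The one-variable Gaussian integrand. -/
noncomputable def singleIntegrand (l : ℝ) (m n : ℕ) (z : ℂ) : ℂ :=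
  (l / Real.pi : ℂ) * Complex.exp (-(l * ((‖z‖ ^ 2 : ℝ) : ℂ))) * (z ^ m * starRingEnd ℂ z ^ n)

theorem integrable_singleIntegrand {l : ℝ} (hl : 0 < l) (m n : ℕ) :
    Integrable (singleIntegrand l m n) := by
  have hcont : Continuous (singleIntegrand l m n) := by
    unfold singleIntegrand
    have : Continuous fun z : ℂ => starRingEnd ℂ z := Complex.continuous_conj
    fun_prop
  refine ((integrable_norm_pow_mul_exp hl (m + n)).const_mul (l / Real.pi)).mono'
    hcont.aestronglyMeasurable (Filter.Eventually.of_forall fun z => le_of_eq ?_)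
  have h : (-((l : ℂ) * ((‖z‖ ^ 2 : ℝ) : ℂ))) = ((-(l * ‖z‖ ^ 2) : ℝ) : ℂ) := by push_cast; ring
  rw [singleIntegrand, h, norm_mul, norm_mul, norm_mul, norm_pow, norm_pow, Complex.norm_exp,
    Complex.ofReal_re, RCLike.norm_conj, pow_add, norm_div, Complex.norm_real, Complex.norm_real,
    Real.norm_of_nonneg hl.le, Real.norm_of_nonneg Real.pi_pos.le]
  ring

theorem integral_singleIntegrand {l : ℝ} (hl : 0 < l) (m n : ℕ) :
    ∫ z, singleIntegrand l m n z = singleMoment (l : ℂ) m n := by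
  rw [singleMoment]
  split_ifs with hmn
  · subst hmn
    have h1 : ∀ z : ℂ, singleIntegrand l m m z
        = ((l / Real.pi * (‖z‖ ^ (2 * m : ℝ) * Real.exp (-l * ‖z‖ ^ (2 : ℝ))) : ℝ) : ℂ) := by
      intro z
      rw [singleIntegrand, ← mul_pow, Complex.mul_conj, Complex.normSq_eq_norm_sq]
      have : ‖z‖ ^ (2 * m : ℝ) = (‖z‖ ^ 2) ^ m := by
        rw [← pow_mul]; exact_mod_cast Real.rpow_natCast ‖z‖ (2 * m)
      rw [this]
      norm_cast
      ring_nf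
    simp only [h1]
    rw [integral_complex_ofReal, integral_const_mul,
      Complex.integral_rpow_mul_exp_neg_mul_rpow (by norm_num) (by
        have : (0 : ℝ) ≤ m := Nat.cast_nonneg m
        linarith) hl]
    have h2 : (-(2 * (m : ℝ) + 2) / 2) = -((m + 1 : ℕ) : ℝ) := by push_cast; ring
    have h3 : ((2 * (m : ℝ) + 2) / 2) = (m : ℝ) + 1 := by ring
    rw [h2, h3, Real.Gamma_nat_eq_factorial, Real.rpow_neg hl.le, Real.rpow_natCast]
    have hpi := Real.pi_ne_zero
    have : l / Real.pi * (2 * Real.pi / 2 * (l ^ (m + 1))⁻¹ * m.factorial) = m.factorial / l ^ m := by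
      field_simp
      ring
    rw [this]; push_cast; rfl
  -- The rotation by `π / (m - n)` preserves the measure and the weight and multiplies `z ^ m * conj
  -- z ^ n` by `-1`, so the integral is its own opposite.
  · have hne : ((m : ℝ) - n) ≠ 0 := sub_ne_zero.2 (by exact_mod_cast hmn)
    set θ : ℝ := Real.pi / (m - n) with hθ
    set u : Circle := Circle.exp θ with hu
    have h1 : ∀ z : ℂ, singleIntegrand l m n (rotation u z) = - singleIntegrand l m n z := by
      intro z
      have h2 : (u : ℂ) ^ m * starRingEnd ℂ (u : ℂ) ^ n = -1 := by
        have hconj : starRingEnd ℂ (u : ℂ) = Complex.exp (-(θ * Complex.I)) := by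
          rw [hu, Circle.coe_exp, ← Complex.exp_conj]; simp
        rw [hconj, hu, Circle.coe_exp, ← Complex.exp_nat_mul, ← Complex.exp_nat_mul,
          ← Complex.exp_add, ← Complex.exp_pi_mul_I]
        congr 1
        have : ((m : ℂ) - n) * θ = Real.pi := by
          rw [hθ]; push_cast
          have : ((m : ℂ) - n) ≠ 0 := by exact_mod_cast hne
          field_simp
        linear_combination Complex.I * this
      rw [singleIntegrand, singleIntegrand, LinearIsometryEquiv.norm_map, rotation_apply, map_mul,
        mul_pow, mul_pow]
      linear_combination ((l / Real.pi : ℂ) * Complex.exp (-(l * ((‖z‖ ^ 2 : ℝ) : ℂ)))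
        * (z ^ m * starRingEnd ℂ z ^ n)) * h2
    have h3 := (rotation u).measurePreserving.integral_comp
      (rotation u).toHomeomorph.measurableEmbedding (singleIntegrand l m n)
    simp only [h1, integral_neg] at h3
    exact self_eq_neg.1 h3.symm

variable {D N : ℕ}

/-- Evaluation of a polynomial at a tensor and its complex conjugate. -/
noncomputable def tensorEval (T : Tensor D N) :
    MvPolynomial (Index D N ⊕ Index D N) ℂ⟦X⟧ →ₐ[ℂ⟦X⟧] ℂ⟦X⟧ :=
  MvPolynomial.aeval (Sum.elim (fun i => PowerSeries.C (T i))
    fun i => PowerSeries.C (starRingEnd ℂ (T i)))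

/-- The integrand of the Gaussian integral. -/
noncomputable def gaussianIntegrand (D N : ℕ) (f : Tensor D N → ℂ) (T : Tensor D N) : ℂ :=
  (∏ _a : Index D N, ((N : ℂ) ^ (D - 1) / (Real.pi : ℂ)))
    * Complex.exp (-((N : ℂ) ^ (D - 1) * ∑ a, ((‖T a‖ ^ 2 : ℝ) : ℂ))) * f T

theorem gaussianIntegrand_monomial (s : Index D N ⊕ Index D N →₀ ℕ) (T : Tensor D N) :
    gaussianIntegrand D N (fun T => ∏ i, (T i ^ s (Sum.inl i) * starRingEnd ℂ (T i) ^ s (Sum.inr i)))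
      T = ∏ i, singleIntegrand ((N : ℝ) ^ (D - 1)) (s (Sum.inl i)) (s (Sum.inr i)) (T i) := by
  simp only [gaussianIntegrand, singleIntegrand, Finset.prod_mul_distrib, Finset.mul_sum,
    ← Finset.sum_neg_distrib, Complex.exp_sum]
  push_cast
  rfl

theorem coeff_tensorEval_monomial (n : ℕ) (s : Index D N ⊕ Index D N →₀ ℕ) (r : ℂ⟦X⟧)
    (T : Tensor D N) :
    PowerSeries.coeff n (tensorEval T (MvPolynomial.monomial s r)) = PowerSeries.coeff n r
      * ∏ i, (T i ^ s (Sum.inl i) * starRingEnd ℂ (T i) ^ s (Sum.inr i)) := by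
  rw [tensorEval, MvPolynomial.aeval_monomial, Finsupp.prod_fintype _ _ (by simp),
    Fintype.prod_sum_type]
  simp only [Sum.elim_inl, Sum.elim_inr, ← map_pow, ← map_prod, ← map_mul,
    Finset.prod_mul_distrib]
  rw [Algebra.algebraMap_self_apply, PowerSeries.coeff_mul_C]

/-- The bridge from analysis to algebra, used by `integral_eq_sumSeries`. Integrability accompanies
the induction because additivity of the integral requires it. -/
theorem integrable_and_integral_tensorEval (hN : 0 < N) (n : ℕ)
    (P : MvPolynomial (Index D N ⊕ Index D N) ℂ⟦X⟧) :
    Integrable (gaussianIntegrand D N fun T => PowerSeries.coeff n (tensorEval T P)) ∧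
      gaussianIntegral D N (fun T => PowerSeries.coeff n (tensorEval T P))
        = PowerSeries.coeff n (gaussianFunctional ℂ⟦X⟧ ((N : ℂ) ^ (D - 1)) P) := by
  have hl : (0 : ℝ) < (N : ℝ) ^ (D - 1) := by positivity
  have hdef : ∀ f : Tensor D N → ℂ, gaussianIntegral D N f = ∫ T, gaussianIntegrand D N f T :=
    fun _ => rfl
  rw [hdef]
  induction P using MvPolynomial.induction_on' with
  | monomial s r =>
    have h1 : (gaussianIntegrand D N fun T => PowerSeries.coeff n
        (tensorEval T (MvPolynomial.monomial s r))) = fun T => PowerSeries.coeff n r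
          * ∏ i, singleIntegrand ((N : ℝ) ^ (D - 1)) (s (Sum.inl i)) (s (Sum.inr i)) (T i) := by
      funext T
      rw [← gaussianIntegrand_monomial, gaussianIntegrand, gaussianIntegrand,
        coeff_tensorEval_monomial]
      ring
    rw [h1]
    refine ⟨(Integrable.fintype_prod fun i => integrable_singleIntegrand hl _ _).const_mul _, ?_⟩
    rw [integral_const_mul, integral_fintype_prod_volume_eq_prod (fun i =>
      singleIntegrand ((N : ℝ) ^ (D - 1)) (s (Sum.inl i)) (s (Sum.inr i)))]
    simp only [integral_singleIntegrand hl]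
    rw [gaussianFunctional_monomial, gaussianMoment, PowerSeries.algebraMap_eq,
      PowerSeries.coeff_mul_C]
    push_cast
    rfl
  | add P Q hP hQ =>
    have h1 : (gaussianIntegrand D N fun T => PowerSeries.coeff n (tensorEval T (P + Q)))
        = (gaussianIntegrand D N fun T => PowerSeries.coeff n (tensorEval T P))
          + gaussianIntegrand D N fun T => PowerSeries.coeff n (tensorEval T Q) := by
      funext T
      simp only [gaussianIntegrand, map_add, Pi.add_apply]
      ring
    rw [h1]
    refine ⟨hP.1.add hQ.1, ?_⟩
    rw [integral_add' hP.1 hQ.1, hP.2, hQ.2, map_add, map_add]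

end GaussianIntegral

/-! ### Perturbation series -/

section SumSeries

/-- The sum of a sequence of power series, the `k`-th of which is divisible by `X ^ k`. -/
noncomputable def sumSeries (a : ℕ → ℂ⟦X⟧) : ℂ⟦X⟧ :=
  PowerSeries.mk fun n => ∑ k ∈ Finset.range (n + 1), PowerSeries.coeff n (a k)

/-- Terms with `k > m` have no coefficient of order `m`, so every sufficiently late truncation gives
the same value. -/
theorem coeff_sumSeries {a : ℕ → ℂ⟦X⟧} (ha : ∀ k, PowerSeries.X ^ k ∣ a k) {m n : ℕ} (h : m ≤ n) :
    PowerSeries.coeff m (sumSeries a) = ∑ k ∈ Finset.range (n + 1), PowerSeries.coeff m (a k) := by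
  rw [sumSeries, PowerSeries.coeff_mk]
  refine Finset.sum_subset (Finset.range_subset_range.2 (by omega)) fun k _ hk => ?_
  exact PowerSeries.X_pow_dvd_iff.1 (ha k) m (by simpa using hk)

theorem sumSeries_mul {a b : ℕ → ℂ⟦X⟧} (ha : ∀ k, PowerSeries.X ^ k ∣ a k)
    (hb : ∀ k, PowerSeries.X ^ k ∣ b k) :
    sumSeries a * sumSeries b
      = sumSeries fun k => ∑ q ∈ Finset.HasAntidiagonal.antidiagonal k, a q.1 * b q.2 := by
  ext n
  have h1 : PowerSeries.coeff n (sumSeries a * sumSeries b)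
      = PowerSeries.coeff n ((∑ k ∈ Finset.range (n + 1), a k)
        * ∑ k ∈ Finset.range (n + 1), b k) := by
    rw [PowerSeries.coeff_mul, PowerSeries.coeff_mul]
    refine Finset.sum_congr rfl fun q hq => ?_
    have := Finset.HasAntidiagonal.mem_antidiagonal.1 hq
    rw [coeff_sumSeries ha (show q.1 ≤ n by omega), coeff_sumSeries hb (show q.2 ≤ n by omega),
      map_sum, map_sum]
  rw [h1, sumSeries, PowerSeries.coeff_mk, Finset.sum_mul_sum, ← Finset.sum_product', map_sum]
  simp only [map_sum]
  rw [Finset.sum_sigma']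
  symm
  refine Finset.sum_of_injOn (fun x => x.2) ?_ ?_ ?_ ?_
  · rintro ⟨k, q⟩ hx ⟨k', q'⟩ hx' h
    simp only [Finset.coe_sigma, Set.mem_sigma_iff, Finset.mem_coe, Finset.HasAntidiagonal.mem_antidiagonal]
      at hx hx'
    obtain rfl : q = q' := h
    obtain rfl : k = k' := by omega
    rfl
  · rintro ⟨k, q⟩ hx
    simp only [Finset.coe_sigma, Set.mem_sigma_iff, Finset.mem_coe, Finset.HasAntidiagonal.mem_antidiagonal,
      Finset.mem_range] at hx
    simp only [Finset.coe_product, Set.mem_prod, Finset.mem_coe, Finset.mem_range]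
    omega
  · rintro ⟨i, j⟩ _ hij
    refine PowerSeries.X_pow_dvd_iff.1 ((pow_add (PowerSeries.X (R := ℂ)) i j).symm ▸
      mul_dvd_mul (ha i) (hb j)) n ?_
    by_contra hle
    exact hij ⟨⟨i + j, (i, j)⟩, by simp; omega, rfl⟩
  · rintro ⟨k, q⟩ _; rfl

theorem sumSeries_sum {ι : Type*} (s : Finset ι) (a : ι → ℕ → ℂ⟦X⟧) :
    ∑ i ∈ s, sumSeries (a i) = sumSeries fun k => ∑ i ∈ s, a i k := by
  ext n
  simp only [sumSeries, map_sum, PowerSeries.coeff_mk]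
  exact Finset.sum_comm

end SumSeries

section Weights

variable {Λ R : Type*} [DecidableEq Λ] [CommRing R]

/-- Each partition of `S` collects every weight exactly once. It extracts powers of `z` from
cumulants and exploits the rescaling symmetry. -/
theorem jointCumulant_weight (w : Λ → R) (m : Finset Λ → R) (S : Finset Λ) :
    jointCumulant (fun s => (∏ x ∈ s, w x) * m s) S = (∏ x ∈ S, w x) * jointCumulant m S := by
  rw [jointCumulant, jointCumulant, Finset.mul_sum]
  refine Finset.sum_congr rfl fun π _ => ?_
  have h : ∏ s ∈ π.parts, ∏ x ∈ s, w x = ∏ x ∈ S, w x := by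
    have h := Finset.prod_biUnion (s := π.parts) (t := id) (f := w) π.disjoint
    rw [π.biUnion_parts] at h
    exact h.symm
  rw [Finset.prod_mul_distrib, h]
  ring

end Weights

/-! ### The perturbative integral of a polynomial as a series of Gaussian expectations. -/

section Polynomials

variable {D N : ℕ}

/-- Polynomials in the entries of a tensor and their conjugates, with power series in `z` as
coefficients. -/
abbrev Obs (D N : ℕ) := MvPolynomial (Index D N ⊕ Index D N) ℂ⟦X⟧

/-- The Gaussian expectation of a polynomial. -/
noncomputable abbrev gaussE (D N : ℕ) : Obs D N →ₗ[ℂ⟦X⟧] ℂ⟦X⟧ :=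
  gaussianFunctional ℂ⟦X⟧ ((N : ℂ) ^ (D - 1))

/-- The monomial `∏_v T_{a v} ∏_v T̄_{b v}`. -/
noncomputable def legMonomial {W B : Type*} [Fintype W] [Fintype B] (a : W → Index D N)
    (b : B → Index D N) : Obs D N :=
  (∏ v, MvPolynomial.X (Sum.inl (a v))) * ∏ v, MvPolynomial.X (Sum.inr (b v))

/-- The trace invariant as a polynomial. -/
noncomputable def tracePoly (N : ℕ) {V : Type} [Fintype V] [DecidableEq V] (B : ColoredGraph D V) :
    Obs D N :=
  ∑ q : (V → Index D N) × (V → Index D N),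
    (PowerSeries.C (traceOperator B q.1 q.2) : ℂ⟦X⟧) • legMonomial q.1 q.2

theorem tensorEval_tracePoly {V : Type} [Fintype V] [DecidableEq V] (B : ColoredGraph D V)
    (T : Tensor D N) : tensorEval T (tracePoly N B) = PowerSeries.C (traceInvariant B T) := by
  rw [tracePoly, traceInvariant, map_sum, Fintype.sum_prod_type, map_sum]
  refine Finset.sum_congr rfl fun a _ => ?_
  rw [map_sum]
  refine Finset.sum_congr rfl fun b _ => ?_
  simp only [legMonomial, map_smul, map_mul, map_prod, tensorEval, MvPolynomial.aeval_X,
    Sum.elim_inl, Sum.elim_inr, smul_eq_mul]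
  ring

/-- The interaction as a polynomial. -/
noncomputable def TensorModel.interactionPoly (M : TensorModel D) (N : ℕ) : Obs D N :=
  ∑ i, (PowerSeries.monomial (M.p i - 1) ((N : ℂ) ^ (D - 1) * (M.t i / (M.p i : ℂ))) : ℂ⟦X⟧)
    • tracePoly N (M.bubble i)

theorem tensorEval_interactionPoly (M : TensorModel D) (T : Tensor D N) :
    tensorEval T (M.interactionPoly N) = M.interaction N T := by
  rw [TensorModel.interactionPoly, TensorModel.interaction, map_sum]
  refine Finset.sum_congr rfl fun i _ => ?_
  rw [map_smul, tensorEval_tracePoly, smul_eq_mul]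
  ext n
  rw [PowerSeries.coeff_mul_C, PowerSeries.coeff_monomial, PowerSeries.coeff_monomial]
  split_ifs <;> simp

/-- The interaction is divisible by `z`. -/
noncomputable def TensorModel.interactionQuot (M : TensorModel D) (N : ℕ) : Obs D N :=
  ∑ i, (PowerSeries.monomial (M.p i - 2) ((N : ℂ) ^ (D - 1) * (M.t i / (M.p i : ℂ))) : ℂ⟦X⟧)
    • tracePoly N (M.bubble i)

theorem interactionPoly_eq (M : TensorModel D) (N : ℕ) :
    M.interactionPoly N = (PowerSeries.X : ℂ⟦X⟧) • M.interactionQuot N := by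
  rw [TensorModel.interactionPoly, TensorModel.interactionQuot, Finset.smul_sum]
  refine Finset.sum_congr rfl fun i _ => ?_
  rw [smul_smul]
  congr 1
  have h := M.two_le i
  rw [PowerSeries.X_eq, PowerSeries.monomial_mul_monomial, one_mul,
    show 1 + (M.p i - 2) = M.p i - 1 by omega]

theorem X_pow_dvd_gaussE (M : TensorModel D) (k : ℕ) (F : Obs D N) :
    (PowerSeries.X : ℂ⟦X⟧) ^ k ∣ gaussE D N (M.interactionPoly N ^ k * F) := by
  rw [interactionPoly_eq, smul_pow, smul_mul_assoc, map_smul, smul_eq_mul]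
  exact dvd_mul_right _ _

/-- At order `n` only the powers `k ≤ n` of the interaction enter, so the integrand is the
evaluation of a single polynomial. -/
theorem integral_eq_sumSeries (M : TensorModel D) (hN : 0 < N) {f : Tensor D N → ℂ} {F : Obs D N}
    (hF : ∀ T, tensorEval T F = PowerSeries.C (f T)) :
    M.integral N f = sumSeries fun k =>
      ((k.factorial : ℂ)⁻¹) • gaussE D N (M.interactionPoly N ^ k * F) := by
  ext n
  rw [TensorModel.integral, sumSeries, PowerSeries.coeff_mk, PowerSeries.coeff_mk]
  have h := (integrable_and_integral_tensorEval (D := D) hN n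
    (∑ k ∈ Finset.range (n + 1), (PowerSeries.C ((k.factorial : ℂ)⁻¹) : ℂ⟦X⟧)
      • (M.interactionPoly N ^ k * F))).2
  have h2 : ∀ T, PowerSeries.coeff n (expSeries (M.interaction N T)) * f T
      = PowerSeries.coeff n (tensorEval T (∑ k ∈ Finset.range (n + 1),
        (PowerSeries.C ((k.factorial : ℂ)⁻¹) : ℂ⟦X⟧) • (M.interactionPoly N ^ k * F))) := by
    intro T
    rw [expSeries, PowerSeries.coeff_mk, map_sum, map_sum, Finset.sum_mul]
    refine Finset.sum_congr rfl fun k _ => ?_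
    rw [map_smul, map_mul, map_pow (tensorEval T), tensorEval_interactionPoly, hF, smul_eq_mul,
      PowerSeries.coeff_C_mul, PowerSeries.coeff_mul_C]
    field_simp
  simp only [h2]
  rw [h, map_sum, map_sum]
  refine Finset.sum_congr rfl fun k _ => ?_
  rw [map_smul, smul_eq_mul, PowerSeries.coeff_C_mul, PowerSeries.coeff_smul, smul_eq_mul]

theorem X_pow_dvd_smul {k : ℕ} {a : ℂ⟦X⟧} (c : ℂ) (h : (PowerSeries.X : ℂ⟦X⟧) ^ k ∣ a) :
    (PowerSeries.X : ℂ⟦X⟧) ^ k ∣ c • a := by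
  rw [PowerSeries.smul_eq_C_mul]; exact h.mul_left _

theorem integral_one_mul_inv (M : TensorModel D) (hN : 0 < N) :
    (M.integral N fun _ => 1) * (M.integral N fun _ => 1)⁻¹ = 1 := by
  refine PowerSeries.mul_inv_cancel _ ?_
  rw [integral_eq_sumSeries M hN (F := 1) (by simp), ← PowerSeries.coeff_zero_eq_constantCoeff_apply,
    sumSeries, PowerSeries.coeff_mk]
  simp [gaussianFunctional_one]

end Polynomials

/-! ### Cumulants with insertions of the interaction. -/

section Exponential

variable {D N : ℕ} {Λ : Type} [Fintype Λ] [DecidableEq Λ]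

/-- Moments of the fields `ext` and `k` copies of the interaction. -/
noncomputable def mixedMoment (M : TensorModel D) (N : ℕ) (ext : Λ → Obs D N) (k : ℕ)
    (U : Finset (Λ ⊕ Fin k)) : ℂ⟦X⟧ :=
  gaussE D N (∏ x ∈ U, Sum.elim ext (fun _ => M.interactionPoly N) x)

/-- The cumulant of the fields in `S` and `k` copies of the interaction. -/
noncomputable def mixedCumulant (M : TensorModel D) (N : ℕ) (ext : Λ → Obs D N) (k : ℕ)
    (S : Finset Λ) : ℂ⟦X⟧ :=
  jointCumulant (mixedMoment M N ext k) (S.disjSum Finset.univ)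

theorem mixedMoment_empty (M : TensorModel D) (ext : Λ → Obs D N) (k : ℕ) :
    mixedMoment M N ext k ∅ = 1 := by
  simp [mixedMoment, gaussianFunctional_one]

theorem mixedMoment_disjSum (M : TensorModel D) (ext : Λ → Obs D N) (k : ℕ) (S : Finset Λ)
    (J : Finset (Fin k)) :
    mixedMoment M N ext k (S.disjSum J)
      = gaussE D N (M.interactionPoly N ^ J.card * ∏ x ∈ S, ext x) := by
  simp [mixedMoment, Finset.prod_disjSum, mul_comm]

/-- The copies of the interaction are interchangeable, so only their number matters; the increasing
enumeration of `J` transports one cumulant to the other. -/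
theorem jointCumulant_mixedMoment (M : TensorModel D) (ext : Λ → Obs D N) (k : ℕ) {S : Finset Λ}
    (hS : S.Nonempty) (J : Finset (Fin k)) :
    jointCumulant (mixedMoment M N ext k) (S.disjSum J) = mixedCumulant M N ext J.card S := by
  let e : Λ ⊕ Fin J.card ↪ Λ ⊕ Fin k :=
    ⟨Sum.map id (J.orderEmbOfFin rfl), Sum.map_injective.2
      ⟨Function.injective_id, (J.orderEmbOfFin rfl).injective⟩⟩
  have h1 : (S.disjSum (Finset.univ : Finset (Fin J.card))).map e = S.disjSum J := by
    ext x
    rcases x with x | x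
    · simp [e]
    · simp only [Finset.mem_map, Finset.mem_disjSum, Function.Embedding.coeFn_mk, e]
      constructor
      · rintro ⟨y, hy, hx⟩
        rcases y with y | y
        · simp at hx
        · simp only [Sum.map_inr, Sum.inr.injEq] at hx
          right; exact ⟨x, hx ▸ J.orderEmbOfFin_mem rfl y, rfl⟩
      · rintro (⟨a, _, h⟩ | ⟨a, ha, h⟩)
        · simp at h
        · obtain rfl := Sum.inr.inj h
          have : a ∈ Set.range (J.orderEmbOfFin rfl) := by
            rw [Finset.range_orderEmbOfFin]; exact ha
          obtain ⟨y, rfl⟩ := this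
          exact ⟨Sum.inr y, by simp, rfl⟩
  have hne : (S.disjSum (Finset.univ : Finset (Fin J.card))).Nonempty := by
    obtain ⟨x, hx⟩ := hS
    exact ⟨Sum.inl x, by simp [hx]⟩
  rw [← h1, jointCumulant_map e (mixedMoment_empty M ext k) hne, mixedCumulant]
  congr 1
  funext U
  simp only [mixedMoment, Finset.prod_map]
  congr 1
  refine Finset.prod_congr rfl fun x _ => ?_
  rcases x with x | x <;> rfl

/-- The rooted recursion for the fields and the `k` interaction copies together. Grouping the
subsets of copies by cardinality produces the binomial coefficients. -/
theorem gaussE_pow_mul_prod (M : TensorModel D) (ext : Λ → Obs D N) (k : ℕ) {S : Finset Λ} {x : Λ}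
    (hx : x ∈ S) :
    gaussE D N (M.interactionPoly N ^ k * ∏ x ∈ S, ext x)
      = ∑ b ∈ rootedSubsets S x, ∑ q ∈ Finset.HasAntidiagonal.antidiagonal k,
        (k.choose q.1 : ℂ) • (mixedCumulant M N ext q.1 b
          * gaussE D N (M.interactionPoly N ^ q.2 * ∏ x ∈ S \ b, ext x)) := by
  have h1 := moment_eq_sum_rooted (mixedMoment_empty M ext k)
    (show Sum.inl x ∈ S.disjSum (Finset.univ : Finset (Fin k)) by simp [hx])
  rw [mixedMoment_disjSum, Finset.card_univ, Fintype.card_fin] at h1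
  rw [h1]
  have h2 : ∀ b ∈ rootedSubsets S x, ∑ q ∈ Finset.HasAntidiagonal.antidiagonal k,
        (k.choose q.1 : ℂ) • (mixedCumulant M N ext q.1 b
          * gaussE D N (M.interactionPoly N ^ q.2 * ∏ x ∈ S \ b, ext x))
      = ∑ J : Finset (Fin k), mixedCumulant M N ext J.card b
          * gaussE D N (M.interactionPoly N ^ (k - J.card) * ∏ x ∈ S \ b, ext x) := by
    intro b _
    have h3 := Finset.sum_powerset_apply_card (x := (Finset.univ : Finset (Fin k)))
      (fun j => mixedCumulant M N ext j b
          * gaussE D N (M.interactionPoly N ^ (k - j) * ∏ x ∈ S \ b, ext x))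
    rw [Finset.powerset_univ] at h3
    rw [h3, Finset.card_univ, Fintype.card_fin, Finset.Nat.sum_antidiagonal_eq_sum_range_succ_mk]
    refine Finset.sum_congr rfl fun j _ => ?_
    rw [Nat.cast_smul_eq_nsmul]
  rw [Finset.sum_congr rfl h2, ← Finset.sum_product']
  refine Finset.sum_bij' (fun V _ => (V.toLeft, V.toRight)) (fun q _ => q.1.disjSum q.2)
    ?_ ?_ ?_ ?_ ?_
  · intro V hV
    rw [mem_rootedSubsets] at hV
    simp only [Finset.mem_product, mem_rootedSubsets, Finset.mem_univ, and_true,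
      Finset.mem_toLeft]
    refine ⟨fun y hy => ?_, hV.2⟩
    simpa using hV.1 (Finset.mem_toLeft.1 hy)
  · rintro ⟨b, J⟩ hq
    simp only [Finset.mem_product, mem_rootedSubsets, Finset.mem_univ, and_true] at hq
    rw [mem_rootedSubsets]
    exact ⟨Finset.disjSum_mono hq.1 (Finset.subset_univ _), by simp [hq.2]⟩
  · intro V _
    exact Finset.toLeft_disjSum_toRight
  · rintro ⟨b, J⟩ _
    simp
  · intro V hV
    rw [mem_rootedSubsets] at hV
    have hV' : V = V.toLeft.disjSum V.toRight := Finset.toLeft_disjSum_toRight.symm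
    have h4 : S.disjSum (Finset.univ : Finset (Fin k)) \ V
        = (S \ V.toLeft).disjSum (V.toRight)ᶜ := by
      ext y; rcases y with y | y <;> simp
    rw [h4, mixedMoment_disjSum, Finset.card_compl, Fintype.card_fin]
    have h5 := jointCumulant_mixedMoment M ext k ⟨x, Finset.mem_toLeft.2 hV.2⟩ V.toRight
    rw [← hV'] at h5
    rw [h5]

/-- Each copy of the interaction carries a factor `z`, which `jointCumulant_weight` pulls out. -/
theorem X_pow_dvd_mixedCumulant (M : TensorModel D) (ext : Λ → Obs D N) (k : ℕ) (S : Finset Λ) :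
    (PowerSeries.X : ℂ⟦X⟧) ^ k ∣ mixedCumulant M N ext k S := by
  have h : mixedMoment M N ext k = fun s : Finset (Λ ⊕ Fin k) =>
      (∏ x ∈ s, Sum.elim (fun _ => 1) (fun _ => PowerSeries.X) x)
        * gaussE D N (∏ x ∈ s, Sum.elim ext (fun _ => M.interactionQuot N) x) := by
    funext s
    rw [mixedMoment, ← smul_eq_mul, ← map_smul, ← Finset.prod_smul]
    congr 1
    refine Finset.prod_congr rfl fun x _ => ?_
    rcases x with x | x
    · simp
    · simp [interactionPoly_eq]
  rw [mixedCumulant, h, jointCumulant_weight, Finset.prod_disjSum]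
  simp

/-- The cumulants of the perturbed Gaussian measure are sums of Gaussian cumulants. -/
theorem jointCumulant_expectation (M : TensorModel D) (hN : 0 < N) (ext : Λ → Obs D N)
    (f : Finset Λ → Tensor D N → ℂ)
    (hf : ∀ S T, tensorEval T (∏ x ∈ S, ext x) = PowerSeries.C (f S T)) {S : Finset Λ}
    (hS : S.Nonempty) :
    jointCumulant (fun S => M.expectation N (f S)) S
      = sumSeries fun k => ((k.factorial : ℂ)⁻¹) • mixedCumulant M N ext k S := by
  symm
  set H : Finset Λ → ℂ⟦X⟧ := fun S => sumSeries fun k =>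
      ((k.factorial : ℂ)⁻¹) • gaussE D N (M.interactionPoly N ^ k * ∏ x ∈ S, ext x) with hH
  have hint : ∀ S, M.integral N (f S) = H S := fun S => integral_eq_sumSeries M hN (hf S)
  have hone : f ∅ = fun _ => 1 := by
    funext T
    have := hf ∅ T
    rw [Finset.prod_empty, map_one] at this
    exact (PowerSeries.C_injective (by rw [map_one]; exact this)).symm
  refine jointCumulant_unique (c := fun S => sumSeries fun k =>
    ((k.factorial : ℂ)⁻¹) • mixedCumulant M N ext k S) ?_ ?_ hS
  · simp only [TensorModel.expectation]
    rw [hone, integral_one_mul_inv M hN]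
  · rintro S ⟨x, hx⟩
    refine ⟨x, hx, ?_⟩
    -- The normalization occurs once on each side, in the moment of `S` and in that of `S \ b`, so
    -- it factors out and vacuum diagrams need no separate treatment.
    simp only [TensorModel.expectation, hint, ← mul_assoc]
    rw [← Finset.sum_mul]
    congr 1
    have h1 : ∀ b ∈ rootedSubsets S x,
        (sumSeries fun k => ((k.factorial : ℂ)⁻¹) • mixedCumulant M N ext k b) * H (S \ b)
        = sumSeries fun k => ∑ q ∈ Finset.HasAntidiagonal.antidiagonal k,
          (((q.1.factorial : ℂ)⁻¹) • mixedCumulant M N ext q.1 b) * (((q.2.factorial : ℂ)⁻¹) •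
            gaussE D N (M.interactionPoly N ^ q.2 * ∏ x ∈ S \ b, ext x)) := fun b _ =>
      sumSeries_mul (fun k => X_pow_dvd_smul _ (X_pow_dvd_mixedCumulant M ext k b))
        fun k => X_pow_dvd_smul _ (X_pow_dvd_gaussE M k _)
    rw [Finset.sum_congr rfl h1, sumSeries_sum, hH]
    refine congrArg sumSeries (funext fun k => ?_)
    rw [gaussE_pow_mul_prod M ext k hx, Finset.smul_sum]
    refine Finset.sum_congr rfl fun b _ => ?_
    rw [Finset.smul_sum]
    refine Finset.sum_congr rfl fun q hq => ?_
    rw [smul_mul_smul_comm, smul_smul]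
    congr 1
    rw [Finset.HasAntidiagonal.mem_antidiagonal] at hq
    have h2 := Nat.choose_mul_factorial_mul_factorial (show q.1 ≤ k by omega)
    rw [show k - q.1 = q.2 by omega] at h2
    have h3 : (k.factorial : ℂ) = k.choose q.1 * q.1.factorial * q.2.factorial := by
      exact_mod_cast h2.symm
    have h4 : (q.1.factorial : ℂ) ≠ 0 := by exact_mod_cast q.1.factorial_ne_zero
    have h5 : (q.2.factorial : ℂ) ≠ 0 := by exact_mod_cast q.2.factorial_ne_zero
    have h6 : (k.choose q.1 : ℂ) ≠ 0 := by
      exact_mod_cast (Nat.choose_pos (by omega)).ne'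
    rw [h3]
    field_simp

end Exponential

/-! ### Feynman expansion -/

section Expansion

variable {D N k : ℕ} {V : Type} [Fintype V] [DecidableEq V] {p : Fin k → ℕ}

theorem ite_one_zero_congr {P Q : Prop} {_ : Decidable P} {_ : Decidable Q} (h : P ↔ Q) :
    (if P then 1 else 0 : ℂ) = if Q then 1 else 0 := by
  by_cases hP : P
  · rw [if_pos hP, if_pos (h.1 hP)]
  · rw [if_neg hP, if_neg (mt h.2 hP)]

theorem prod_ite_one_zero {W : Type*} [Fintype W] {P : W → Prop} {_ : DecidablePred P}
    [Decidable (∀ w, P w)] :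
    (∏ w, if P w then 1 else 0 : ℂ) = if ∀ w, P w then 1 else 0 := by
  split_ifs with h
  · exact Finset.prod_eq_one fun w _ => if_pos (h w)
  · push Not at h
    obtain ⟨w, h⟩ := h
    exact Finset.prod_eq_zero (Finset.mem_univ w) (if_neg h)

theorem traceOperator_eq_ite {W : Type} [Fintype W] (B : ColoredGraph D W) (a b : W → Index D N)
    [Decidable (∀ c v, a v c = b (B c v) c)] :
    traceOperator B a b = if ∀ c v, a v c = b (B c v) c then 1 else 0 := by
  split_ifs with h
  · exact Finset.prod_eq_one fun c _ => Finset.prod_eq_one fun v _ => if_pos (h c v)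
  · push Not at h
    obtain ⟨c, v, h⟩ := h
    exact Finset.prod_eq_zero (Finset.mem_univ c)
      (Finset.prod_eq_zero (Finset.mem_univ v) (if_neg h))

/-- The entries of the tensor and of its conjugate, as polynomials. -/
noncomputable def entries (a b : V → Index D N) : V ⊕ V → Obs D N :=
  Sum.elim (fun v => MvPolynomial.X (Sum.inl (a v))) fun v => MvPolynomial.X (Sum.inr (b v))

/-- The white (or black) legs of the external entries and of `k` interaction vertices. -/
abbrev Legs (V : Type) {k : ℕ} (p : Fin k → ℕ) := V ⊕ Σ j, Fin (p j)

/-- The external entry or interaction vertex of a white leg. -/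
def whiteLabel : Legs V p → (V ⊕ V) ⊕ Fin k :=
  Sum.elim (fun v => Sum.inl (Sum.inl v)) fun x => Sum.inr x.1

/-- The external entry or interaction vertex of a black leg. -/
def blackLabel : Legs V p → (V ⊕ V) ⊕ Fin k :=
  Sum.elim (fun v => Sum.inl (Sum.inr v)) fun x => Sum.inr x.1

/-- The indices of the entries in the interaction vertices. -/
abbrev VertexIndices (D N : ℕ) {k : ℕ} (p : Fin k → ℕ) :=
  ∀ j, (Fin (p j) → Index D N) × (Fin (p j) → Index D N)

/-- The index of the entry at a white leg. -/
def whiteIndex (a : V → Index D N) (q : VertexIndices D N p) : Legs V p → Index D N :=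
  Sum.elim a fun x => (q x.1).1 x.2

/-- The index of the entry at a black leg. -/
def blackIndex (b : V → Index D N) (q : VertexIndices D N p) : Legs V p → Index D N :=
  Sum.elim b fun x => (q x.1).2 x.2

theorem prod_mem_eq_ite {Λ M : Type*} [Fintype Λ] [DecidableEq Λ] [CommMonoid M] (U : Finset Λ)
    (F : Λ → M) : ∏ x ∈ U, F x = ∏ x, if x ∈ U then F x else 1 := by
  rw [Finset.prod_ite_mem, Finset.univ_inter]

theorem prod_entries_elim (a b : V → Index D N) (q : VertexIndices D N p)
    (U : Finset ((V ⊕ V) ⊕ Fin k)) :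
    ∏ x ∈ U, Sum.elim (entries a b) (fun j => legMonomial (q j).1 (q j).2) x
      = (∏ w ∈ legs whiteLabel U,
          (MvPolynomial.X (Sum.inl (whiteIndex a q w)) : Obs D N))
        * ∏ w ∈ legs blackLabel U, MvPolynomial.X (Sum.inr (blackIndex b q w)) := by
  rw [prod_mem_eq_ite, legs, legs, Finset.prod_filter, Finset.prod_filter, Fintype.prod_sum_type,
    Fintype.prod_sum_type, Fintype.prod_sum_type, Fintype.prod_sum_type, Fintype.prod_sigma,
    Fintype.prod_sigma]
  simp only [Sum.elim_inl, Sum.elim_inr, entries, whiteIndex, blackIndex]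
  rw [mul_mul_mul_comm, ← Finset.prod_mul_distrib (s := (Finset.univ : Finset (Fin k)))]
  congr 1
  refine Finset.prod_congr rfl fun j _ => ?_
  by_cases h : (Sum.inr j : (V ⊕ V) ⊕ Fin k) ∈ U
  · have hw : ∀ v, whiteLabel (V := V) (p := p) (Sum.inr ⟨j, v⟩) ∈ U := fun _ => h
    have hb : ∀ v, blackLabel (V := V) (p := p) (Sum.inr ⟨j, v⟩) ∈ U := fun _ => h
    rw [if_pos h, Finset.prod_congr rfl fun v _ => if_pos (hw v),
      Finset.prod_congr rfl fun v _ => if_pos (hb v), legMonomial]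
  · have hw : ∀ v, whiteLabel (V := V) (p := p) (Sum.inr ⟨j, v⟩) ∉ U := fun _ => h
    have hb : ∀ v, blackLabel (V := V) (p := p) (Sum.inr ⟨j, v⟩) ∉ U := fun _ => h
    rw [if_neg h, Finset.prod_eq_one fun v _ => if_neg (hw v),
      Finset.prod_eq_one fun v _ => if_neg (hb v), mul_one]

theorem gaussE_prod_entries (hN : 0 < N) (a b : V → Index D N) (q : VertexIndices D N p)
    (U : Finset ((V ⊕ V) ⊕ Fin k)) :
    gaussE D N (∏ x ∈ U, Sum.elim (entries a b) (fun j => legMonomial (q j).1 (q j).2) x)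
      = pairingMoment whiteLabel blackLabel (fun w v => algebraMap ℂ ℂ⟦X⟧
        (if whiteIndex a q w = blackIndex b q v then ((N : ℂ) ^ (D - 1))⁻¹ else 0)) U := by
  rw [prod_entries_elim, gaussianFunctional_prod
    (pow_ne_zero _ (Nat.cast_ne_zero.2 hN.ne')), pairingMoment]

/-- The colored graph whose vertices are the pairs of a Wick contraction `τ` and the external
legs. -/
def contractionGraph (C : ∀ j, ColoredGraph D (Fin (p j))) (τ : Equiv.Perm (Legs V p)) :
    ColoredGraph D (Legs V p ⊕ V) := fun c =>
  { toFun := Sum.elim (Sum.elim Sum.inr fun x => Sum.inl (τ.symm (Sum.inr ⟨x.1, C x.1 c x.2⟩)))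
      fun v => Sum.inl (τ.symm (Sum.inl v))
    invFun := Sum.elim (fun w => Sum.elim Sum.inr
      (fun x => Sum.inl (Sum.inr ⟨x.1, (C x.1 c).symm x.2⟩)) (τ w)) fun v => Sum.inl (Sum.inl v)
    left_inv := by rintro ((v | x) | v) <;> simp
    right_inv := by
      rintro (w | v)
      · obtain ⟨u, rfl⟩ := τ.symm.surjective w
        rcases u with v | x <;> simp
      · simp }

/-- The pair with white leg `w` carries one index `z w`, which determines the vertex indices. It
acts as a white vertex for its white leg and as a black one for its black leg; an external entry
sits at the opposite end of its leg, so `b` appears on the white side and `a` on the black side. -/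
theorem sum_traceOperator_wick (C : ∀ j, ColoredGraph D (Fin (p j)))
    (τ : Equiv.Perm (Legs V p)) (a b : V → Index D N) :
    ∑ q : VertexIndices D N p, (∏ j, traceOperator (C j) (q j).1 (q j).2)
        * (∏ w, if whiteIndex a q w = blackIndex b q (τ w) then 1 else 0)
      = ∑ z : Legs V p → Index D N,
          traceOperator (contractionGraph C τ) (Sum.elim z b) (Sum.elim z a) := by
  classical
  have h1 : ∀ q : VertexIndices D N p,
      (∏ w, if whiteIndex a q w = blackIndex b q (τ w) then (1 : ℂ) else 0)
        = ∑ z : Legs V p → Index D N,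
          if whiteIndex a q = z ∧ blackIndex b q ∘ τ = z then 1 else 0 := by
    intro q
    rw [prod_ite_one_zero, Finset.sum_eq_single (whiteIndex a q)]
    · exact ite_one_zero_congr ⟨fun h => ⟨rfl, funext fun w => (h w).symm⟩,
        fun h w => (congrFun h.2 w).symm⟩
    · intro z _ hz
      exact if_neg fun h => hz h.1.symm
    · simp
  simp only [h1, Finset.mul_sum]
  rw [Finset.sum_comm]
  refine Finset.sum_congr rfl fun z _ => ?_
  rw [Finset.sum_eq_single (fun j => (fun v => z (Sum.inr ⟨j, v⟩),
    fun v => z (τ.symm (Sum.inr ⟨j, v⟩))))]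
  · simp only [traceOperator_eq_ite]
    rw [prod_ite_one_zero, ite_zero_mul_ite_zero, mul_one]
    refine ite_one_zero_congr ?_
    constructor
    · rintro ⟨h1, h2, h3⟩ c ((v | ⟨j, v⟩) | v)
      · have := congrFun h2 (Sum.inl v)
        simp only [whiteIndex, Sum.elim_inl] at this
        simp [contractionGraph, this]
      · simpa [contractionGraph] using h1 j c v
      · have := congrFun h3 (τ.symm (Sum.inl v))
        simp only [Function.comp_apply, Equiv.apply_symm_apply, blackIndex, Sum.elim_inl] at this
        simp [contractionGraph, this]
    · intro h
      refine ⟨fun j c v => by simpa [contractionGraph] using h c (Sum.inl (Sum.inr ⟨j, v⟩)),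
        funext fun w => ?_, funext fun w => ?_⟩
      · rcases w with v | x
        · funext c
          simpa [contractionGraph, whiteIndex] using (h c (Sum.inl (Sum.inl v))).symm
        · rfl
      · obtain ⟨u, rfl⟩ := τ.symm.surjective w
        rcases u with v | x
        · funext c
          simpa [contractionGraph, blackIndex] using h c (Sum.inr v)
        · simp [blackIndex]
  · intro q _ hq
    rw [if_neg, mul_zero]
    rintro ⟨h2, h3⟩
    refine hq (funext fun j => Prod.ext (funext fun v => ?_) (funext fun v => ?_))
    · exact congrFun h2 (Sum.inr ⟨j, v⟩)
    · have := congrFun h3 (τ.symm (Sum.inr ⟨j, v⟩))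
      simpa [blackIndex] using this
  · simp

theorem map_interactionPoly {Λ : Type} [Fintype Λ] [DecidableEq Λ] (M : TensorModel D)
    (Φ : MultilinearMap ℂ⟦X⟧ (fun _ : Λ ⊕ Fin k => Obs D N) ℂ⟦X⟧) (ext : Λ → Obs D N) :
    Φ (Sum.elim ext fun _ => M.interactionPoly N)
      = ∑ i : Fin k → M.I, (∏ j, (PowerSeries.monomial (M.p (i j) - 1)
          ((N : ℂ) ^ (D - 1) * (M.t (i j) / (M.p (i j) : ℂ))) : ℂ⟦X⟧))
        * ∑ q : VertexIndices D N (fun j => M.p (i j)),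
          algebraMap ℂ ℂ⟦X⟧ (∏ j, traceOperator (M.bubble (i j)) (q j).1 (q j).2)
          * Φ (Sum.elim ext fun j => legMonomial (q j).1 (q j).2) := by
  classical
  -- Currying freezes the external slots, so the multilinear expansion runs over the interaction
  -- slots only.
  have h : ∀ y : Fin k → Obs D N, Φ (Sum.elim ext y) = Φ.currySum ext y := by
    intro y
    rw [MultilinearMap.currySum_apply]
    congr 1
  simp only [h, TensorModel.interactionPoly]
  rw [MultilinearMap.map_sum]
  refine Finset.sum_congr rfl fun i _ => ?_
  rw [MultilinearMap.map_smul_univ, smul_eq_mul]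
  congr 1
  simp only [tracePoly]
  rw [MultilinearMap.map_sum]
  refine Finset.sum_congr rfl fun q _ => ?_
  rw [MultilinearMap.map_smul_univ, smul_eq_mul, ← map_prod]
  rfl

end Expansion

/-! ### Powers of `N` in Wick contractions. -/

section Amplitudes

variable {D N k : ℕ} {V : Type} [Fintype V] [DecidableEq V] {p : Fin k → ℕ}

open Classical in
theorem sum_wick (C : ∀ j, ColoredGraph D (Fin (p j))) (P : Finset (Legs V p × Legs V p) → Prop)
    (a b : V → Index D N) (l : ℂ) :
    ∑ q : VertexIndices D N p, algebraMap ℂ ℂ⟦X⟧ (∏ j, traceOperator (C j) (q j).1 (q j).2)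
        * (∑ s ∈ matchings (Finset.univ : Finset (Legs V p)) Finset.univ with P s,
          ∏ x ∈ s, algebraMap ℂ ℂ⟦X⟧ (if whiteIndex a q x.1 = blackIndex b q x.2 then l else 0))
      = algebraMap ℂ ℂ⟦X⟧ (l ^ Fintype.card (Legs V p)
        * ∑ τ : Equiv.Perm (Legs V p) with P (permGraph τ), ∑ z : Legs V p → Index D N,
          traceOperator (contractionGraph C τ) (Sum.elim z b) (Sum.elim z a)) := by
  have h0 := fun q : VertexIndices D N p => sum_matchings_univ P fun w v =>
    algebraMap ℂ ℂ⟦X⟧ (if whiteIndex a q w = blackIndex b q v then l else 0)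
  simp only [h0, ← sum_traceOperator_wick]
  simp only [← map_prod, ← map_sum, ← map_mul]
  congr 1
  simp only [Finset.mul_sum]
  rw [Finset.sum_comm]
  refine Finset.sum_congr rfl fun τ _ => Finset.sum_congr rfl fun q _ => ?_
  have h : ∀ w, (if whiteIndex a q w = blackIndex b q (τ w) then l else 0)
      = l * if whiteIndex a q w = blackIndex b q (τ w) then 1 else 0 := fun w => by
    rw [mul_ite, mul_one, mul_zero]
  simp only [h]
  rw [Finset.prod_mul_distrib, Finset.prod_const, Finset.card_univ]
  ring

/-- As long as the two copies of a pair are not identified, every edge stays within one interaction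
vertex or one external entry, so the label is an invariant of components. -/
theorem card_labels_le_numComponents (C : ∀ j, ColoredGraph D (Fin (p j))) (hp : ∀ j, 0 < p j)
    (τ : Equiv.Perm (Legs V p)) :
    k + 2 * Fintype.card V ≤ numComponents (contractionGraph C τ) := by
  obtain ⟨f, hf⟩ := exists_comp_lift (B := contractionGraph C τ)
    (F := Sum.elim (Sum.elim whiteLabel fun v => Sum.inl (Sum.inr v))
      (Sum.elim (fun w => blackLabel (τ w)) fun v => Sum.inl (Sum.inl v))) (by
    rintro c ((v | x) | v) <;> simp [contractionGraph, whiteLabel, blackLabel])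
  have hs : Function.Surjective f := by
    rintro ((v | v) | j)
    · exact ⟨_, hf (Sum.inl (Sum.inl (Sum.inl v)))⟩
    · exact ⟨_, hf (Sum.inl (Sum.inr v))⟩
    · exact ⟨_, hf (Sum.inl (Sum.inl (Sum.inr ⟨j, ⟨0, hp j⟩⟩)))⟩
  have h := Nat.card_le_card_of_surjective f hs
  rw [Nat.card_eq_fintype_card, Fintype.card_sum, Fintype.card_sum, Fintype.card_fin] at h
  rw [numComponents]
  omega

/-- The Wick contraction connects all the labels. -/
def ConnectsLabels (τ : Equiv.Perm (Legs V p)) : Prop :=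
  ∀ x y, Linked whiteLabel blackLabel (permGraph τ) x y

/-- This gives `JoinConnected` for the contraction graph. Connected bubbles force one value of `F`
per label, and identifying the two copies of a pair equates the values at the labels of its legs. -/
theorem apply_eq_of_connectsLabels (C : ∀ j, ColoredGraph D (Fin (p j))) (hD : 0 < D)
    (hp : ∀ j, 0 < p j) (hC : ∀ j, (toSimpleGraph (C j)).Connected) {τ : Equiv.Perm (Legs V p)}
    (hτ : ConnectsLabels τ) {α : Type} {F : (Legs V p ⊕ V) ⊕ (Legs V p ⊕ V) → α}
    (hF : ∀ c v, F (Sum.inl v) = F (Sum.inr (contractionGraph C τ c v)))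
    (hJ : ∀ s, F (Sum.inl (Sum.inl s)) = F (Sum.inr (Sum.inl s))) (u v) : F u = F v := by
  let c₀ : Fin D := ⟨0, hD⟩
  let G : (V ⊕ V) ⊕ Fin k → α := Sum.elim
    (Sum.elim (fun v => F (Sum.inl (Sum.inl (Sum.inl v)))) fun v => F (Sum.inl (Sum.inr v)))
    fun j => F (Sum.inl (Sum.inl (Sum.inr ⟨j, ⟨0, hp j⟩⟩)))
  have hbub : ∀ j (u v : Fin (p j) ⊕ Fin (p j)),
      Sum.elim (fun v => F (Sum.inl (Sum.inl (Sum.inr ⟨j, v⟩))))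
        (fun v => F (Sum.inr (Sum.inl (τ.symm (Sum.inr ⟨j, v⟩))))) u
      = Sum.elim (fun v => F (Sum.inl (Sum.inl (Sum.inr ⟨j, v⟩))))
        (fun v => F (Sum.inr (Sum.inl (τ.symm (Sum.inr ⟨j, v⟩))))) v := fun j u v =>
    eq_of_reachable (B := C j) (fun c v => by
      simpa [contractionGraph] using hF c (Sum.inl (Sum.inr ⟨j, v⟩))) ((hC j).preconnected u v)
  have hwhite : ∀ w : Legs V p, F (Sum.inl (Sum.inl w)) = G (whiteLabel w) := by
    rintro (v | ⟨j, v⟩)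
    · rfl
    · exact hbub j (Sum.inl v) (Sum.inl ⟨0, hp j⟩)
  have hblack : ∀ w : Legs V p, F (Sum.inr (Sum.inl w)) = G (blackLabel (τ w)) := by
    intro w
    obtain ⟨x, rfl⟩ := τ.symm.surjective w
    rw [Equiv.apply_symm_apply]
    rcases x with v | ⟨j, v⟩
    · exact (hF c₀ (Sum.inr v)).symm
    · exact hbub j (Sum.inr v) (Sum.inl ⟨0, hp j⟩)
  have hG : ∀ x y, G x = G y := by
    intro x y
    have h := hτ x y
    induction h with
    | rel x y h =>
      obtain ⟨⟨w, w'⟩, hq, rfl, rfl⟩ := h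
      have hq' : τ w = w' := mem_permGraph.1 hq
      simp only
      rw [← hwhite, ← hq', ← hblack, hJ]
    | refl x => rfl
    | symm x y _ ih => exact ih.symm
    | trans x y z _ _ ih1 ih2 => exact ih1.trans ih2
  have hall : ∀ u, ∃ x, F u = G x := by
    rintro ((w | v) | (w | v))
    · exact ⟨_, hwhite w⟩
    · exact ⟨Sum.inl (Sum.inr v), rfl⟩
    · exact ⟨_, hblack w⟩
    · exact ⟨Sum.inl (Sum.inl v), (hF c₀ (Sum.inl (Sum.inl v))).symm⟩
  obtain ⟨x, hx⟩ := hall u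
  obtain ⟨y, hy⟩ := hall v
  rw [hx, hy, hG x y]

theorem traceOperator_symm (B : ColoredGraph D V) (a b : V → Index D N) :
    traceOperator B b a = traceOperator (fun c => (B c).symm) a b := by
  refine Finset.prod_congr rfl fun c _ => ?_
  rw [← Equiv.prod_comp (B c).symm]
  refine Finset.prod_congr rfl fun v _ => ?_
  rw [Equiv.apply_symm_apply]
  exact ite_one_zero_congr eq_comm

theorem numComponents_symm_le (B : ColoredGraph D V) :
    numComponents (fun c => (B c).symm) ≤ numComponents B := by
  obtain ⟨f, hf⟩ := exists_comp_lift (B := B)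
    (F := fun u => comp (fun c => (B c).symm) u.swap) (by
      intro c v
      simpa using (comp_edge (fun c => (B c).symm) c (B c v)).symm)
  refine Nat.card_le_card_of_surjective f fun x => ?_
  obtain ⟨u, rfl⟩ := x.exists_rep
  exact ⟨comp B u.swap, by rw [hf, Sum.swap_swap]; rfl⟩

/-- All pairs are summed as internal vertices. The bound is that of
`exists_boundary_of_joinConnected` with at least one component per label, and inverse permutations
restore `a` to the white side. -/
theorem exists_contraction_boundary (hD : 0 < D) (C : ∀ j, ColoredGraph D (Fin (p j)))
    (τ : Equiv.Perm (Legs V p)) :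
    ∃ (g : ColoredGraph D V) (E : ℕ),
      (∀ (N : ℕ) (a b : V → Index D N), ∑ z : Legs V p → Index D N,
        traceOperator (contractionGraph C τ) (Sum.elim z b) (Sum.elim z a)
          = (N : ℂ) ^ E * traceOperator g a b) ∧
      ((∀ j, 0 < p j) → (∀ j, (toSimpleGraph (C j)).Connected) → ConnectsLabels τ →
        E + numComponents g + (D - 1) * (k + 2 * Fintype.card V)
          ≤ (D - 1) * Fintype.card (Legs V p) + D) := by
  let e : Legs V p ⊕ V ≃ Fin (Fintype.card (Legs V p)) ⊕ V :=
    Equiv.sumCongr (Fintype.equivFin _) (Equiv.refl V)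
  let B := relabel (contractionGraph C τ) e e
  have hsum : ∀ {N : ℕ} (a b : V → Index D N),
      ∑ z : Legs V p → Index D N,
        traceOperator (contractionGraph C τ) (Sum.elim z b) (Sum.elim z a)
      = ∑ z : Fin (Fintype.card (Legs V p)) → Index D N,
        traceOperator B (Sum.elim z b) (Sum.elim z a) := by
    intro N a b
    rw [← Equiv.sum_comp (Equiv.arrowCongr (Fintype.equivFin (Legs V p)).symm
      (Equiv.refl (Index D N)))]
    refine Finset.sum_congr rfl fun z _ => ?_
    rw [traceOperator_relabel]
    congr 1 <;> funext x <;> rcases x with x | x <;> rfl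
  by_cases h : (∀ j, 0 < p j) ∧ (∀ j, (toSimpleGraph (C j)).Connected) ∧ ConnectsLabels τ
  · obtain ⟨hp, hC, hτ⟩ := h
    obtain ⟨g, E, h1, h2⟩ := exists_boundary_of_joinConnected hD _ B (by
      intro α F hF hJ
      have h3 := apply_eq_of_connectsLabels C hD hp hC hτ (F := F ∘ Sum.map e e)
        (fun c v => by simpa [B, relabel] using hF c (e v))
        (fun s => hJ _)
      intro u v
      obtain ⟨u, rfl⟩ := (Equiv.sumCongr e e).surjective u
      obtain ⟨v, rfl⟩ := (Equiv.sumCongr e e).surjective v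
      exact h3 u v)
    refine ⟨fun c => (g c).symm, E, fun N a b => ?_, fun _ _ _ => ?_⟩
    · rw [hsum, h1, traceOperator_symm]
    · have h3 := numComponents_symm_le g
      have h4 := card_labels_le_numComponents C hp τ
      have h5 : numComponents B = numComponents (contractionGraph C τ) :=
        numComponents_relabel _ e e
      have h6 := Nat.mul_le_mul_left (D - 1) h4
      rw [h5] at h2
      omega
  · obtain ⟨g, E, h1, -⟩ := exists_boundary hD _ B
    refine ⟨fun c => (g c).symm, E, fun N a b => ?_, fun h1 h2 h3 => absurd ⟨h1, h2, h3⟩ h⟩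
    rw [hsum, h1, traceOperator_symm]

theorem legs_univ {Λ W : Type} [Fintype Λ] [DecidableEq Λ] [Fintype W] [DecidableEq W] (l : W → Λ) :
    legs l Finset.univ = Finset.univ := by
  ext w
  rw [mem_legs]
  simp

/-- The product of the couplings of `k` interaction vertices. -/
noncomputable def vertexWeight (M : TensorModel D) (i : Fin k → M.I) : ℂ⟦X⟧ :=
  ∏ j, PowerSeries.monomial (M.p (i j) - 1) (M.t (i j) / (M.p (i j) : ℂ))

theorem prod_monomial_eq (M : TensorModel D) (N : ℕ) (i : Fin k → M.I) :
    (∏ j, (PowerSeries.monomial (M.p (i j) - 1)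
      ((N : ℂ) ^ (D - 1) * (M.t (i j) / (M.p (i j) : ℂ))) : ℂ⟦X⟧))
      = ((N : ℂ) ^ ((D - 1) * k)) • vertexWeight M i := by
  have h : ∀ j, (PowerSeries.monomial (M.p (i j) - 1)
      ((N : ℂ) ^ (D - 1) * (M.t (i j) / (M.p (i j) : ℂ))) : ℂ⟦X⟧)
      = ((N : ℂ) ^ (D - 1)) • PowerSeries.monomial (M.p (i j) - 1)
        (M.t (i j) / (M.p (i j) : ℂ)) := fun j => by rw [← smul_eq_mul, map_smul]
  simp only [h]
  rw [Finset.prod_smul, Finset.prod_const, Finset.card_univ, Fintype.card_fin, pow_mul]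
  rfl

-- Moments and cumulants are two instances of the multilinear expansion `key`; they differ only in
-- the restriction `P` to connected contractions, and only these obey the bound on `E`.
open Classical in
theorem exists_wick_expansion (hD : 0 < D) (M : TensorModel D) (k : ℕ) (V : Type) [Fintype V]
    [DecidableEq V] :
    ∃ (g : (i : Fin k → M.I) → Equiv.Perm (Legs V fun j => M.p (i j)) → ColoredGraph D V)
      (E : (i : Fin k → M.I) → Equiv.Perm (Legs V fun j => M.p (i j)) → ℕ),
      (∀ (N : ℕ), 0 < N → ∀ (a b : V → Index D N),
        (gaussE D N (M.interactionPoly N ^ k * ∏ x, entries a b x)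
          = ∑ i : Fin k → M.I, ∑ τ,
            ((N : ℂ) ^ ((D - 1) * k) * (((N : ℂ) ^ (D - 1))⁻¹ ^
              Fintype.card (Legs V fun j => M.p (i j)) * ((N : ℂ) ^ E i τ
              * traceOperator (g i τ) a b))) • vertexWeight M i) ∧
        (Nonempty V → mixedCumulant M N (entries a b) k Finset.univ
          = ∑ i : Fin k → M.I, ∑ τ with ConnectsLabels τ,
            ((N : ℂ) ^ ((D - 1) * k) * (((N : ℂ) ^ (D - 1))⁻¹ ^
              Fintype.card (Legs V fun j => M.p (i j)) * ((N : ℂ) ^ E i τ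
              * traceOperator (g i τ) a b))) • vertexWeight M i)) ∧
      ∀ i τ, ConnectsLabels τ → E i τ + numComponents (g i τ) + (D - 1) * (k + 2 * Fintype.card V)
          ≤ (D - 1) * Fintype.card (Legs V fun j => M.p (i j)) + D := by
  choose g E hgE hb using fun (i : Fin k → M.I) (τ : Equiv.Perm (Legs V fun j => M.p (i j))) =>
    exists_contraction_boundary hD (fun j => M.bubble (i j)) τ
  have hp : ∀ (i : Fin k → M.I) j, 0 < M.p (i j) := fun i j =>
    lt_of_lt_of_le two_pos (M.two_le (i j))
  have key : ∀ (N : ℕ) (a b : V → Index D N)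
      (P : ∀ i : Fin k → M.I, Finset (Legs V (fun j => M.p (i j)) × Legs V (fun j => M.p (i j)))
        → Prop)
      (Φ : MultilinearMap ℂ⟦X⟧ (fun _ : (V ⊕ V) ⊕ Fin k => Obs D N) ℂ⟦X⟧)
      (_ : ∀ i (q : VertexIndices D N fun j => M.p (i j)),
        Φ (Sum.elim (entries a b) fun j => legMonomial (q j).1 (q j).2)
          = ∑ s ∈ matchings (Finset.univ : Finset (Legs V fun j => M.p (i j))) Finset.univ
            with P i s, ∏ x ∈ s, algebraMap ℂ ℂ⟦X⟧
            (if whiteIndex a q x.1 = blackIndex b q x.2 then ((N : ℂ) ^ (D - 1))⁻¹ else 0)),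
      Φ (Sum.elim (entries a b) fun _ => M.interactionPoly N)
        = ∑ i : Fin k → M.I, ∑ τ with P i (permGraph τ),
            ((N : ℂ) ^ ((D - 1) * k) * (((N : ℂ) ^ (D - 1))⁻¹ ^
              Fintype.card (Legs V fun j => M.p (i j)) * ((N : ℂ) ^ E i τ
              * traceOperator (g i τ) a b))) • vertexWeight M i := by
    intro N a b P Φ hΦ
    rw [map_interactionPoly]
    refine Finset.sum_congr rfl fun i _ => ?_
    simp only [hΦ i]
    rw [sum_wick (fun j => M.bubble (i j)), prod_monomial_eq]
    simp only [hgE]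
    rw [smul_mul_assoc, mul_comm (vertexWeight M i), ← Algebra.smul_def, ← Finset.sum_smul, smul_smul,
      Finset.mul_sum, Finset.mul_sum]
  refine ⟨g, E, fun N hN a b => ⟨?_, fun hV => ?_⟩, fun i τ hτ => hb i τ (hp i) (fun j => M.connected _) hτ⟩
  · have h := key N a b (fun _ _ => True)
      ((gaussE D N).compMultilinearMap (MultilinearMap.mkPiAlgebra ℂ⟦X⟧ _ _)) (by
        intro i q
        rw [LinearMap.compMultilinearMap_apply, MultilinearMap.mkPiAlgebra_apply,
          gaussE_prod_entries hN, pairingMoment, legs_univ, legs_univ]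
        exact Finset.sum_congr (by simp) fun _ _ => rfl)
    rw [LinearMap.compMultilinearMap_apply, MultilinearMap.mkPiAlgebra_apply,
      Fintype.prod_sum_type] at h
    simp only [Sum.elim_inl, Sum.elim_inr, Finset.prod_const, Finset.card_univ,
      Fintype.card_fin] at h
    rw [mul_comm, h]
    refine Finset.sum_congr rfl fun i _ => Finset.sum_congr (by simp) fun _ _ => rfl
  · have h := key N a b (fun _ s => ∀ x y, Linked whiteLabel blackLabel s x y)
      (cumulantMultilinear (gaussE D N)) (by
        intro i q
        have h1 : (fun U : Finset ((V ⊕ V) ⊕ Fin k) => gaussE D N (∏ x ∈ U,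
            Sum.elim (entries a b) (fun j => legMonomial (q j).1 (q j).2) x))
            = pairingMoment whiteLabel blackLabel _ := funext fun U => gaussE_prod_entries hN a b q U
        change jointCumulant (fun U : Finset ((V ⊕ V) ⊕ Fin k) => gaussE D N (∏ x ∈ U,
            Sum.elim (entries a b) (fun j => legMonomial (q j).1 (q j).2) x)) Finset.univ = _
        rw [h1]
        rw [← connectedMoment_eq_jointCumulant _ _ _ Finset.univ_nonempty, connectedMoment,
          legs_univ, legs_univ]
        exact Finset.sum_congr (by ext s; simp) fun _ _ => rfl)
    rw [mixedCumulant, Finset.univ_disjSum_univ]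
    exact h

end Amplitudes

/-! ### Invariant expansion of the cumulants -/

section Cumulants

variable {D N : ℕ} {V : Type} [Fintype V] [DecidableEq V]

/-- The product of the entries in `S`. -/
noncomputable def entryProduct (a b : V → Index D N) (S : Finset (V ⊕ V)) (T : Tensor D N) : ℂ :=
  ∏ x ∈ S, Sum.elim (fun v => T (a v)) (fun v => starRingEnd ℂ (T (b v))) x

/-- The moments of the entries of the tensor. -/
noncomputable def entryMoment (M : TensorModel D) (N : ℕ) (a b : V → Index D N)
    (S : Finset (V ⊕ V)) : ℂ⟦X⟧ := M.expectation N (entryProduct a b S)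

/-- The cumulants of the entries of the tensor. -/
noncomputable def entryCumulant (M : TensorModel D) (N : ℕ) (a b : V → Index D N)
    (S : Finset (V ⊕ V)) : ℂ⟦X⟧ := jointCumulant (entryMoment M N a b) S

theorem cumulant_eq_entryCumulant (M : TensorModel D) (N p : ℕ) (a b : Fin p → Index D N) :
    M.cumulant N p a b = entryCumulant M N a b Finset.univ := rfl

theorem tensorEval_prod_entries (a b : V → Index D N) (S : Finset (V ⊕ V)) (T : Tensor D N) :
    tensorEval T (∏ x ∈ S, entries a b x) = PowerSeries.C (entryProduct a b S T) := by
  rw [entryProduct, map_prod, map_prod]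
  refine Finset.prod_congr rfl fun x _ => ?_
  rcases x with v | v <;> simp [entries, tensorEval]

theorem entryMoment_empty (M : TensorModel D) (hN : 0 < N) (a b : V → Index D N) :
    entryMoment M N a b ∅ = 1 := by
  have : entryProduct a b ∅ = fun _ => 1 := funext fun T => Finset.prod_empty
  rw [entryMoment, this, TensorModel.expectation, integral_one_mul_inv M hN]

theorem entryCumulant_eq_sumSeries (M : TensorModel D) (hN : 0 < N) (a b : V → Index D N)
    {S : Finset (V ⊕ V)} (hS : S.Nonempty) :
    entryCumulant M N a b S
      = sumSeries fun k => ((k.factorial : ℂ)⁻¹) • mixedCumulant M N (entries a b) k S :=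
  jointCumulant_expectation M hN _ _ (tensorEval_prod_entries a b) hS

/-- The exponent of `N` in the leading behaviour of the coefficient of the trace invariant of `B`. -/
noncomputable def cumulantExponent (B : ColoredGraph D V) : ℤ :=
  (D : ℤ) - 2 * ((D : ℤ) - 1) * Fintype.card V - numComponents B

/-- A vertex gives `N^(D-1)`, a propagator `N^(-(D-1))`. With the bound on `E`, the total power is
`cumulantExponent` minus a natural number, which becomes the degree of a monomial in `1/N`; at order
`n` only finitely many contractions occur. -/
theorem exists_polynomial_entryCumulant (hD : 0 < D) (M : TensorModel D) (V : Type) [Fintype V]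
    [DecidableEq V] [Nonempty V] :
    ∃ P : ℕ → ColoredGraph D V → Polynomial ℂ, ∀ N : ℕ, 0 < N → ∀ (a b : V → Index D N) (n : ℕ),
      PowerSeries.coeff n (entryCumulant M N a b Finset.univ)
        = ∑ B : ColoredGraph D V, traceOperator B a b
          * ((N : ℂ) ^ cumulantExponent B * (P n B).eval (N : ℂ)⁻¹) := by
  classical
  choose g E hexp hb using fun k => exists_wick_expansion hD M k V
  refine ⟨fun n B => ∑ k ∈ Finset.range (n + 1), ∑ i : Fin k → M.I,
    ∑ τ with ConnectsLabels τ ∧ g k i τ = B,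
      Polynomial.C ((k.factorial : ℂ)⁻¹ * PowerSeries.coeff n (vertexWeight M i))
        * Polynomial.X ^ ((D - 1) * Fintype.card (Legs V fun j => M.p (i j)) + D
          - (E k i τ + numComponents (g k i τ) + (D - 1) * (k + 2 * Fintype.card V))),
    fun N hN a b n => ?_⟩
  have hN' : (N : ℂ) ≠ 0 := Nat.cast_ne_zero.2 hN.ne'
  rw [entryCumulant_eq_sumSeries M hN a b Finset.univ_nonempty, sumSeries, PowerSeries.coeff_mk]
  simp only [Polynomial.eval_finsetSum, Polynomial.eval_mul, Polynomial.eval_C, Polynomial.eval_pow,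
    Polynomial.eval_X, Finset.mul_sum]
  rw [Finset.sum_comm]
  refine Finset.sum_congr rfl fun k _ => ?_
  rw [Finset.sum_comm, PowerSeries.coeff_smul, (hexp k N hN a b).2 inferInstance, map_sum,
    Finset.smul_sum]
  refine Finset.sum_congr rfl fun i _ => ?_
  rw [map_sum, Finset.smul_sum, ← Finset.sum_fiberwise (g := g k i)]
  refine Finset.sum_congr rfl fun B _ => ?_
  rw [Finset.filter_filter]
  refine Finset.sum_congr rfl fun τ hτ => ?_
  obtain ⟨hc, rfl⟩ := (Finset.mem_filter.1 hτ).2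
  have h := hb k i τ hc
  obtain ⟨d, hd⟩ := Nat.exists_eq_add_of_le h
  rw [hd, Nat.add_sub_cancel_left, PowerSeries.coeff_smul, smul_eq_mul, smul_eq_mul]
  have h1 : (N : ℂ) ^ cumulantExponent (g k i τ) * ((N : ℂ)⁻¹) ^ d
      = (N : ℂ) ^ ((D - 1) * k) * (((N : ℂ) ^ (D - 1))⁻¹ ^
              Fintype.card (Legs V fun j => M.p (i j)) * (N : ℂ) ^ E k i τ) := by
    rw [← zpow_natCast, ← zpow_natCast, ← zpow_natCast, ← zpow_natCast, ← zpow_natCast,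
      ← zpow_neg_one, ← zpow_neg_one, ← zpow_mul, ← zpow_mul, ← zpow_mul, ← zpow_add₀ hN',
      ← zpow_add₀ hN', ← zpow_add₀ hN']
    congr 1
    rw [cumulantExponent]
    have hd' : (((D - 1 : ℕ) : ℤ)) = (D : ℤ) - 1 := by omega
    have := congrArg (Nat.cast : ℕ → ℤ) hd
    push_cast at this ⊢
    rw [hd'] at this ⊢
    linear_combination this
  calc _ = (k.factorial : ℂ)⁻¹ * PowerSeries.coeff n (vertexWeight M i)
        * traceOperator (g k i τ) a b * ((N : ℂ) ^ ((D - 1) * k) * (((N : ℂ) ^ (D - 1))⁻¹ ^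
              Fintype.card (Legs V fun j => M.p (i j)) * (N : ℂ) ^ E k i τ)) := by ring
    _ = _ := by rw [← h1]; ring

theorem exists_entryMoment_expansion (hD : 0 < D) (M : TensorModel D) (hN : 0 < N) :
    ∃ Ω : ColoredGraph D V → ℂ⟦X⟧, ∀ a b : V → Index D N,
      entryMoment M N a b Finset.univ = ∑ B : ColoredGraph D V, traceOperator B a b • Ω B := by
  classical
  choose g E hexp hb using fun k => exists_wick_expansion hD M k V
  refine ⟨fun B => (PowerSeries.mk fun n => ∑ k ∈ Finset.range (n + 1), ∑ i : Fin k → M.I,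
    ∑ τ with g k i τ = B, (k.factorial : ℂ)⁻¹ * ((N : ℂ) ^ ((D - 1) * k) * (((N : ℂ) ^ (D - 1))⁻¹ ^
              Fintype.card (Legs V fun j => M.p (i j)) * (N : ℂ) ^ E k i τ))
      * PowerSeries.coeff n (vertexWeight M i)) * (M.integral N fun _ => 1)⁻¹, fun a b => ?_⟩
  simp only [← smul_mul_assoc]
  rw [← Finset.sum_mul, entryMoment, TensorModel.expectation]
  congr 1
  rw [integral_eq_sumSeries M hN (tensorEval_prod_entries a b Finset.univ)]
  ext n
  rw [sumSeries, PowerSeries.coeff_mk, map_sum]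
  simp only [PowerSeries.coeff_smul, PowerSeries.coeff_mk, smul_eq_mul, Finset.mul_sum]
  rw [Finset.sum_comm]
  refine Finset.sum_congr rfl fun k _ => ?_
  rw [Finset.sum_comm, (hexp k N hN a b).1, map_sum, Finset.mul_sum]
  refine Finset.sum_congr rfl fun i _ => ?_
  rw [map_sum, Finset.mul_sum, ← Finset.sum_fiberwise (g := g k i)]
  refine Finset.sum_congr rfl fun B _ => ?_
  refine Finset.sum_congr rfl fun τ hτ => ?_
  obtain rfl := (Finset.mem_filter.1 hτ).2
  rw [PowerSeries.coeff_smul, smul_eq_mul]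
  ring

/-- White indices that distinguish the vertices. -/
def whiteTag (D : ℕ) (u : V → Fin N) : V → Index D N := fun v _ => u v

/-- Black indices that match the white ones along the edges of `B`. -/
def blackTag (u : V → Fin N) (B : ColoredGraph D V) : V → Index D N := fun v c => u ((B c).symm v)

/-- Inverts expansions in trace operators by evaluation: on injective tags the operators are
Kronecker deltas on labelled graphs. Hence coefficients are unique as soon as `N` is at least the
number of white vertices. -/
theorem traceOperator_tag {u : V → Fin N} (hu : Function.Injective u) (B B' : ColoredGraph D V)
    [Decidable (B' = B)] :
    traceOperator B' (whiteTag D u) (blackTag u B) = if B' = B then 1 else 0 := by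
  rw [traceOperator_eq_ite]
  refine ite_one_zero_congr ⟨fun h => funext fun c => Equiv.ext fun v => ?_, ?_⟩
  · have := hu (h c v)
    rw [Equiv.eq_symm_apply] at this
    exact this.symm
  · rintro rfl c v
    simp [whiteTag, blackTag]

theorem eq_of_expansion {u : V → Fin N} (hu : Function.Injective u)
    {m : (V → Index D N) → (V → Index D N) → ℂ⟦X⟧} {w : ColoredGraph D V → ℂ⟦X⟧}
    (h : ∀ a b, m a b = ∑ B : ColoredGraph D V, traceOperator B a b • w B) (B : ColoredGraph D V) :
    w B = m (whiteTag D u) (blackTag u B) := by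
  classical
  rw [h]
  simp [traceOperator_tag hu]

theorem entryCumulant_map {V' : Type} [Fintype V'] [DecidableEq V'] (M : TensorModel D)
    (hN : 0 < N) (e f : V' ↪ V) (a b : V → Index D N) {S : Finset (V' ⊕ V')} (hS : S.Nonempty) :
    entryCumulant M N a b (S.map (e.sumMap f)) = entryCumulant M N (a ∘ e) (b ∘ f) S := by
  rw [entryCumulant, jointCumulant_map _ (entryMoment_empty M hN a b) hS, entryCumulant]
  congr 1
  funext s
  rw [entryMoment, entryMoment]
  congr 1
  funext T
  rw [entryProduct, entryProduct, Finset.prod_map]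
  refine Finset.prod_congr rfl fun x _ => ?_
  rcases x with x | x <;> rfl

/-- The coefficient of the trace invariant of `B` in the cumulant of the entries. -/
theorem exists_cumulant_expansion (hD : 0 < D) (M : TensorModel D) (hN : 0 < N) [Nonempty V] :
    ∃ w : ColoredGraph D V → ℂ⟦X⟧, ∀ a b : V → Index D N,
      entryCumulant M N a b Finset.univ = ∑ B : ColoredGraph D V, traceOperator B a b • w B := by
  obtain ⟨P, hP⟩ := exists_polynomial_entryCumulant hD M V
  refine ⟨fun B => PowerSeries.mk fun n =>
    (N : ℂ) ^ cumulantExponent B * (P n B).eval (N : ℂ)⁻¹, fun a b => ?_⟩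
  ext n
  rw [hP N hN, map_sum]
  simp

theorem exists_isInvariantExpansion (hD : 0 < D) (M : TensorModel D) {p : ℕ} (hp : 0 < p)
    (hN : p ≤ N) : ∃ w, M.IsInvariantExpansion N p w := by
  have : Nonempty (Fin p) := ⟨⟨0, hp⟩⟩
  have hN0 : 0 < N := hp.trans_le hN
  obtain ⟨w, hw⟩ := exists_cumulant_expansion (V := Fin p) hD M hN0
  refine ⟨w, fun B e f => ?_, hw⟩
  have hu : Function.Injective (Fin.castLE hN) := Fin.castLE_injective hN
  -- One coefficient is read off with the tags `u`, the other with `u ∘ e`; uniqueness makes the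
  -- choice of tags irrelevant.
  rw [eq_of_expansion (m := fun a b => entryCumulant M N a b Finset.univ) hu hw,
    eq_of_expansion (m := fun a b => entryCumulant M N a b Finset.univ) (hu.comp e.injective) hw]
  have h := entryCumulant_map M hN0 e.toEmbedding f.toEmbedding (whiteTag D (Fin.castLE hN))
    (blackTag (Fin.castLE hN) (relabel B e f)) (S := Finset.univ) Finset.univ_nonempty
  have h2 : (Finset.univ : Finset (Fin p ⊕ Fin p)).map (e.toEmbedding.sumMap f.toEmbedding)
      = Finset.univ := by
    exact Finset.map_univ_equiv (Equiv.sumCongr e f)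
  rw [h2] at h
  rw [h]
  congr 1
  funext v c
  simp [blackTag, relabel]

theorem W_eq_entryCumulant (hD : 0 < D) (M : TensorModel D) {p : ℕ} (hp : 0 < p) (hN : p ≤ N)
    {u : Fin p → Fin N} (hu : Function.Injective u) (B : ColoredGraph D (Fin p)) :
    M.W N B = entryCumulant M N (whiteTag D u) (blackTag u B) Finset.univ := by
  have h := exists_isInvariantExpansion hD M hp hN
  rw [TensorModel.W, dif_pos h]
  exact eq_of_expansion (m := fun a b => entryCumulant M N a b Finset.univ) hu h.choose_spec.2 B

theorem cumulant_eq_sum_W (hD : 0 < D) (M : TensorModel D) {p : ℕ} (hp : 0 < p) (hN : p ≤ N)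
    (a b : Fin p → Index D N) :
    entryCumulant M N a b Finset.univ
      = ∑ B : ColoredGraph D (Fin p), traceOperator B a b • M.W N B := by
  have h := exists_isInvariantExpansion hD M hp hN
  rw [← cumulant_eq_entryCumulant, h.choose_spec.2]
  simp only [TensorModel.W, dif_pos h]

/-- The coefficients of the rescaled cumulants are polynomials in `1/N`. -/
theorem exists_polynomial_K (hD : 0 < D) (M : TensorModel D) {p : ℕ} (hp : 0 < p) :
    ∃ P : ℕ → ColoredGraph D (Fin p) → Polynomial ℂ, ∀ N : ℕ, p ≤ N → ∀ B n,
      PowerSeries.coeff n (M.K N B) = (P n B).eval (N : ℂ)⁻¹ := by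
  classical
  have : Nonempty (Fin p) := ⟨⟨0, hp⟩⟩
  obtain ⟨P, hP⟩ := exists_polynomial_entryCumulant hD M (Fin p)
  refine ⟨P, fun N hN B n => ?_⟩
  have hN0 : 0 < N := hp.trans_le hN
  have hN' : (N : ℂ) ≠ 0 := Nat.cast_ne_zero.2 hN0.ne'
  have hu : Function.Injective (Fin.castLE hN) := Fin.castLE_injective hN
  rw [TensorModel.K, PowerSeries.coeff_smul, W_eq_entryCumulant hD M hp hN hu, hP N hN0]
  simp only [traceOperator_tag hu, ite_mul, one_mul, zero_mul, Finset.sum_ite_eq',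
    Finset.mem_univ, if_true]
  rw [smul_eq_mul, ← mul_assoc, cumulantExponent, Fintype.card_fin, inv_mul_cancel₀, one_mul]
  exact zpow_ne_zero _ hN'

end Cumulants

/-! ### Linearity and symmetries of the perturbative expectation. -/

section PolynomialExpectation

variable {D N : ℕ}

/-- The perturbative integral of a polynomial. -/
noncomputable def polyIntegral (M : TensorModel D) (N : ℕ) (F : Obs D N) : ℂ⟦X⟧ :=
  sumSeries fun k => ((k.factorial : ℂ)⁻¹) • gaussE D N (M.interactionPoly N ^ k * F)

/-- The perturbative expectation of a polynomial. -/
noncomputable def polyExpectation (M : TensorModel D) (N : ℕ) (F : Obs D N) : ℂ⟦X⟧ :=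
  polyIntegral M N F * (M.integral N fun _ => 1)⁻¹

theorem expectation_eq_polyExpectation (M : TensorModel D) (hN : 0 < N) {f : Tensor D N → ℂ}
    {F : Obs D N} (hF : ∀ T, tensorEval T F = PowerSeries.C (f T)) :
    M.expectation N f = polyExpectation M N F := by
  rw [TensorModel.expectation, polyExpectation, integral_eq_sumSeries M hN hF, polyIntegral]

theorem polyIntegral_add (M : TensorModel D) (F G : Obs D N) :
    polyIntegral M N (F + G) = polyIntegral M N F + polyIntegral M N G := by
  ext n
  simp only [polyIntegral, sumSeries, map_add, PowerSeries.coeff_mk, mul_add, smul_add,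
    Finset.sum_add_distrib]

theorem polyIntegral_smul (M : TensorModel D) (r : ℂ⟦X⟧) (F : Obs D N) :
    polyIntegral M N (r • F) = r * polyIntegral M N F := by
  -- The scalar `r` is a series concentrated at `k = 0`, which makes linearity a case of the Cauchy
  -- product.
  have h : sumSeries (fun k => if k = 0 then r else 0) = r := by
    ext n
    rw [sumSeries, PowerSeries.coeff_mk, Finset.sum_range_succ']
    simp
  conv_rhs => rw [← h]
  rw [polyIntegral, polyIntegral, sumSeries_mul]
  · congr 1
    funext k
    rw [Finset.sum_eq_single (0, k)]
    · simp
    · rintro ⟨i, j⟩ hij hne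
      rw [Finset.HasAntidiagonal.mem_antidiagonal] at hij
      rw [if_neg, zero_mul]
      rintro rfl
      exact hne (by simpa using hij)
    · intro h
      exact absurd (Finset.HasAntidiagonal.mem_antidiagonal.2 (zero_add k)) h
  · intro k
    split_ifs with h
    · simp [h]
    · exact dvd_zero _
  · exact fun k => X_pow_dvd_smul _ (X_pow_dvd_gaussE M k _)

/-- The perturbative expectation as a linear map. -/
noncomputable def polyExpectationHom (M : TensorModel D) (N : ℕ) : Obs D N →ₗ[ℂ⟦X⟧] ℂ⟦X⟧ where
  toFun := polyExpectation M N
  map_add' F G := by rw [polyExpectation, polyIntegral_add, add_mul]; rfl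
  map_smul' r F := by
    rw [polyExpectation, polyIntegral_smul, mul_assoc]; rfl

theorem polyExpectationHom_one (M : TensorModel D) (hN : 0 < N) :
    polyExpectationHom M N 1 = 1 := by
  change polyExpectation M N 1 = 1
  rw [← expectation_eq_polyExpectation M hN (f := fun _ => 1) (by simp),
    TensorModel.expectation, integral_one_mul_inv M hN]

theorem expectation_traceInvariant {V : Type} [Fintype V] [DecidableEq V] (M : TensorModel D)
    (hN : 0 < N) (B : ColoredGraph D V) :
    M.expectation N (traceInvariant B) = polyExpectationHom M N (tracePoly N B) :=
  expectation_eq_polyExpectation M hN (tensorEval_tracePoly B)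

theorem entryMoment_eq {V : Type} [Fintype V] [DecidableEq V] (M : TensorModel D) (hN : 0 < N)
    (a b : V → Index D N) (S : Finset (V ⊕ V)) :
    entryMoment M N a b S = polyExpectationHom M N (∏ x ∈ S, entries a b x) :=
  expectation_eq_polyExpectation M hN (tensorEval_prod_entries a b S)

theorem prod_entries_univ {V : Type} [Fintype V] [DecidableEq V] (a b : V → Index D N) :
    ∏ x, entries a b x = legMonomial a b := by
  rw [Fintype.prod_sum_type]; rfl

/-- Common source of the symmetry arguments, applied to the rescaling of `T` against `T̄` and to
permutations of the colors. -/
theorem polyExpectationHom_map (M M' : TensorModel D) (φ : Obs D N →ₐ[ℂ⟦X⟧] Obs D N)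
    (hφ : ∀ P, gaussE D N (φ P) = gaussE D N P)
    (hI : φ (M.interactionPoly N) = M'.interactionPoly N) (hN : 0 < N) (F : Obs D N) :
    polyExpectationHom M' N (φ F) = polyExpectationHom M N F := by
  have h : ∀ F, polyIntegral M' N (φ F) = polyIntegral M N F := fun F => by
    rw [polyIntegral, polyIntegral]
    congr 1
    funext k
    rw [← hI, ← map_pow, ← map_mul, hφ]
  have h1 : ∀ M : TensorModel D, (M.integral N fun _ => 1) = polyIntegral M N 1 := fun M =>
    integral_eq_sumSeries M hN (by simp)
  change polyExpectation M' N (φ F) = polyExpectation M N F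
  rw [polyExpectation, polyExpectation, h, h1, h1]
  conv_lhs => rw [← map_one φ, h]

/-- Rescaling of `T` by `2` and of `T̄` by `1/2`. -/
noncomputable def rescale (D N : ℕ) : Obs D N →ₐ[ℂ⟦X⟧] Obs D N :=
  MvPolynomial.aeval (Sum.elim
    (fun i => (PowerSeries.C (2 : ℂ) : ℂ⟦X⟧) • MvPolynomial.X (Sum.inl i))
    fun i => (PowerSeries.C (2⁻¹ : ℂ) : ℂ⟦X⟧) • MvPolynomial.X (Sum.inr i))

theorem rescale_inl (i : Index D N) : rescale D N (MvPolynomial.X (Sum.inl i))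
    = (PowerSeries.C (2 : ℂ) : ℂ⟦X⟧) • MvPolynomial.X (Sum.inl i) := by
  simp [rescale]

theorem rescale_inr (i : Index D N) : rescale D N (MvPolynomial.X (Sum.inr i))
    = (PowerSeries.C (2⁻¹ : ℂ) : ℂ⟦X⟧) • MvPolynomial.X (Sum.inr i) := by
  simp [rescale]

theorem gaussE_rescale (P : Obs D N) : gaussE D N (rescale D N P) = gaussE D N P := by
  induction P using MvPolynomial.induction_on' with
  | add p q hp hq => rw [map_add, map_add, map_add, hp, hq]
  | monomial s r =>
    have h1 : ∀ x : Index D N ⊕ Index D N, (Sum.elim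
        (fun i => (PowerSeries.C (2 : ℂ) : ℂ⟦X⟧) • MvPolynomial.X (Sum.inl i))
        (fun i => (PowerSeries.C (2⁻¹ : ℂ) : ℂ⟦X⟧) • MvPolynomial.X (Sum.inr i)) x : Obs D N)
        = (PowerSeries.C (Sum.elim (fun _ => 2) (fun _ => 2⁻¹) x : ℂ) : ℂ⟦X⟧)
          • MvPolynomial.X x := by
      rintro (x | x) <;> rfl
    have h2 : rescale D N (MvPolynomial.monomial s r)
        = (PowerSeries.C (∏ x, (Sum.elim (fun _ => 2) (fun _ => 2⁻¹) x : ℂ) ^ s x) : ℂ⟦X⟧)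
          • MvPolynomial.monomial s r := by
      rw [rescale, MvPolynomial.aeval_monomial, Finsupp.prod_fintype _ _ (by simp)]
      simp only [h1, smul_pow]
      rw [Finset.prod_smul, mul_smul_comm, MvPolynomial.algebraMap_eq, MvPolynomial.monomial_eq,
        Finsupp.prod_fintype _ _ (by simp), map_prod]
      simp only [map_pow]
    rw [h2, map_smul, gaussianFunctional_monomial, smul_eq_mul]
    by_cases h : ∀ i : Index D N, s (Sum.inl i) = s (Sum.inr i)
    · have : (∏ x, (Sum.elim (fun _ => 2) (fun _ => 2⁻¹) x : ℂ) ^ s x) = 1 := by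
        rw [Fintype.prod_sum_type]
        simp only [Sum.elim_inl, Sum.elim_inr, h]
        rw [← Finset.prod_mul_distrib]
        refine Finset.prod_eq_one fun i _ => ?_
        rw [← mul_pow]; norm_num
      rw [this, map_one, one_mul]
    · push Not at h
      obtain ⟨i, hi⟩ := h
      have : gaussianMoment ((N : ℂ) ^ (D - 1)) s = 0 :=
        Finset.prod_eq_zero (Finset.mem_univ i) (if_neg hi)
      rw [this, map_zero, mul_zero, mul_zero]

theorem rescale_legMonomial {W : Type*} [Fintype W] (a b : W → Index D N) :
    rescale D N (legMonomial a b) = legMonomial a b := by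
  rw [legMonomial, map_mul, map_prod, map_prod]
  simp only [rescale_inl, rescale_inr]
  rw [Finset.prod_smul, Finset.prod_smul, smul_mul_smul_comm, Finset.prod_const, Finset.prod_const,
    ← mul_pow, ← map_mul]
  norm_num

theorem rescale_interactionPoly (M : TensorModel D) :
    rescale D N (M.interactionPoly N) = M.interactionPoly N := by
  simp only [TensorModel.interactionPoly, tracePoly, map_sum, map_smul, rescale_legMonomial]

/-- Charge conservation: the rescaling by `2` and `1/2` leaves the model invariant, yet multiplies
an unbalanced cumulant by a power of `2` different from `1`. -/
theorem entryCumulant_eq_zero {V : Type} [Fintype V] [DecidableEq V] (M : TensorModel D)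
    (hN : 0 < N) (a b : V → Index D N) {S : Finset (V ⊕ V)} (hS : S.toLeft.card ≠ S.toRight.card) :
    entryCumulant M N a b S = 0 := by
  let w : V ⊕ V → ℂ⟦X⟧ := Sum.elim (fun _ => PowerSeries.C (2 : ℂ)) fun _ => PowerSeries.C (2⁻¹ : ℂ)
  have h1 : entryMoment M N a b = fun S => (∏ x ∈ S, w x) * entryMoment M N a b S := by
    funext S
    rw [entryMoment_eq M hN, ← smul_eq_mul, ← map_smul, ← Finset.prod_smul,
      ← polyExpectationHom_map M M (rescale D N) gaussE_rescale (rescale_interactionPoly M) hN,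
      map_prod]
    congr 1
    refine Finset.prod_congr rfl fun x _ => ?_
    rcases x with x | x
    · exact rescale_inl _
    · exact rescale_inr _
  have h2 : entryCumulant M N a b S = (∏ x ∈ S, w x) * entryCumulant M N a b S := by
    conv_lhs => rw [entryCumulant, h1, jointCumulant_weight]
    rfl
  have h3 : ∏ x ∈ S, w x = PowerSeries.C ((2 : ℂ) ^ S.toLeft.card * (2⁻¹) ^ S.toRight.card) := by
    conv_lhs => rw [← Finset.toLeft_disjSum_toRight (u := S), Finset.prod_disjSum]
    simp only [w, Sum.elim_inl, Sum.elim_inr, Finset.prod_const, map_mul, map_pow]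
  rw [h3] at h2
  ext n
  have h4 := congrArg (PowerSeries.coeff n) h2
  rw [PowerSeries.coeff_C_mul] at h4
  have h5 : (2 : ℂ) ^ S.toLeft.card * (2⁻¹) ^ S.toRight.card ≠ 1 := by
    intro h
    rw [inv_pow, mul_inv_eq_one₀ (pow_ne_zero _ two_ne_zero)] at h
    have : (2 : ℕ) ^ S.toLeft.card = 2 ^ S.toRight.card := by exact_mod_cast h
    exact hS (Nat.pow_right_injective le_rfl this)
  rw [map_zero]
  by_contra hne
  exact h5 (mul_right_cancel₀ hne (by rw [one_mul]; exact h4.symm))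

end PolynomialExpectation

/-! ### Faces and the expectation of a trace invariant. -/

section Faces

variable {D N : ℕ} {V : Type} [Fintype V] [DecidableEq V]

theorem card_invariant_functions (f : Equiv.Perm V) :
    Nat.card {a : V → Fin N // ∀ v, a (f v) = a v} = N ^ numCycles f := by
  have e : {a : V → Fin N // ∀ v, a (f v) = a v}
      ≃ (Quotient (Equiv.Perm.SameCycle.setoid f) → Fin N) :=
    { toFun := fun a => Quotient.lift a.1 fun _ _ h => eq_of_sameCycle a.2 h
      invFun := fun F => ⟨fun v => F (cyc f v), fun v => congrArg F (cyc_apply f v)⟩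
      left_inv := fun a => rfl
      right_inv := fun F => funext fun C => by
        obtain ⟨v, rfl⟩ := Quotient.mk_surjective C
        rfl }
  rw [Nat.card_congr e, Nat.card_fun, Nat.card_fin, numCycles]

/-- Through `B` the white indices determine the black ones. What remains in color `c` is a function
constant on the cycles of `(B c)⁻¹ * g c`, that is, one free index per face. -/
theorem sum_traceOperator_mul (B g : ColoredGraph D V) :
    ∑ a : V → Index D N, ∑ b : V → Index D N, traceOperator B a b * traceOperator g a b
      = (N : ℂ) ^ numFaces B g := by
  classical
  have h1 : ∀ a : V → Index D N,
      ∑ b : V → Index D N, traceOperator B a b * traceOperator g a b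
        = ∏ c, if ∀ v, a (((B c)⁻¹ * g c) v) c = a v c then 1 else 0 := by
    intro a
    rw [Finset.sum_eq_single (fun w c => a ((B c).symm w) c)]
    · rw [traceOperator_eq_ite, traceOperator_eq_ite, if_pos (by simp), one_mul, prod_ite_one_zero]
      refine ite_one_zero_congr (forall_congr' fun c => forall_congr' fun v => ?_)
      exact eq_comm
    · intro b _ hb
      rw [traceOperator_eq_ite, if_neg, zero_mul]
      intro h
      refine hb (funext fun w => funext fun c => ?_)
      rw [h c ((B c).symm w), Equiv.apply_symm_apply]
    · simp
  simp only [h1]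
  rw [← Equiv.sum_comp (Equiv.piComm fun (_ : Fin D) (_ : V) => Fin N)]
  simp only [Equiv.piComm_apply, Function.swap]
  have h2 := Finset.prod_univ_sum (fun _ : Fin D => (Finset.univ : Finset (V → Fin N)))
    fun c a => if ∀ v, a (((B c)⁻¹ * g c) v) = a v then (1 : ℂ) else 0
  rw [Fintype.piFinset_univ] at h2
  rw [← h2, numFaces, ← Finset.prod_pow_eq_pow_sum]
  refine Finset.prod_congr rfl fun c _ => ?_
  rw [Finset.sum_boole, ← Nat.cast_pow, ← card_invariant_functions, Nat.card_eq_fintype_card,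
    Fintype.card_subtype]

/-- The coefficients of the moment are evaluated at tagged indices, a form in which they can be
split into cumulants. -/
theorem expectation_traceInvariant_eq_sum (hD : 0 < D) (M : TensorModel D) {u : V → Fin N}
    (hu : Function.Injective u) (hN : 0 < N) (B : ColoredGraph D V) :
    M.expectation N (traceInvariant B)
      = ∑ g : ColoredGraph D V, ((N : ℂ) ^ numFaces B g) •
        entryMoment M N (whiteTag D u) (blackTag u g) Finset.univ := by
  obtain ⟨Ω, hΩ⟩ := exists_entryMoment_expansion (V := V) hD M hN
  rw [expectation_traceInvariant M hN, tracePoly, map_sum, Fintype.sum_prod_type]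
  have h1 : ∀ a b : V → Index D N, polyExpectationHom M N
      ((PowerSeries.C (traceOperator B a b) : ℂ⟦X⟧) • legMonomial a b)
      = ∑ g : ColoredGraph D V, (traceOperator B a b * traceOperator g a b) • Ω g := by
    intro a b
    rw [map_smul, ← prod_entries_univ, ← entryMoment_eq M hN, hΩ, smul_eq_mul,
      ← PowerSeries.smul_eq_C_mul, Finset.smul_sum]
    simp only [smul_smul]
  simp only [h1]
  have h2 : ∀ a : V → Index D N, ∑ b : V → Index D N, ∑ g : ColoredGraph D V,
      (traceOperator B a b * traceOperator g a b) • Ω g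
      = ∑ g : ColoredGraph D V,
        (∑ b : V → Index D N, traceOperator B a b * traceOperator g a b) • Ω g := fun a => by
    rw [Finset.sum_comm]
    simp only [Finset.sum_smul]
  simp only [h2]
  rw [Finset.sum_comm]
  refine Finset.sum_congr rfl fun g _ => ?_
  rw [← Finset.sum_smul, sum_traceOperator_mul,
    eq_of_expansion (m := fun a b => entryMoment M N a b Finset.univ) hu hΩ]

end Faces

/-! ### Orders of magnitude -/

section BigO

open Asymptotics Filter

theorem IsPerturbativeBigO.congr {F G : ℕ → ℂ⟦X⟧} {k : ℕ} (h : IsPerturbativeBigO F k)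
    (hFG : ∀ᶠ N in atTop, F N = G N) : IsPerturbativeBigO G k := fun n =>
  (h n).congr' (hFG.mono fun N hN => by simp only [hN]) EventuallyEq.rfl

theorem IsPerturbativeBigO.add {F G : ℕ → ℂ⟦X⟧} {k : ℕ} (hF : IsPerturbativeBigO F k)
    (hG : IsPerturbativeBigO G k) : IsPerturbativeBigO (fun N => F N + G N) k := fun n => by
  simp only [map_add]
  exact (hF n).add (hG n)

theorem IsPerturbativeBigO.sub {F G : ℕ → ℂ⟦X⟧} {k : ℕ} (hF : IsPerturbativeBigO F k)
    (hG : IsPerturbativeBigO G k) : IsPerturbativeBigO (fun N => F N - G N) k := fun n => by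
  simp only [map_sub]
  exact (hF n).sub (hG n)

theorem isPerturbativeBigO_zero (k : ℕ) : IsPerturbativeBigO (fun _ => 0) k := fun n => by
  simp only [map_zero]
  exact isBigO_zero _ _

theorem IsPerturbativeBigO.sum {ι : Type*} {s : Finset ι} {F : ι → ℕ → ℂ⟦X⟧} {k : ℕ}
    (h : ∀ i ∈ s, IsPerturbativeBigO (F i) k) :
    IsPerturbativeBigO (fun N => ∑ i ∈ s, F i N) k := fun n => by
  simp only [map_sum]
  exact IsBigO.fun_sum fun i hi => h i hi n

theorem IsPerturbativeBigO.mul {F G : ℕ → ℂ⟦X⟧} {k l : ℕ} (hF : IsPerturbativeBigO F k)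
    (hG : IsPerturbativeBigO G l) : IsPerturbativeBigO (fun N => F N * G N) (k + l) := fun n => by
  simp only [PowerSeries.coeff_mul]
  refine IsBigO.fun_sum fun q _ => ?_
  refine ((hF q.1).mul (hG q.2)).congr_right fun N => ?_
  rw [pow_add, mul_inv]

theorem isPerturbativeBigO_const (F : ℂ⟦X⟧) : IsPerturbativeBigO (fun _ => F) 0 := fun n => by
  simpa using isBigO_const_const (PowerSeries.coeff n F) (one_ne_zero (α := ℝ)) atTop

theorem IsPerturbativeBigO.prod {ι : Type*} {s : Finset ι} {F : ι → ℕ → ℂ⟦X⟧}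
    (h : ∀ i ∈ s, IsPerturbativeBigO (F i) 0) :
    IsPerturbativeBigO (fun N => ∏ i ∈ s, F i N) 0 := by
  classical
  induction s using Finset.induction_on with
  | empty => simpa using isPerturbativeBigO_const 1
  | insert i s hi ih =>
    simp only [Finset.prod_insert hi]
    exact (h i (Finset.mem_insert_self _ _)).mul fun n =>
      ih (fun j hj => h j (Finset.mem_insert_of_mem hj)) n

theorem IsPerturbativeBigO.pow {F : ℕ → ℂ⟦X⟧} (h : IsPerturbativeBigO F 0) (m : ℕ) :
    IsPerturbativeBigO (fun N => F N ^ m) 0 := by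
  simpa using IsPerturbativeBigO.prod (s := Finset.range m) (F := fun _ => F) fun _ _ => h

theorem IsPerturbativeBigO.zpow_smul {F : ℕ → ℂ⟦X⟧} {k l : ℕ} {e : ℤ} (he : e ≤ l - k)
    (h : IsPerturbativeBigO F l) :
    IsPerturbativeBigO (fun N => ((N : ℂ) ^ e) • F N) k := fun n => by
  simp only [PowerSeries.coeff_smul, smul_eq_mul]
  have h1 : (fun N : ℕ => (N : ℂ) ^ e) =O[atTop] fun N : ℕ => (N : ℝ) ^ ((l : ℤ) - k) := by
    refine IsBigO.of_bound 1 ?_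
    filter_upwards [eventually_ge_atTop 1] with N hN
    have hN' : (1 : ℝ) ≤ N := by exact_mod_cast hN
    rw [norm_zpow, Complex.norm_natCast, norm_zpow, Real.norm_natCast, one_mul]
    exact zpow_le_zpow_right₀ hN' he
  refine (h1.mul (h n)).trans (IsBigO.of_bound 1 ?_)
  filter_upwards [eventually_ge_atTop 1] with N hN
  have hN' : (N : ℝ) ≠ 0 := by positivity
  rw [one_mul, ← zpow_natCast, ← zpow_natCast, ← zpow_neg, ← zpow_neg, ← zpow_add₀ hN']
  ring_nf
  exact le_rfl

theorem IsPerturbativeBigO.const_smul {F : ℕ → ℂ⟦X⟧} {k : ℕ} (h : IsPerturbativeBigO F k) (c : ℂ) :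
    IsPerturbativeBigO (fun N => c • F N) k := fun n => by
  simp only [PowerSeries.coeff_smul, smul_eq_mul]
  exact (h n).const_mul_left c

theorem IsPerturbativeBigO.mono {F : ℕ → ℂ⟦X⟧} {k l : ℕ} (h : IsPerturbativeBigO F l)
    (hkl : k ≤ l) : IsPerturbativeBigO F k := by
  have := h.zpow_smul (k := k) (e := 0) (by omega)
  simpa using this

theorem isBigO_polynomial_inv (P : Polynomial ℂ) :
    (fun N : ℕ => P.eval (N : ℂ)⁻¹) =O[atTop] fun _ : ℕ => (1 : ℝ) := by
  have h1 : Tendsto (fun N : ℕ => ((N : ℂ))⁻¹) atTop (nhds 0) :=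
    tendsto_inv_atTop_nhds_zero_nat
  exact ((P.continuous.tendsto 0).comp h1).isBigO_one ℝ

theorem isPerturbativeBigO_K {D : ℕ} (hD : 0 < D) (M : TensorModel D) {p : ℕ} (hp : 0 < p)
    (B : ColoredGraph D (Fin p)) : IsPerturbativeBigO (fun N => M.K N B) 0 := fun n => by
  obtain ⟨P, hP⟩ := exists_polynomial_K hD M hp
  have := isBigO_polynomial_inv (P n B)
  simp only [pow_zero, inv_one]
  refine this.congr' ?_ EventuallyEq.rfl
  filter_upwards [eventually_ge_atTop p] with N hN
  rw [hP N hN]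

end BigO

/-! ### The contributions of the doubled graphs -/

section Blocks

variable {D N : ℕ} {V : Type} [Fintype V] [DecidableEq V]

/-- Distinct labels for the vertices. -/
noncomputable def tag (h : Fintype.card V ≤ N) : V → Fin N :=
  fun v => Fin.castLE h (Fintype.equivFin V v)

theorem tag_injective (h : Fintype.card V ≤ N) : Function.Injective (tag (V := V) h) :=
  (Fin.castLE_injective h).comp (Fintype.equivFin V).injective

/-- The cumulant of the vertices in `s`, when the vertices are joined according to `g`. -/
noncomputable def tagCumulant (M : TensorModel D) (N : ℕ) (g : ColoredGraph D V)
    (s : Finset (V ⊕ V)) : ℂ⟦X⟧ :=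
  if h : Fintype.card V ≤ N then entryCumulant M N (whiteTag D (tag h)) (blackTag (tag h) g) s
  else 0

theorem tagCumulant_eq_W (hD : 0 < D) (M : TensorModel D) (hN : Fintype.card V ≤ N)
    {g : ColoredGraph D V} {q : ℕ} (hq : 0 < q) {e f : Fin q ↪ V} {b : ColoredGraph D (Fin q)}
    (h : ∀ c x, f (b c x) = g c (e x)) :
    tagCumulant M N g (Finset.univ.map (e.sumMap f)) = M.W N b := by
  have : Nonempty (Fin q) := ⟨⟨0, hq⟩⟩
  have hqN : q ≤ N := by
    have := Fintype.card_le_of_embedding e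
    rw [Fintype.card_fin] at this
    omega
  have hu := tag_injective (V := V) hN
  rw [tagCumulant, dif_pos hN, entryCumulant_map M (hq.trans_le hqN) e f _ _ Finset.univ_nonempty,
    W_eq_entryCumulant hD M hq hqN (hu.comp e.injective)]
  congr 1
  funext v c
  change tag hN ((g c).symm (f v)) = tag hN (e ((b c).symm v))
  congr 1
  rw [Equiv.symm_apply_eq, ← h, Equiv.apply_symm_apply]

theorem eq_map_sumMap {s : Finset (V ⊕ V)} {q : ℕ} (h1 : s.toLeft.card = q)
    (h2 : s.toRight.card = q) :
    ∃ e f : Fin q ↪ V, s = Finset.univ.map (e.sumMap f) ∧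
      Set.range e = s.toLeft ∧ Set.range f = s.toRight := by
  have e1 : Fin q ≃ s.toLeft := (s.toLeft.equivFinOfCardEq h1).symm
  have e2 : Fin q ≃ s.toRight := (s.toRight.equivFinOfCardEq h2).symm
  refine ⟨e1.toEmbedding.trans (Function.Embedding.subtype _),
    e2.toEmbedding.trans (Function.Embedding.subtype _), ?_, ?_, ?_⟩
  · ext x
    rw [Finset.mem_map]
    constructor
    · intro hx
      rcases x with v | v
      · exact ⟨Sum.inl (e1.symm ⟨v, Finset.mem_toLeft.2 hx⟩), Finset.mem_univ _, by simp⟩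
      · exact ⟨Sum.inr (e2.symm ⟨v, Finset.mem_toRight.2 hx⟩), Finset.mem_univ _, by simp⟩
    · rintro ⟨y | y, -, rfl⟩
      · exact Finset.mem_toLeft.1 (e1 y).2
      · exact Finset.mem_toRight.1 (e2 y).2
  · ext v
    exact ⟨by rintro ⟨x, rfl⟩; exact (e1 x).2, fun h => ⟨e1.symm ⟨v, h⟩, by simp⟩⟩
  · ext v
    exact ⟨by rintro ⟨x, rfl⟩; exact (e2 x).2, fun h => ⟨e2.symm ⟨v, h⟩, by simp⟩⟩

theorem ncard_image_comp_le {g : ColoredGraph D V} {q : ℕ} {e f : Fin q ↪ V}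
    {b : ColoredGraph D (Fin q)} (h : ∀ c x, f (b c x) = g c (e x)) :
    (comp g '' (Finset.univ.map (e.sumMap f) : Finset (V ⊕ V))).ncard ≤ numComponents b := by
  obtain ⟨F, hF⟩ := exists_comp_lift (B := b) (F := fun u => comp g (e.sumMap f u)) (by
    intro c v
    change comp g (Sum.inl (e v)) = comp g (Sum.inr (f (b c v)))
    rw [h]
    exact comp_edge g c (e v))
  rw [← Nat.card_coe_set_eq]
  refine Nat.card_le_card_of_surjective
    (fun C => (⟨F C, ?_⟩ : ↥(comp g '' (Finset.univ.map (e.sumMap f) : Finset (V ⊕ V))))) ?_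
  · obtain ⟨u, rfl⟩ := C.exists_rep
    exact ⟨e.sumMap f u, by simp, (hF u).symm⟩
  · rintro ⟨C, u, hu, rfl⟩
    obtain ⟨w, -, rfl⟩ := Finset.mem_map.1 (Finset.mem_coe.1 hu)
    exact ⟨comp b w, Subtype.ext (hF w)⟩

/-- A block survives only if it is balanced and closed under the edges of `g`: otherwise charge
conservation kills it, or no labelled graph matches the tags. A surviving block is a coefficient
`W`. An inequality between component counts suffices, the discrepancy being a nonpositive power of
`N` left in `X`. -/
theorem tagCumulant_dichotomy (hD : 0 < D) (M : TensorModel D) (g : ColoredGraph D V)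
    {s : Finset (V ⊕ V)} (hs : s.Nonempty) :
    (∀ N, Fintype.card V ≤ N → tagCumulant M N g s = 0) ∨
      (∀ c v, Sum.inl v ∈ s → Sum.inr (g c v) ∈ s) ∧
      ∃ X : ℕ → ℂ⟦X⟧, IsPerturbativeBigO X 0 ∧ ∀ N, Fintype.card V ≤ N → tagCumulant M N g s
        = ((N : ℂ) ^ ((D : ℤ) - ((D : ℤ) - 1) * s.card - (comp g '' s).ncard)) • X N := by
  have hV : 0 < Fintype.card V := by
    obtain ⟨x | x, -⟩ := hs <;> exact Fintype.card_pos_iff.2 ⟨x⟩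
  by_cases hbal : s.toLeft.card = s.toRight.card
  swap
  · left
    intro N hN
    rw [tagCumulant, dif_pos hN, entryCumulant_eq_zero M (hV.trans_le hN) _ _ hbal]
  obtain ⟨q, hq⟩ : ∃ q, s.toLeft.card = q := ⟨_, rfl⟩
  obtain ⟨e, f, hsef, he, hf⟩ := eq_map_sumMap hq (hbal ▸ hq)
  have hcard : s.card = q + q := by
    rw [← Finset.card_toLeft_add_card_toRight (u := s), ← hbal, hq]
  have hq0 : 0 < q := by
    have := hs.card_pos
    omega
  by_cases hb : ∃ b : ColoredGraph D (Fin q), ∀ c x, f (b c x) = g c (e x)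
  · obtain ⟨b, hb⟩ := hb
    right
    refine ⟨fun c v hv => ?_, ?_⟩
    · have hv' : v ∈ Set.range e := by rw [he]; exact Finset.mem_toLeft.2 hv
      obtain ⟨x, rfl⟩ := hv'
      have : g c (e x) ∈ Set.range f := ⟨_, hb c x⟩
      rw [hf] at this
      exact Finset.mem_toRight.1 this
    · have hle := ncard_image_comp_le hb
      rw [← hsef] at hle
      refine ⟨fun N => ((N : ℂ) ^ (((comp g '' s).ncard : ℤ) - numComponents b)) • M.K N b,
        (isPerturbativeBigO_K hD M hq0 b).zpow_smul (by omega), fun N hN => ?_⟩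
      have hN' : (N : ℂ) ≠ 0 := Nat.cast_ne_zero.2 (hV.trans_le hN).ne'
      rw [smul_smul, TensorModel.K, smul_smul, ← zpow_add₀ hN', ← zpow_neg, ← zpow_add₀ hN']
      conv_lhs => rw [hsef, tagCumulant_eq_W hD M hN hq0 hb, ← one_smul ℂ (M.W N b)]
      congr 1
      rw [hcard]
      push_cast
      ring_nf
      rw [zpow_zero]
  · left
    intro N hN
    have : Nonempty (Fin q) := ⟨⟨0, hq0⟩⟩
    have hqN : q ≤ N := by
      have := Fintype.card_le_of_embedding e
      rw [Fintype.card_fin] at this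
      omega
    rw [tagCumulant, dif_pos hN, hsef, entryCumulant_map M (hV.trans_le hN) e f _ _
      Finset.univ_nonempty, cumulant_eq_sum_W hD M hq0 hqN]
    classical
    refine Finset.sum_eq_zero fun b _ => ?_
    rw [traceOperator_eq_ite, if_neg, zero_smul]
    intro h
    refine hb ⟨b, fun c x => ?_⟩
    have := tag_injective hN (h c x)
    rw [Equiv.eq_symm_apply] at this
    exact this.symm

end Blocks

/-! ### The expectation as a sum over doubled graphs. -/

section Doubled

variable {D N : ℕ} {V : Type} [Fintype V] [DecidableEq V]

instance : Finite (DoubledGraph D V) := by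
  refine Finite.of_injective
    (fun G : DoubledGraph D V => (G.graph, fun x y => G.part.r x y)) fun G G' h => ?_
  obtain ⟨g, r, hr⟩ := G
  obtain ⟨g', r', hr'⟩ := G'
  simp only [Prod.mk.injEq] at h
  obtain ⟨rfl, h2⟩ := h
  obtain rfl : r = r' := Setoid.ext fun x y => iff_of_eq (congrFun (congrFun h2 x) y)
  rfl

noncomputable instance : Fintype (DoubledGraph D V) := Fintype.ofFinite _

open Classical in
/-- The parts of a doubled graph. -/
noncomputable def DoubledGraph.partition (G : DoubledGraph D V) :
    Finpartition (Finset.univ : Finset (V ⊕ V)) := Finpartition.ofSetoid G.part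

theorem DoubledGraph.mem_partition_part (G : DoubledGraph D V) {x y : V ⊕ V} :
    y ∈ G.partition.part x ↔ G.part x y := by
  classical
  exact Finpartition.mem_part_ofSetoid_iff_rel

theorem DoubledGraph.partition_parts (G : DoubledGraph D V) :
    G.partition.parts = Finset.univ.image G.partition.part := by
  ext s
  rw [Finset.mem_image]
  constructor
  · intro hs
    obtain ⟨x, hx⟩ := G.partition.nonempty_of_mem_parts hs
    exact ⟨x, Finset.mem_univ _, (G.partition.part_eq_of_mem hs hx)⟩
  · rintro ⟨x, -, rfl⟩
    exact G.partition.part_mem.2 (Finset.mem_univ x)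

theorem DoubledGraph.part_eq_iff (G : DoubledGraph D V) {x y : V ⊕ V} :
    G.partition.part x = G.partition.part y ↔ G.part x y := by
  constructor
  · intro h
    rw [← G.mem_partition_part, h, G.mem_partition_part]
  · intro h
    ext z
    rw [G.mem_partition_part, G.mem_partition_part]
    exact ⟨fun hz => G.part.trans (G.part.symm h) hz, fun hz => G.part.trans h hz⟩

theorem DoubledGraph.card_partition_parts (G : DoubledGraph D V) :
    G.partition.parts.card = Nat.card (Quotient G.part) := by
  let F : Quotient G.part → G.partition.parts := Quotient.lift
    (fun x => ⟨G.partition.part x, G.partition.part_mem.2 (Finset.mem_univ x)⟩)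
    fun x y h => Subtype.ext (G.part_eq_iff.2 h)
  have hF : Function.Bijective F := by
    constructor
    · intro a b h
      obtain ⟨x, rfl⟩ := Quotient.mk_surjective a
      obtain ⟨y, rfl⟩ := Quotient.mk_surjective b
      exact Quotient.sound (G.part_eq_iff.1 (congrArg Subtype.val h))
    · rintro ⟨s, hs⟩
      rw [G.partition_parts, Finset.mem_image] at hs
      obtain ⟨x, -, rfl⟩ := hs
      exact ⟨Quotient.mk _ x, rfl⟩
  rw [Nat.card_congr (Equiv.ofBijective F hF), Nat.card_eq_fintype_card, Fintype.card_coe]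

/-- The contribution of a doubled graph to `(1/N) ⟨Tr_B⟩`. -/
noncomputable def DoubledGraph.contribution (M : TensorModel D) (B : ColoredGraph D V) (N : ℕ)
    (G : DoubledGraph D V) : ℂ⟦X⟧ :=
  ((N : ℂ) ^ (-1 + (numFaces B G.graph : ℤ)))
    • ∏ s ∈ G.partition.parts, tagCumulant M N G.graph s

theorem exists_doubledGraph (g : ColoredGraph D V)
    (π : Finpartition (Finset.univ : Finset (V ⊕ V)))
    (h : ∀ s ∈ π.parts, ∀ c v, Sum.inl v ∈ s → Sum.inr (g c v) ∈ s) :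
    ∃ G : DoubledGraph D V, G.graph = g ∧ G.partition = π := by
  have hpart : ∀ {x y}, y ∈ π.part x ↔ π.part x = π.part y := by
    intro x y
    constructor
    · intro h
      exact (π.part_eq_of_mem (π.part_mem.2 (Finset.mem_univ x)) h).symm
    · intro h
      rw [h]
      exact π.mem_part_self.2 (Finset.mem_univ y)
  let G : DoubledGraph D V :=
    { graph := g
      part := Setoid.ker π.part
      compatible := fun c v => hpart.1 (h _ (π.part_mem.2 (Finset.mem_univ _)) c v
        (π.mem_part_self.2 (Finset.mem_univ _))) }
  refine ⟨G, rfl, ?_⟩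
  have h1 : ∀ x, G.partition.part x = π.part x := fun x => by
    ext y
    rw [G.mem_partition_part, hpart]
    rfl
  refine Finpartition.ext ?_
  rw [G.partition_parts]
  ext s
  rw [Finset.mem_image]
  constructor
  · rintro ⟨x, -, rfl⟩
    rw [h1]
    exact π.part_mem.2 (Finset.mem_univ x)
  · intro hs
    obtain ⟨x, hx⟩ := π.nonempty_of_mem_parts hs
    exact ⟨x, Finset.mem_univ _, (h1 x).trans (π.part_eq_of_mem hs hx)⟩

theorem DoubledGraph.ext_part {G G' : DoubledGraph D V} (h1 : G.graph = G'.graph)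
    (h2 : G.part = G'.part) : G = G' := by
  obtain ⟨g, r, hr⟩ := G
  obtain ⟨g', r', hr'⟩ := G'
  obtain rfl : g = g' := h1
  obtain rfl : r = r' := h2
  rfl

theorem DoubledGraph.ext_partition {G G' : DoubledGraph D V} (h1 : G.graph = G'.graph)
    (h2 : G.partition = G'.partition) : G = G' :=
  DoubledGraph.ext_part h1 (Setoid.ext fun x y => by
    rw [← G.mem_partition_part, ← G'.mem_partition_part, h2])

/-- Each moment splits into products of cumulants over partitions. A graph and a partition form a
doubled graph when no edge leaves a block, and all other terms vanish by `tagCumulant_dichotomy`. -/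
theorem expectation_eq_sum_contribution (hD : 0 < D) (M : TensorModel D) (hN0 : 0 < N)
    (hN : Fintype.card V ≤ N) (B : ColoredGraph D V) :
    (N : ℂ)⁻¹ • M.expectation N (traceInvariant B)
      = ∑ G : DoubledGraph D V, G.contribution M B N := by
  have hN' : (N : ℂ) ≠ 0 := Nat.cast_ne_zero.2 hN0.ne'
  rw [expectation_traceInvariant_eq_sum hD M (tag_injective hN) hN0, Finset.smul_sum]
  have h1 : ∀ g : ColoredGraph D V, (N : ℂ)⁻¹ • (((N : ℂ) ^ numFaces B g) •
      entryMoment M N (whiteTag D (tag hN)) (blackTag (tag hN) g) Finset.univ)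
      = ∑ π : Finpartition (Finset.univ : Finset (V ⊕ V)),
        ((N : ℂ) ^ (-1 + (numFaces B g : ℤ))) • ∏ s ∈ π.parts, tagCumulant M N g s := by
    intro g
    rw [moment_eq_sum_finpartition (entryMoment_empty M hN0 _ _), smul_smul, Finset.smul_sum,
      zpow_add₀ hN', zpow_neg_one, zpow_natCast]
    refine Finset.sum_congr rfl fun π _ => ?_
    simp only [tagCumulant, dif_pos hN, entryCumulant]
  simp only [h1]
  rw [← Fintype.sum_prod_type']
  symm
  refine Finset.sum_of_injOn (fun G : DoubledGraph D V => (G.graph, G.partition)) ?_ ?_ ?_ ?_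
  · intro G _ G' _ h
    exact DoubledGraph.ext_partition (congrArg Prod.fst h) (congrArg Prod.snd h)
  · intro G _
    simp
  · rintro ⟨g, π⟩ _ h
    rw [smul_eq_zero_iff_right (zpow_ne_zero _ hN')]
    by_contra hne
    have hne' : ∀ s ∈ π.parts, tagCumulant M N g s ≠ 0 := fun s hs h0 =>
      hne (Finset.prod_eq_zero hs h0)
    obtain ⟨G, rfl, rfl⟩ := exists_doubledGraph g π fun s hs => by
      rcases tagCumulant_dichotomy hD M g (π.nonempty_of_mem_parts hs) with h1 | h1
      · exact absurd (h1 N hN) (hne' s hs)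
      · exact h1.1
    exact h ⟨G, by simp, rfl⟩
  · intro G _
    rfl

theorem numComponents_le_sum_ncard (G : DoubledGraph D V) :
    numComponents G.graph ≤ ∑ s ∈ G.partition.parts, (comp G.graph '' s).ncard := by
  classical
  have h1 : (⋃ s ∈ G.partition.parts, comp G.graph '' (s : Set (V ⊕ V))) = Set.univ := by
    refine Set.eq_univ_of_forall fun C => ?_
    obtain ⟨u, rfl⟩ := C.exists_rep
    refine Set.mem_biUnion (G.partition.part_mem.2 (Finset.mem_univ u)) ⟨u, ?_, rfl⟩
    exact G.partition.mem_part_self.2 (Finset.mem_univ u)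
  rw [numComponents, ← Set.ncard_univ, ← h1]
  exact Finset.set_ncard_biUnion_le _ _

theorem sum_card_partition (G : DoubledGraph D V) :
    ∑ s ∈ G.partition.parts, s.card = 2 * Fintype.card V := by
  rw [G.partition.sum_card_parts, Finset.card_univ, Fintype.card_sum, two_mul]

/-- The powers of the blocks add up to the scaling exponent, except that the blocks may together
count more than `ρ` components; this only lowers the power and goes into `X`. -/
theorem contribution_isBigO (hD : 0 < D) (M : TensorModel D) (B : ColoredGraph D V)
    (G : DoubledGraph D V) :
    ∃ X : ℕ → ℂ⟦X⟧, IsPerturbativeBigO X 0 ∧ ∀ N, 0 < N → Fintype.card V ≤ N →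
      G.contribution M B N = ((N : ℂ) ^ scalingExponent B G) • X N := by
  have h := fun s hs => tagCumulant_dichotomy hD M G.graph (G.partition.nonempty_of_mem_parts
    (a := s) hs)
  by_cases h0 : ∃ s ∈ G.partition.parts, ∀ N, Fintype.card V ≤ N → tagCumulant M N G.graph s = 0
  · obtain ⟨s, hs, h0⟩ := h0
    refine ⟨fun _ => 0, isPerturbativeBigO_zero 0, fun N _ hN => ?_⟩
    rw [DoubledGraph.contribution, Finset.prod_eq_zero hs (h0 N hN), smul_zero, smul_zero]
  push Not at h0
  have h2 : ∀ s : Finset (V ⊕ V), ∃ X : ℕ → ℂ⟦X⟧, s ∈ G.partition.parts →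
      IsPerturbativeBigO X 0 ∧ ∀ N, Fintype.card V ≤ N → tagCumulant M N G.graph s
        = ((N : ℂ) ^ ((D : ℤ) - ((D : ℤ) - 1) * s.card - (comp G.graph '' s).ncard)) • X N := by
    intro s
    by_cases hs : s ∈ G.partition.parts
    · rcases h s hs with h1 | ⟨-, X, h1⟩
      · obtain ⟨N, hN, hne⟩ := h0 s hs
        exact absurd (h1 N hN) hne
      · exact ⟨X, fun _ => h1⟩
    · exact ⟨0, fun h => absurd h hs⟩
  choose X hX using h2
  have hle := numComponents_le_sum_ncard G
  refine ⟨fun N => ((N : ℂ) ^ ((numComponents G.graph : ℤ)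
      - ∑ s ∈ G.partition.parts, ((comp G.graph '' s).ncard : ℤ)))
      • ∏ s ∈ G.partition.parts, X s N, ?_, fun N hN0 hN => ?_⟩
  · refine (IsPerturbativeBigO.prod fun s hs => (hX s hs).1).zpow_smul ?_
    have : (numComponents G.graph : ℤ)
        ≤ ∑ s ∈ G.partition.parts, ((comp G.graph '' s).ncard : ℤ) := by exact_mod_cast hle
    simpa using this
  · have hN' : (N : ℂ) ≠ 0 := Nat.cast_ne_zero.2 hN0.ne'
    rw [DoubledGraph.contribution, Finset.prod_congr rfl fun s hs => (hX s hs).2 N hN,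
      Finset.prod_smul, smul_smul, smul_smul]
    congr 1
    have hprod : ∀ (t : Finset (Finset (V ⊕ V))) (f : Finset (V ⊕ V) → ℤ),
        ∏ s ∈ t, (N : ℂ) ^ f s = (N : ℂ) ^ ∑ s ∈ t, f s := by
      intro t f
      classical
      induction t using Finset.induction_on with
      | empty => simp
      | insert s t hs ih => rw [Finset.prod_insert hs, Finset.sum_insert hs, ih, zpow_add₀ hN']
    rw [hprod, ← zpow_add₀ hN', ← zpow_add₀ hN']
    congr 1
    rw [Finset.sum_sub_distrib, Finset.sum_sub_distrib, ← Finset.mul_sum, Finset.sum_const,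
      G.card_partition_parts, scalingExponent, nsmul_eq_mul]
    have h3 : (∑ s ∈ G.partition.parts, (s.card : ℤ)) = 2 * Fintype.card V := by
      exact_mod_cast sum_card_partition G
    rw [h3, Nat.card_eq_fintype_card (α := V)]
    ring

/-- `F` picks a white representative in every component, so that products over parts become products
over the image of `F`. -/
theorem ofGraph_part_eq_ker {g : ColoredGraph D V} {F : V ⊕ V → V}
    (hF : ∀ c v, F (Sum.inl v) = F (Sum.inr (g c v)))
    (h : ∀ u, comp g u = comp g (Sum.inl (F u))) :
    (DoubledGraph.ofGraph g).part = Setoid.ker F := by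
  refine Setoid.ext fun x y => ⟨fun hxy => eq_of_reachable hF hxy, fun hxy => ?_⟩
  have hxy' : F x = F y := hxy
  exact SimpleGraph.ConnectedComponent.exact (by
    change comp g x = comp g y
    rw [h x, h y, hxy'])

theorem prod_partition_of_ker {R : Type*} [CommMonoid R] {G : DoubledGraph D V} {F : V ⊕ V → V}
    (h : G.part = Setoid.ker F) (f : Finset (V ⊕ V) → R) :
    ∏ s ∈ G.partition.parts, f s
      = ∏ t ∈ Finset.univ.image F, f (Finset.univ.filter fun u => F u = t) := by
  have h1 : ∀ x, G.partition.part x = Finset.univ.filter fun u => F u = F x := fun x => by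
    ext y
    rw [G.mem_partition_part, h, Setoid.ker_def, Finset.mem_filter]
    simp [eq_comm]
  have h2 : G.partition.parts
      = (Finset.univ.image F).image fun t => Finset.univ.filter fun u => F u = t := by
    rw [G.partition_parts, Finset.image_image]
    exact Finset.image_congr fun x _ => h1 x
  rw [h2, Finset.prod_image]
  intro t ht t' _ htt
  obtain ⟨x, -, rfl⟩ := Finset.mem_image.1 (Finset.mem_coe.1 ht)
  have : x ∈ Finset.univ.filter fun u => F u = t' := by
    rw [← show (Finset.univ.filter fun u => F u = F x)
      = Finset.univ.filter fun u => F u = t' from htt]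
    simp
  exact (Finset.mem_filter.1 this).2

theorem card_quotient_of_ker {G : DoubledGraph D V} {F : V ⊕ V → V} (h : G.part = Setoid.ker F) :
    Nat.card (Quotient G.part) = (Finset.univ.image F).card := by
  -- The constant `2` converts the identity of products into an equality of cardinalities.
  have := prod_partition_of_ker h (fun _ => (2 : ℕ))
  rw [Finset.prod_const, Finset.prod_const] at this
  rw [← G.card_partition_parts]
  exact Nat.pow_right_injective le_rfl this

theorem tagCumulant_pair (hD : 0 < D) (M : TensorModel D) (hN : Fintype.card V ≤ N)
    {g : ColoredGraph D V} {x y : V} (h : ∀ c, g c x = y) {s : Finset (V ⊕ V)}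
    (hs : ∀ u, u ∈ s ↔ u = Sum.inl x ∨ u = Sum.inr y) :
    tagCumulant M N g s = M.W N (bubbleTwo D) := by
  let e : Fin 1 ↪ V := ⟨fun _ => x, fun _ _ _ => Subsingleton.elim _ _⟩
  let f : Fin 1 ↪ V := ⟨fun _ => y, fun _ _ _ => Subsingleton.elim _ _⟩
  have h1 : s = Finset.univ.map (e.sumMap f) := by
    ext u
    rw [hs, Finset.mem_map]
    constructor
    · rintro (rfl | rfl)
      · exact ⟨Sum.inl 0, Finset.mem_univ _, rfl⟩
      · exact ⟨Sum.inr 0, Finset.mem_univ _, rfl⟩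
    · rintro ⟨i | i, -, rfl⟩
      · exact Or.inl rfl
      · exact Or.inr rfl
  rw [h1]
  exact tagCumulant_eq_W hD M hN one_pos fun c i => (h c).symm

theorem gaussianPairing_part (hD : 0 < D) (τ : Equiv.Perm V) :
    (gaussianPairing D τ).part = Setoid.ker (Sum.elim id τ.symm) := by
  refine ofGraph_part_eq_ker (by simp) ?_
  rintro (v | v)
  · rfl
  · have := comp_edge (fun _ : Fin D => τ) ⟨0, hD⟩ (τ.symm v)
    rw [Equiv.apply_symm_apply] at this
    exact this.symm

/-- An exact identity: all corrections in `1/N` stay inside `K_2`, so no error term arises from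
these graphs. -/
theorem contribution_gaussianPairing (hD : 0 < D) (M : TensorModel D) (B : ColoredGraph D V)
    (τ : Equiv.Perm V) (hN0 : 0 < N) (hN : Fintype.card V ≤ N) :
    (gaussianPairing D τ).contribution M B N
      = ((N : ℂ) ^ scalingExponent B (gaussianPairing D τ))
        • M.K N (bubbleTwo D) ^ Fintype.card V := by
  have hN' : (N : ℂ) ≠ 0 := Nat.cast_ne_zero.2 hN0.ne'
  have hker := gaussianPairing_part hD τ
  have himg : Finset.univ.image (Sum.elim id τ.symm : V ⊕ V → V) = Finset.univ :=
    Finset.image_univ_of_surjective fun v => ⟨Sum.inl v, rfl⟩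
  rw [DoubledGraph.contribution, prod_partition_of_ker hker, himg,
    Finset.prod_congr rfl fun t _ => tagCumulant_pair hD M hN (x := t) (y := τ t)
      (g := (gaussianPairing D τ).graph) (fun _ => rfl) (by
        rintro (u | u)
        · simp
        · simp [Equiv.symm_apply_eq]),
    Finset.prod_const, Finset.card_univ, TensorModel.K, smul_pow, smul_smul]
  congr 1
  rw [scalingExponent, card_quotient_of_ker hker, himg, Finset.card_univ,
    ← zpow_neg, ← zpow_natCast, ← zpow_mul, ← zpow_add₀ hN']
  congr 1
  have h1 : numComponents (gaussianPairing D τ).graph = Fintype.card V := by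
    rw [← Nat.card_eq_fintype_card]; exact numComponents_const hD τ
  have h2 : numComponents (bubbleTwo D) = 1 := by
    exact (numComponents_const hD (1 : Equiv.Perm (Fin 1))).trans (Nat.card_fin 1)
  rw [h1, h2, Nat.card_eq_fintype_card]
  push_cast
  ring

/-- The map that identifies `w` with `v`. -/
def merge (v w : V) : V → V := fun x => if x = w then v else x

/-- A color other than `c` ties `x` to `τ x`, and the color `c` ties the pairs of `v` and `w`
together; `v` represents the merged component. -/
theorem singleFourPoint_part (hD : 1 < D) (c : Fin D) (τ : Equiv.Perm V) {v w : V} (hvw : v ≠ w) :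
    (singleFourPoint c τ v w).part = Setoid.ker (Sum.elim (merge v w) (merge v w ∘ τ.symm)) := by
  obtain ⟨c', hc'⟩ : ∃ c' : Fin D, c' ≠ c := by
    have : Nontrivial (Fin D) := Fin.nontrivial_iff_two_le.2 hD
    exact exists_ne c
  set g : ColoredGraph D V := fun c' => if c' = c then τ * Equiv.swap v w else τ with hg
  have h1 : ∀ x, comp g (Sum.inl x) = comp g (Sum.inr (τ x)) := fun x => by
    rw [comp_edge g c' x, hg]
    simp [hc']
  have h2 : comp g (Sum.inl w) = comp g (Sum.inr (τ v)) := by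
    rw [comp_edge g c w, hg]
    simp
  have h3 : ∀ x, comp g (Sum.inl x) = comp g (Sum.inl (merge v w x)) := by
    intro x
    rw [merge]
    split_ifs with h
    · rw [h, h2, h1]
    · rfl
  refine ofGraph_part_eq_ker (g := g) ?_ ?_
  · intro d x
    simp only [Sum.elim_inl, Sum.elim_inr, Function.comp_apply, hg]
    split_ifs with h
    · simp only [Equiv.Perm.mul_apply, Equiv.symm_apply_apply, merge]
      by_cases hx : x = w
      · subst hx; simp
      · by_cases hx' : x = v
        · subst hx'; simp [hvw]
        · rw [Equiv.swap_apply_of_ne_of_ne hx' hx]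
    · simp
  · rintro (x | x)
    · exact h3 x
    · have := h1 (τ.symm x)
      rw [Equiv.apply_symm_apply] at this
      rw [← this]
      exact h3 _

theorem image_merge {v w : V} (hvw : v ≠ w) (τ : Equiv.Perm V) :
    Finset.univ.image (Sum.elim (merge v w) (merge v w ∘ τ.symm)) = Finset.univ.erase w := by
  have h1 : ∀ x, merge v w x ≠ w := fun x => by
    rw [merge]; split_ifs with h
    · exact hvw
    · exact h
  ext x
  simp only [Finset.mem_image, Finset.mem_univ, true_and, Finset.mem_erase, and_true]
  constructor
  · rintro ⟨u | u, rfl⟩ <;> exact h1 _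
  · intro h
    exact ⟨Sum.inl x, by simp [merge, h]⟩

theorem numComponents_singleFourPoint (hD : 1 < D) (c : Fin D) (τ : Equiv.Perm V) {v w : V}
    (hvw : v ≠ w) :
    numComponents (singleFourPoint c τ v w).graph + 1 = Fintype.card V := by
  have h := card_quotient_of_ker (singleFourPoint_part hD c τ hvw)
  rw [image_merge hvw, Finset.card_erase_of_mem (Finset.mem_univ _), Finset.card_univ] at h
  have h2 : numComponents (singleFourPoint c τ v w).graph
      = Nat.card (Quotient (singleFourPoint c τ v w).part) := (card_quotient_ofGraph _).symm
  have h3 : 0 < Fintype.card V := Fintype.card_pos_iff.2 ⟨v⟩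
  omega

theorem numComponents_bubbleFour (hD : 1 < D) (c : Fin D) : numComponents (bubbleFour {c}) = 1 := by
  have h := numComponents_singleFourPoint hD c (1 : Equiv.Perm (Fin 2)) (v := 0) (w := 1) (by simp)
  have h2 : (singleFourPoint c (1 : Equiv.Perm (Fin 2)) 0 1).graph = bubbleFour {c} := by
    funext d
    simp [singleFourPoint, DoubledGraph.ofGraph, bubbleFour]
  rw [h2, Fintype.card_fin] at h
  omega

theorem tagCumulant_four (hD : 0 < D) (M : TensorModel D) (hN : Fintype.card V ≤ N) (c : Fin D)
    (τ : Equiv.Perm V) {v w : V} (hvw : v ≠ w) {s : Finset (V ⊕ V)}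
    (hs : ∀ u, u ∈ s ↔ u = Sum.inl v ∨ u = Sum.inl w ∨ u = Sum.inr (τ v) ∨ u = Sum.inr (τ w)) :
    tagCumulant M N (singleFourPoint c τ v w).graph s = M.W N (bubbleFour {c}) := by
  let e : Fin 2 ↪ V := ⟨![v, w], by
    intro i j h
    fin_cases i <;> fin_cases j <;> simp_all [hvw.symm]⟩
  have he0 : e 0 = v := rfl
  have he1 : e 1 = w := rfl
  have h1 : s = Finset.univ.map (e.sumMap (e.trans τ.toEmbedding)) := by
    ext u
    rw [hs, Finset.mem_map]
    constructor
    · rintro (rfl | rfl | rfl | rfl)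
      · exact ⟨Sum.inl 0, Finset.mem_univ _, rfl⟩
      · exact ⟨Sum.inl 1, Finset.mem_univ _, rfl⟩
      · exact ⟨Sum.inr 0, Finset.mem_univ _, rfl⟩
      · exact ⟨Sum.inr 1, Finset.mem_univ _, rfl⟩
    · rintro ⟨i | i, -, rfl⟩ <;> fin_cases i <;> simp [he0, he1]
  rw [h1]
  refine tagCumulant_eq_W hD M hN two_pos fun d i => ?_
  simp only [singleFourPoint, DoubledGraph.ofGraph, bubbleFour, Finset.mem_singleton]
  split_ifs with h
  · fin_cases i <;> simp [he0, he1]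
  · rfl

theorem contribution_singleFourPoint (hD : 1 < D) (M : TensorModel D) (B : ColoredGraph D V)
    (c : Fin D) (τ : Equiv.Perm V) {v w : V} (hvw : v ≠ w) (hN0 : 0 < N)
    (hN : Fintype.card V ≤ N) :
    (singleFourPoint c τ v w).contribution M B N
      = ((N : ℂ) ^ scalingExponent B (singleFourPoint c τ v w))
        • (M.K N (bubbleTwo D) ^ (Fintype.card V - 2) * M.K N (bubbleFour {c})) := by
  have hN' : (N : ℂ) ≠ 0 := Nat.cast_ne_zero.2 hN0.ne'
  have hD0 : 0 < D := by omega
  have hker := singleFourPoint_part hD c τ hvw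
  have hv : v ∈ Finset.univ.erase w := by simp [hvw]
  have hcard : ((Finset.univ.erase w).erase v).card = Fintype.card V - 2 := by
    rw [Finset.card_erase_of_mem hv, Finset.card_erase_of_mem (Finset.mem_univ _),
      Finset.card_univ]
    rfl
  have hcard2 : 2 ≤ Fintype.card V := by
    have := Finset.card_le_univ {v, w}
    rwa [Finset.card_pair hvw] at this
  have h4 : tagCumulant M N (singleFourPoint c τ v w).graph (Finset.univ.filter fun u =>
      (Sum.elim (merge v w) (merge v w ∘ τ.symm) : V ⊕ V → V) u = v) = M.W N (bubbleFour {c}) := by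
    refine tagCumulant_four hD0 M hN c τ hvw ?_
    have hm : ∀ x, merge v w x = v ↔ x = v ∨ x = w := fun x => by
      rw [merge]; split_ifs with h <;> simp [h]
    rintro (u | u)
    · simp [hm]
    · simp [hm, Equiv.symm_apply_eq]
  have h2 : ∀ t ∈ (Finset.univ.erase w).erase v,
      tagCumulant M N (singleFourPoint c τ v w).graph (Finset.univ.filter fun u =>
      (Sum.elim (merge v w) (merge v w ∘ τ.symm) : V ⊕ V → V) u = t) = M.W N (bubbleTwo D) := by
    intro t ht
    simp only [Finset.mem_erase, Finset.mem_univ, and_true] at ht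
    refine tagCumulant_pair hD0 M hN (x := t) (y := τ t) (fun d => ?_) ?_
    · simp only [singleFourPoint, DoubledGraph.ofGraph]
      split_ifs with h
      · rw [Equiv.Perm.mul_apply, Equiv.swap_apply_of_ne_of_ne ht.1 ht.2]
      · rfl
    · have hm : ∀ x, merge v w x = t ↔ x = t := fun x => by
        rw [merge]; split_ifs with h
        · subst h
          exact ⟨fun h => absurd h.symm ht.1, fun h => absurd h.symm ht.2⟩
        · rfl
      rintro (u | u)
      · simp [hm]
      · simp [hm, Equiv.symm_apply_eq]
  rw [DoubledGraph.contribution, prod_partition_of_ker hker, image_merge hvw,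
    ← Finset.mul_prod_erase _ _ hv, h4, Finset.prod_congr rfl h2, Finset.prod_const, hcard,
    TensorModel.K, TensorModel.K, smul_pow, smul_mul_smul_comm, smul_smul, mul_comm (M.W N _)]
  congr 1
  rw [scalingExponent, card_quotient_of_ker hker, image_merge hvw,
    Finset.card_erase_of_mem (Finset.mem_univ _), Finset.card_univ,
    ← zpow_neg, ← zpow_neg, ← zpow_natCast, ← zpow_mul, ← zpow_add₀ hN', ← zpow_add₀ hN']
  congr 1
  have h1 := numComponents_singleFourPoint hD c τ hvw
  have h3 : numComponents (bubbleTwo D) = 1 := by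
    exact (numComponents_const hD0 (1 : Equiv.Perm (Fin 1))).trans (Nat.card_fin 1)
  obtain ⟨r, hr⟩ := Nat.exists_eq_add_of_le hcard2
  have h5 : numComponents (singleFourPoint c τ v w).graph = r + 1 := by omega
  rw [h5, h3, numComponents_bubbleFour hD, Nat.card_eq_fintype_card, hr,
    show 2 + r - 2 = r by omega, show 2 + r - 1 = r + 1 by omega]
  push_cast
  ring

end Doubled

/-! ### The expectation of a melonic bubble -/

section Expansion

open Filter

variable {D : ℕ} {V : Type} [Fintype V] [DecidableEq V]

/-- A Gaussian pairing uses one permutation for all colors, whereas here the color `c` differs from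
any other one by a transposition. -/
theorem IsSingleFourPoint.not_isNearlyCanonical (hD : 1 < D) {σ : Equiv.Perm V} {c : Fin D}
    {G : DoubledGraph D V} (h : IsSingleFourPoint c G) : ¬ IsNearlyCanonical σ G := by
  obtain ⟨c', hc'⟩ : ∃ c' : Fin D, c' ≠ c := by
    have : Nontrivial (Fin D) := Fin.nontrivial_iff_two_le.2 hD
    exact exists_ne c
  obtain ⟨τ, v, w, hvw, rfl⟩ := h
  rintro ⟨τ', -, h⟩
  have h1 := congrFun (congrArg DoubledGraph.graph h) c
  have h2 := congrFun (congrArg DoubledGraph.graph h) c'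
  simp only [singleFourPoint, gaussianPairing, DoubledGraph.ofGraph, if_true, if_neg hc'] at h1 h2
  rw [← h2, mul_eq_left, Equiv.swap_eq_one_iff] at h1
  exact hvw h1

/-- A third color, available because `D ≥ 3`, carries `τ` in both descriptions and contradicts the
transposition in color `c`. Distinct colors thus never count the same doubled graph. -/
theorem IsSingleFourPoint.color_eq (hD : 3 ≤ D) {c c' : Fin D} {G : DoubledGraph D V}
    (h : IsSingleFourPoint c G) (h' : IsSingleFourPoint c' G) : c = c' := by
  by_contra hne
  obtain ⟨d, hd⟩ : ∃ d : Fin D, d ∉ ({c, c'} : Finset (Fin D)) := by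
    by_contra! hall
    have h1 := Finset.card_le_card (fun x _ => hall x : (Finset.univ : Finset (Fin D)) ⊆ {c, c'})
    rw [Finset.card_univ, Fintype.card_fin] at h1
    have := Finset.card_le_two (a := c) (b := c')
    omega
  simp only [Finset.mem_insert, Finset.mem_singleton, not_or] at hd
  obtain ⟨τ, v, w, hvw, rfl⟩ := h
  obtain ⟨τ', v', w', hvw', h⟩ := h'
  have h1 := congrFun (congrArg DoubledGraph.graph h) c
  have h2 := congrFun (congrArg DoubledGraph.graph h) d
  simp only [singleFourPoint, DoubledGraph.ofGraph, if_true, if_neg hd.1, if_neg hd.2, if_neg hne]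
    at h1 h2
  rw [← h2, mul_eq_left, Equiv.swap_eq_one_iff] at h1
  exact hvw h1

theorem sum_ite_ncard {R : Type*} [AddCommGroup R] [Module ℂ R] {α : Type*} [Fintype α]
    (P : α → Prop) [DecidablePred P] (x : R) :
    ∑ a, (if P a then x else 0) = ({a | P a}.ncard : ℂ) • x := by
  rw [← Finset.sum_filter, Finset.sum_const, Nat.cast_smul_eq_nsmul]
  congr 1
  rw [← Set.ncard_coe_finset]
  congr 1
  ext a
  simp

/-- Beyond the exponents `0` and `-(D - 2)`, whose contributions are exact, integrality leaves
exponents at most `-(D - 1)`. For a single pair the truncated `card V - 2` is harmless: a four-point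
part needs two distinct vertices, so `alphaCoeff'` vanishes. -/
theorem isPerturbativeBigO_expectation (hD : 3 ≤ D) {B : ColoredGraph D V} {σ : Equiv.Perm V}
    (hB : IsMelonic B σ) (M : TensorModel D) :
    IsPerturbativeBigO (fun N : ℕ =>
        (N : ℂ)⁻¹ • M.expectation N (traceInvariant B)
          - ((1 + (alphaCoeff B σ : ℂ) / (N : ℂ) ^ (D - 2)) •
                M.K N (bubbleTwo D) ^ Fintype.card V
            + ∑ c : Fin D, ((alphaCoeff' B c : ℂ) / (N : ℂ) ^ (D - 2)) •
                (M.K N (bubbleTwo D) ^ (Fintype.card V - 2) * M.K N (bubbleFour {c}))))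
        (D - 1) := by
  classical
  have hD0 : 0 < D := by omega
  have hD1 : 1 < D := by omega
  obtain ⟨hG0, hG⟩ := scaling_of_melonic hD hB
  have hD3 : (3 : ℤ) ≤ D := by exact_mod_cast hD
  -- The main terms are distributed over the doubled graphs, so that the comparison is made graph by
  -- graph; summing the indicators gives back the counts.
  let main : DoubledGraph D V → ℕ → ℂ⟦X⟧ := fun G N =>
    (if G = gaussianPairing D σ then M.K N (bubbleTwo D) ^ Fintype.card V else 0)
    + (if IsNearlyCanonical σ G ∧ scalingExponent B G = -((D : ℤ) - 2) then
        ((N : ℂ) ^ (-((D : ℤ) - 2))) • M.K N (bubbleTwo D) ^ Fintype.card V else 0)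
    + ∑ c, if IsSingleFourPoint c G ∧ scalingExponent B G = -((D : ℤ) - 2) then
        ((N : ℂ) ^ (-((D : ℤ) - 2))) •
          (M.K N (bubbleTwo D) ^ (Fintype.card V - 2) * M.K N (bubbleFour {c})) else 0
  have hmain : ∀ N : ℕ, ∑ G, main G N
      = (1 + (alphaCoeff B σ : ℂ) / (N : ℂ) ^ (D - 2)) • M.K N (bubbleTwo D) ^ Fintype.card V
            + ∑ c : Fin D, ((alphaCoeff' B c : ℂ) / (N : ℂ) ^ (D - 2)) •
                (M.K N (bubbleTwo D) ^ (Fintype.card V - 2) * M.K N (bubbleFour {c})) := by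
    intro N
    have hpow : (N : ℂ) ^ (-((D : ℤ) - 2)) = ((N : ℂ) ^ (D - 2))⁻¹ := by
      rw [zpow_neg, ← zpow_natCast]
      congr 2
      omega
    simp only [main, Finset.sum_add_distrib]
    rw [Finset.sum_comm (s := (Finset.univ : Finset (DoubledGraph D V)))]
    simp only [sum_ite_ncard]
    have hone : {G : DoubledGraph D V | G = gaussianPairing D σ}.ncard = 1 :=
      Set.ncard_singleton _
    rw [hone, hpow, Nat.cast_one]
    simp only [smul_smul, add_smul, one_smul, div_eq_mul_inv]
    rfl
  refine IsPerturbativeBigO.congr (F := fun N => ∑ G, (G.contribution M B N - main G N))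
    (IsPerturbativeBigO.sum fun G _ => ?_) ?_
  swap
  · filter_upwards [eventually_ge_atTop 1, eventually_ge_atTop (Fintype.card V)] with N h1 h2
    rw [expectation_eq_sum_contribution hD0 M h1 h2, ← hmain, Finset.sum_sub_distrib]
  have hexact : (∀ N, 0 < N → Fintype.card V ≤ N → G.contribution M B N = main G N) →
      IsPerturbativeBigO (fun N => G.contribution M B N - main G N) (D - 1) := fun h => by
    refine (isPerturbativeBigO_zero (D - 1)).congr ?_
    filter_upwards [eventually_ge_atTop 1, eventually_ge_atTop (Fintype.card V)] with N h1 h2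
    rw [h N h1 h2, sub_self]
  by_cases h0 : G = gaussianPairing D σ
  · refine hexact fun N hN0 hN => ?_
    have hne : scalingExponent B G ≠ -((D : ℤ) - 2) := by rw [h0, hG0]; omega
    simp only [main, if_pos h0, hne, and_false, if_false, Finset.sum_const_zero, add_zero]
    rw [h0, contribution_gaussianPairing hD0 M B σ hN0 hN, hG0, zpow_zero, one_smul]
  obtain ⟨hle, heq⟩ := hG G h0
  by_cases he : scalingExponent B G = -((D : ℤ) - 2)
  · refine hexact fun N hN0 hN => ?_
    simp only [main, if_neg h0, he, and_true, zero_add]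
    rcases heq he with h1 | ⟨c, hc⟩
    · have h2 : ∀ c, ¬ IsSingleFourPoint c G := fun c hc => hc.not_isNearlyCanonical hD1 h1
      simp only [h2, if_false, Finset.sum_const_zero, add_zero, if_pos h1]
      obtain ⟨τ, -, rfl⟩ := h1
      rw [contribution_gaussianPairing hD0 M B τ hN0 hN, he]
    · rw [if_neg (hc.not_isNearlyCanonical hD1), zero_add, Finset.sum_eq_single c, if_pos hc]
      · obtain ⟨τ, v, w, hvw, rfl⟩ := hc
        rw [contribution_singleFourPoint hD1 M B c τ hvw hN0 hN, he]
      · intro c' _ hc'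
        exact if_neg fun h => hc' (h.color_eq hD hc)
      · simp
  · have hz : main G = fun _ => 0 := by
      funext N
      simp only [main, if_neg h0, he, and_false, if_false, Finset.sum_const_zero, add_zero]
    obtain ⟨X, hX, hXN⟩ := contribution_isBigO hD0 M B G
    refine (hX.zpow_smul (k := D - 1) (e := scalingExponent B G) (by omega)).congr ?_
    filter_upwards [eventually_ge_atTop 1, eventually_ge_atTop (Fintype.card V)] with N h1 h2
    rw [hXN N h1 h2, hz, sub_zero]

end Expansion

/-! ### Color-invariant models -/

section ColorInvariance

variable {D N : ℕ} {V : Type} [Fintype V] [DecidableEq V]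

/-- The permutation of the positions of the indices. -/
def permuteIndex (N : ℕ) (κ : Equiv.Perm (Fin D)) : Equiv.Perm (Index D N) where
  toFun i := i ∘ κ
  invFun i := i ∘ κ.symm
  left_inv i := by funext c; simp
  right_inv i := by funext c; simp

/-- The action of a permutation of the positions of the indices on polynomials. -/
noncomputable def permuteColors (N : ℕ) (κ : Equiv.Perm (Fin D)) : Obs D N →ₐ[ℂ⟦X⟧] Obs D N :=
  MvPolynomial.rename (Equiv.sumCongr (permuteIndex N κ) (permuteIndex N κ))

theorem gaussE_permuteColors (κ : Equiv.Perm (Fin D)) (P : Obs D N) :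
    gaussE D N (permuteColors N κ P) = gaussE D N P := by
  induction P using MvPolynomial.induction_on' with
  | add p q hp hq => rw [map_add, map_add, map_add, hp, hq]
  | monomial s r =>
    rw [permuteColors, MvPolynomial.rename_monomial, gaussianFunctional_monomial,
      gaussianFunctional_monomial, gaussianMoment, gaussianMoment]
    congr 2
    rw [← Equiv.prod_comp (permuteIndex N κ)]
    refine Finset.prod_congr rfl fun i _ => ?_
    have h1 := Finsupp.mapDomain_apply
      (Equiv.sumCongr (permuteIndex N κ) (permuteIndex N κ)).injective s (Sum.inl i)
    have h2 := Finsupp.mapDomain_apply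
      (Equiv.sumCongr (permuteIndex N κ) (permuteIndex N κ)).injective s (Sum.inr i)
    exact congrArg₂ _ h1 h2

theorem traceOperator_permute (κ : Equiv.Perm (Fin D)) (B : ColoredGraph D V)
    (a b : V → Index D N) :
    traceOperator (fun c => B (κ c)) (fun v => permuteIndex N κ (a v))
      (fun v => permuteIndex N κ (b v)) = traceOperator B a b := by
  exact Equiv.prod_comp κ fun c => ∏ v, if a v c = b (B c v) c then (1 : ℂ) else 0

theorem permuteColors_legMonomial (κ : Equiv.Perm (Fin D)) (a b : V → Index D N) :
    permuteColors N κ (legMonomial a b)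
      = legMonomial (fun v => permuteIndex N κ (a v)) fun v => permuteIndex N κ (b v) := by
  simp [permuteColors, legMonomial]

theorem permuteColors_tracePoly (κ : Equiv.Perm (Fin D)) (B : ColoredGraph D V) :
    permuteColors N κ (tracePoly N B) = tracePoly N fun c => B (κ c) := by
  conv_rhs => rw [tracePoly,
    ← Equiv.sum_comp (Equiv.prodCongr (Equiv.arrowCongr (Equiv.refl V) (permuteIndex N κ))
      (Equiv.arrowCongr (Equiv.refl V) (permuteIndex N κ)))]
  rw [tracePoly, map_sum]
  refine Finset.sum_congr rfl fun q _ => ?_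
  rw [map_smul, permuteColors_legMonomial, ← traceOperator_permute κ B]
  rfl

theorem tracePoly_relabel {V' : Type} [Fintype V'] [DecidableEq V'] (B : ColoredGraph D V)
    (e f : V ≃ V') : tracePoly N (relabel B e f) = tracePoly N B := by
  rw [tracePoly, tracePoly,
    ← Equiv.sum_comp (Equiv.prodCongr (Equiv.arrowCongr e (Equiv.refl (Index D N)))
      (Equiv.arrowCongr f (Equiv.refl (Index D N))))]
  refine Finset.sum_congr rfl fun q _ => ?_
  rw [traceOperator_relabel]
  congr 1
  · congr 2 <;> funext v <;> simp [Equiv.arrowCongr]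
  · rw [legMonomial, legMonomial, ← Equiv.prod_comp e, ← Equiv.prod_comp f]
    simp [Equiv.arrowCongr]

theorem permuteColors_interactionPoly {M : TensorModel D} (hM : M.ColorInvariant)
    (κ : Equiv.Perm (Fin D)) :
    permuteColors N κ (M.interactionPoly N) = M.interactionPoly N := by
  obtain ⟨s, hs⟩ := hM κ
  rw [TensorModel.interactionPoly, map_sum, ← Equiv.sum_comp s]
  refine Finset.sum_congr rfl fun i _ => ?_
  obtain ⟨ht, e, f, hef⟩ := hs i
  have hp : M.p (s i) = M.p i := by simpa using (Fintype.card_congr e).symm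
  rw [map_smul, permuteColors_tracePoly, hef, tracePoly_relabel, ht, hp]

theorem entryCumulant_permute {M : TensorModel D} (hM : M.ColorInvariant) (hN : 0 < N)
    (κ : Equiv.Perm (Fin D)) (a b : V → Index D N) (S : Finset (V ⊕ V)) :
    entryCumulant M N (fun v => permuteIndex N κ (a v)) (fun v => permuteIndex N κ (b v)) S
      = entryCumulant M N a b S := by
  rw [entryCumulant, entryCumulant]
  congr 1
  funext s
  rw [entryMoment_eq M hN, entryMoment_eq M hN]
  conv_rhs => rw [← polyExpectationHom_map M M (permuteColors N κ) (gaussE_permuteColors κ)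
      (permuteColors_interactionPoly hM κ) hN, map_prod]
  congr 1
  refine Finset.prod_congr rfl fun x _ => ?_
  rcases x with x | x <;> simp [entries, permuteColors]

theorem W_permute (hD : 0 < D) {M : TensorModel D} (hM : M.ColorInvariant) {p : ℕ} (hp : 0 < p)
    (hN : p ≤ N) (κ : Equiv.Perm (Fin D)) (B : ColoredGraph D (Fin p)) :
    M.W N (fun c => B (κ c)) = M.W N B := by
  rw [W_eq_entryCumulant hD M hp hN (Fin.castLE_injective hN),
    W_eq_entryCumulant hD M hp hN (Fin.castLE_injective hN)]
  exact entryCumulant_permute hM (hp.trans_le hN) κ (whiteTag D (Fin.castLE hN))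
    (blackTag (Fin.castLE hN) B) Finset.univ

/-- The transposition of the two colors carries one bubble to the other. -/
theorem K_bubbleFour_eq (hD : 1 < D) {M : TensorModel D} (hM : M.ColorInvariant) (hN : 2 ≤ N)
    (c c' : Fin D) : M.K N (bubbleFour {c'}) = M.K N (bubbleFour {c}) := by
  have h : (fun d => bubbleFour {c} (Equiv.swap c c' d)) = bubbleFour {c'} := by
    funext d
    simp only [bubbleFour, Finset.mem_singleton]
    refine if_congr ?_ rfl rfl
    rw [Equiv.swap_apply_eq_iff, Equiv.swap_apply_left]
  have hW := W_permute (by omega) hM two_pos hN (Equiv.swap c c') (bubbleFour {c})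
  rw [h] at hW
  rw [TensorModel.K, TensorModel.K, hW, numComponents_bubbleFour hD, numComponents_bubbleFour hD]

theorem isPerturbativeBigO_expectation_of_colorInvariant (hD : 3 ≤ D) {B : ColoredGraph D V}
    {σ : Equiv.Perm V} (hB : IsMelonic B σ) {M : TensorModel D} (hM : M.ColorInvariant)
    (c : Fin D) :
    IsPerturbativeBigO (fun N : ℕ =>
        (N : ℂ)⁻¹ • M.expectation N (traceInvariant B)
          - ((1 + (alphaCoeff B σ : ℂ) / (N : ℂ) ^ (D - 2)) •
                M.K N (bubbleTwo D) ^ Fintype.card V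
            + (((∑ c' : Fin D, alphaCoeff' B c' : ℕ) : ℂ) / (N : ℂ) ^ (D - 2)) •
                (M.K N (bubbleTwo D) ^ (Fintype.card V - 2) * M.K N (bubbleFour {c}))))
        (D - 1) := by
  refine (isPerturbativeBigO_expectation hD hB M).congr ?_
  filter_upwards [Filter.eventually_ge_atTop 2] with N hN
  congr 2
  simp only [fun c' => K_bubbleFour_eq (by omega) hM hN c c']
  rw [← Finset.sum_smul, ← Finset.sum_div, Nat.cast_sum]

end ColorInvariance

/-! ### The Schwinger-Dyson equation -/

section SchwingerDyson

variable {D N : ℕ}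

/-- The Euler derivation in the conjugate variables. -/
noncomputable def eulerDerivation (D N : ℕ) : Derivation ℂ⟦X⟧ (Obs D N) (Obs D N) :=
  ∑ i : Index D N, (MvPolynomial.X (Sum.inr i) : Obs D N) • MvPolynomial.pderiv (Sum.inr i)

theorem eulerDerivation_apply (P : Obs D N) : eulerDerivation D N P
    = ∑ i : Index D N, MvPolynomial.X (Sum.inr i) * MvPolynomial.pderiv (Sum.inr i) P := by
  rw [eulerDerivation, ← Derivation.coeFnAddMonoidHom_apply, map_sum, Finset.sum_apply]
  rfl

theorem eulerDerivation_inl (i : Index D N) :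
    eulerDerivation D N (MvPolynomial.X (Sum.inl i)) = 0 := by
  rw [eulerDerivation_apply]
  refine Finset.sum_eq_zero fun j _ => ?_
  rw [MvPolynomial.pderiv_X_of_ne (by simp), mul_zero]

theorem eulerDerivation_inr (i : Index D N) :
    eulerDerivation D N (MvPolynomial.X (Sum.inr i)) = MvPolynomial.X (Sum.inr i) := by
  rw [eulerDerivation_apply, Finset.sum_eq_single i]
  · rw [MvPolynomial.pderiv_X_self, mul_one]
  · intro j _ hj
    rw [MvPolynomial.pderiv_X_of_ne (by simpa using hj.symm), mul_zero]
  · simp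

theorem eulerDerivation_legMonomial {W : Type*} [Fintype W] (a b : W → Index D N) :
    eulerDerivation D N (legMonomial a b) = Fintype.card W • legMonomial a b := by
  classical
  have h1 : ∀ s : Finset W, eulerDerivation D N (∏ v ∈ s, MvPolynomial.X (Sum.inl (a v))) = 0 := by
    intro s
    induction s using Finset.induction_on with
    | empty => simp
    | insert v s hv ih =>
      rw [Finset.prod_insert hv, Derivation.leibniz, ih, eulerDerivation_inl, smul_zero, smul_zero,
        add_zero]
  have h2 : ∀ s : Finset W, eulerDerivation D N (∏ v ∈ s, MvPolynomial.X (Sum.inr (b v)))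
      = s.card • ∏ v ∈ s, MvPolynomial.X (Sum.inr (b v)) := by
    intro s
    induction s using Finset.induction_on with
    | empty => simp
    | insert v s hv ih =>
      rw [Finset.prod_insert hv, Derivation.leibniz, ih, eulerDerivation_inr,
        Finset.card_insert_of_notMem hv, add_smul, one_smul, smul_eq_mul, smul_eq_mul,
        mul_smul_comm, mul_comm (∏ v ∈ s, _)]
  rw [legMonomial, Derivation.leibniz, h1, h2, smul_zero, add_zero, smul_eq_mul, mul_smul_comm,
    Finset.card_univ]

theorem eulerDerivation_tracePoly {V : Type} [Fintype V] [DecidableEq V] (B : ColoredGraph D V) :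
    eulerDerivation D N (tracePoly N B) = Fintype.card V • tracePoly N B := by
  simp only [tracePoly, map_sum, Derivation.map_smul, eulerDerivation_legMonomial, Finset.smul_sum]
  refine Finset.sum_congr rfl fun q _ => ?_
  rw [smul_comm]

/-- Integration by parts in every `T_i`: the derivative hits the conjugate entry beside it, once for
each of the `N ^ D` indices, or it hits `P`, which produces the Euler operator. -/
theorem gaussE_tracePoly_two_mul (hN : 0 < N) (P : Obs D N) :
    gaussE D N (tracePoly N (bubbleTwo D) * P)
      = ((N : ℂ) ^ (D - 1))⁻¹ • ((N : ℂ) ^ D • gaussE D N P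
        + gaussE D N (eulerDerivation D N P)) := by
  have h1 : tracePoly N (bubbleTwo D)
      = ∑ i : Index D N, MvPolynomial.X (Sum.inl i) * MvPolynomial.X (Sum.inr i) := by
    classical
    rw [tracePoly, ← Equiv.sum_comp (Equiv.prodCongr (Equiv.funUnique (Fin 1) (Index D N)).symm
      (Equiv.funUnique (Fin 1) (Index D N)).symm), Fintype.sum_prod_type]
    refine Finset.sum_congr rfl fun i _ => ?_
    rw [Finset.sum_eq_single i]
    · rw [traceOperator_eq_ite, if_pos, map_one, one_smul, legMonomial]
      · simp
      · intro c v
        rfl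
    · intro j _ hj
      rw [traceOperator_eq_ite, if_neg, map_zero, zero_smul]
      intro h
      exact hj (funext fun c => (h c 0).symm)
    · simp
  have hl : ((N : ℂ) ^ (D - 1)) ≠ 0 := pow_ne_zero _ (Nat.cast_ne_zero.2 hN.ne')
  rw [h1, Finset.sum_mul, map_sum]
  have h2 : ∀ i : Index D N,
      gaussE D N (MvPolynomial.X (Sum.inl i) * MvPolynomial.X (Sum.inr i) * P)
        = ((N : ℂ) ^ (D - 1))⁻¹ • (gaussE D N P
          + gaussE D N (MvPolynomial.X (Sum.inr i) * MvPolynomial.pderiv (Sum.inr i) P)) := by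
    intro i
    rw [mul_assoc, gaussianFunctional_X_mul hl, Derivation.leibniz, MvPolynomial.pderiv_X_self,
      map_add, smul_eq_mul, smul_eq_mul, mul_one, add_comm]
  simp only [h2]
  rw [← Finset.smul_sum, Finset.sum_add_distrib, Finset.sum_const, ← map_sum,
    ← eulerDerivation_apply, Finset.card_univ, Fintype.card_fun, Fintype.card_fin, Fintype.card_fin,
    ← Nat.cast_smul_eq_nsmul ℂ, Nat.cast_pow]

/-- The degree `p i` in the conjugate entries cancels the `1 / p i` of the action. -/
theorem eulerDerivation_interactionPoly (M : TensorModel D) :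
    eulerDerivation D N (M.interactionPoly N)
      = ∑ i, (PowerSeries.monomial (M.p i - 1) ((N : ℂ) ^ (D - 1) * M.t i) : ℂ⟦X⟧)
        • tracePoly N (M.bubble i) := by
  simp only [TensorModel.interactionPoly, map_sum, Derivation.map_smul, eulerDerivation_tracePoly]
  refine Finset.sum_congr rfl fun i _ => ?_
  have h : (M.p i : ℂ) ≠ 0 := by
    have := M.two_le i
    exact Nat.cast_ne_zero.2 (by omega)
  rw [Fintype.card_fin, smul_comm, ← smul_assoc, ← Nat.cast_smul_eq_nsmul ℂ, ← map_smul,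
    smul_eq_mul]
  congr 2
  field_simp

theorem X_dvd_gaussE_euler (M : TensorModel D) (k : ℕ) :
    (PowerSeries.X : ℂ⟦X⟧) ^ (k + 1)
      ∣ gaussE D N (M.interactionPoly N ^ k * eulerDerivation D N (M.interactionPoly N)) := by
  have h : eulerDerivation D N (M.interactionPoly N)
      = (PowerSeries.X : ℂ⟦X⟧) • eulerDerivation D N (M.interactionQuot N) := by
    rw [interactionPoly_eq, Derivation.map_smul]
  rw [h, mul_smul_comm, map_smul, smul_eq_mul, pow_succ']
  exact mul_dvd_mul_left _ (X_pow_dvd_gaussE M k _)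

theorem polyIntegral_tracePoly_two (M : TensorModel D) (hN : 0 < N) :
    polyIntegral M N (tracePoly N (bubbleTwo D))
      = ((N : ℂ) ^ (D - 1))⁻¹ • ((N : ℂ) ^ D • polyIntegral M N 1
        + polyIntegral M N (eulerDerivation D N (M.interactionPoly N))) := by
  have h1 : ∀ k : ℕ, gaussE D N (M.interactionPoly N ^ k * tracePoly N (bubbleTwo D))
      = ((N : ℂ) ^ (D - 1))⁻¹ • ((N : ℂ) ^ D • gaussE D N (M.interactionPoly N ^ k * 1)
        + (k : ℂ) • gaussE D N (M.interactionPoly N ^ (k - 1)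
          * eulerDerivation D N (M.interactionPoly N))) := by
    intro k
    rw [mul_comm, gaussE_tracePoly_two_mul hN, Derivation.leibniz_pow, mul_one,
      map_nsmul, smul_eq_mul, Nat.cast_smul_eq_nsmul]
  ext n
  simp only [polyIntegral, sumSeries, PowerSeries.coeff_mk, h1, PowerSeries.coeff_smul, map_add,
    smul_eq_mul]
  -- The Leibniz factor `k` turns `k!` into `(k - 1)!` and shifts the sum. The ranges still match,
  -- since the last term on the right is divisible by `X ^ (n + 1)`.
  have h2 : ∑ k ∈ Finset.range (n + 1), (k.factorial : ℂ)⁻¹ * ((k : ℂ) * PowerSeries.coeff n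
      (gaussE D N (M.interactionPoly N ^ (k - 1) * eulerDerivation D N (M.interactionPoly N))))
      = ∑ k ∈ Finset.range (n + 1), (k.factorial : ℂ)⁻¹ * PowerSeries.coeff n
      (gaussE D N (M.interactionPoly N ^ k * eulerDerivation D N (M.interactionPoly N))) := by
    rw [Finset.sum_range_succ', Finset.sum_range_succ _ n,
      PowerSeries.X_pow_dvd_iff.1 (X_dvd_gaussE_euler M n) n (Nat.lt_succ_self n)]
    simp only [Nat.cast_zero, zero_mul, mul_zero, add_zero, Nat.add_sub_cancel]
    refine Finset.sum_congr rfl fun k _ => ?_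
    have h3 : ((k + 1 : ℕ) : ℂ) ≠ 0 := Nat.cast_ne_zero.2 (Nat.succ_ne_zero k)
    rw [Nat.factorial_succ, Nat.cast_mul, mul_inv]
    field_simp
  rw [← h2, Finset.mul_sum, ← Finset.sum_add_distrib, Finset.mul_sum]
  refine Finset.sum_congr rfl fun k _ => ?_
  ring

/-- In a melonic model this becomes a closed equation for `K_2`, each expectation on the right being
a power of `K_2` up to `O(N^(-(D-2)))`. -/
theorem expectation_bubbleTwo (hD : 0 < D) (M : TensorModel D) (hN : 0 < N) :
    (N : ℂ)⁻¹ • M.expectation N (traceInvariant (bubbleTwo D))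
      = 1 + ∑ i, (PowerSeries.monomial (M.p i - 1) (M.t i) : ℂ⟦X⟧)
        * ((N : ℂ)⁻¹ • M.expectation N (traceInvariant (M.bubble i))) := by
  have hN' : (N : ℂ) ≠ 0 := Nat.cast_ne_zero.2 hN.ne'
  have hl : ((N : ℂ) ^ (D - 1)) ≠ 0 := pow_ne_zero _ hN'
  have h1 : polyExpectationHom M N (tracePoly N (bubbleTwo D))
      = ((N : ℂ) ^ (D - 1))⁻¹ • ((N : ℂ) ^ D • polyExpectationHom M N 1
        + polyExpectationHom M N (eulerDerivation D N (M.interactionPoly N))) := by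
    change polyExpectation _ _ _ = _ • (_ • polyExpectation _ _ _ + polyExpectation _ _ _)
    rw [polyExpectation, polyIntegral_tracePoly_two M hN, polyExpectation, polyExpectation,
      smul_mul_assoc, add_mul, smul_mul_assoc]
  rw [expectation_traceInvariant M hN, h1, polyExpectationHom_one M hN,
    eulerDerivation_interactionPoly, map_sum, smul_add, smul_add, smul_smul, smul_smul,
    Finset.smul_sum, Finset.smul_sum]
  congr 1
  · have : (N : ℂ)⁻¹ * ((N : ℂ) ^ (D - 1))⁻¹ * (N : ℂ) ^ D = 1 := by
      obtain ⟨d, rfl⟩ : ∃ d, D = d + 1 := ⟨D - 1, by omega⟩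
      rw [Nat.add_sub_cancel, pow_succ]
      field_simp
    rw [this, one_smul]
  · refine Finset.sum_congr rfl fun i _ => ?_
    rw [map_smul, expectation_traceInvariant M hN, ← smul_eq_mul ((N : ℂ) ^ (D - 1)), map_smul,
      smul_assoc, inv_smul_smul₀ hl, smul_eq_mul, mul_smul_comm]

theorem isMelonic_bubbleTwo (D : ℕ) : IsMelonic (bubbleTwo D) 1 := by
  have h := (IsMelonic.base (D := D)).relabel (Equiv.ofUnique Unit (Fin 1))
    (Equiv.ofUnique Unit (Fin 1))
  convert h using 1
  · exact funext fun c => Subsingleton.elim _ _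
  · exact Subsingleton.elim _ _

/-- On one white and one black vertex the Gaussian pairing is the only doubled graph, and its
exponent is `0`. -/
theorem K_bubbleTwo_eq (hD : 3 ≤ D) (M : TensorModel D) (hN : 0 < N) :
    M.K N (bubbleTwo D) = (N : ℂ)⁻¹ • M.expectation N (traceInvariant (bubbleTwo D)) := by
  rw [expectation_eq_sum_contribution (by omega) M hN (by rw [Fintype.card_fin]; omega),
    Finset.sum_eq_single (gaussianPairing D 1)]
  · rw [contribution_gaussianPairing (by omega) M _ _ hN (by rw [Fintype.card_fin]; omega),
      (scaling_of_melonic hD (isMelonic_bubbleTwo D)).1]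
    simp
  · intro G _ hG
    refine absurd ?_ hG
    have hgr : G.graph = (gaussianPairing D (1 : Equiv.Perm (Fin 1))).graph :=
      Subsingleton.elim _ _
    have hall : ∀ G : DoubledGraph D (Fin 1), ∀ x y, G.part x y := by
      intro G x y
      have h0 : G.part (Sum.inl 0) (Sum.inr 0) := by
        have := G.compatible ⟨0, by omega⟩ 0
        rw [Subsingleton.elim (G.graph ⟨0, by omega⟩ 0) 0] at this
        exact this
      have h1 : ∀ x, G.part (Sum.inl 0) x := by
        rintro (x | x)
        · rw [Subsingleton.elim x 0]
        · rw [Subsingleton.elim x 0]; exact h0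
      exact G.part.trans (G.part.symm (h1 x)) (h1 y)
    exact DoubledGraph.ext_part hgr
      (Setoid.ext fun x y => iff_of_true (hall _ x y) (hall _ x y))
  · simp

end SchwingerDyson

/-! ### Melonic models -/

section Leading

open Asymptotics Filter

theorem eval_eq_mul_eval_divX_add (P : Polynomial ℂ) (x : ℂ) :
    P.eval x = x * P.divX.eval x + P.eval 0 := by
  have h := congrArg (Polynomial.eval x) P.divX_mul_X_add
  rw [Polynomial.eval_add, Polynomial.eval_mul, Polynomial.eval_X, Polynomial.eval_C,
    Polynomial.coeff_zero_eq_eval_zero] at h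
  rw [← h, mul_comm]

/-- A polynomial in `1/N` of order `N^(-m)` has no term of degree below `m`: its constant term is
its limit, and `divX` lowers the degree for the induction. The next error is therefore smaller by a
full power. -/
theorem exists_leading_polynomial (m : ℕ) (P : Polynomial ℂ)
    (h : (fun N : ℕ => P.eval (N : ℂ)⁻¹) =O[atTop] fun N : ℕ => ((N : ℝ) ^ m)⁻¹) :
    ∃ c : ℂ, (fun N : ℕ => P.eval (N : ℂ)⁻¹ - ((N : ℂ) ^ m)⁻¹ * c)
      =O[atTop] fun N : ℕ => ((N : ℝ) ^ (m + 1))⁻¹ := by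
  have hnorm : ∀ N : ℕ, ‖(N : ℂ)‖ = ‖(N : ℝ)‖ := fun N => by
    rw [Complex.norm_natCast, Real.norm_natCast]
  induction m generalizing P with
  | zero =>
    refine ⟨P.eval 0, ?_⟩
    have h1 : ∀ x : ℂ, P.eval x - P.eval 0 = x * P.divX.eval x := fun x => by
      rw [eval_eq_mul_eval_divX_add P x, add_sub_cancel_right]
    simp only [pow_zero, inv_one, one_mul, h1, zero_add, pow_one]
    have h2 : (fun N : ℕ => (N : ℂ)⁻¹) =O[atTop] fun N : ℕ => ((N : ℝ))⁻¹ :=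
      IsBigO.of_bound 1 (Eventually.of_forall fun N => by
        rw [norm_inv, norm_inv, hnorm, one_mul])
    simpa using h2.mul (isBigO_polynomial_inv P.divX)
  | succ m ih =>
    have hlim : Tendsto (fun N : ℕ => P.eval (N : ℂ)⁻¹) atTop (nhds (P.eval 0)) :=
      (P.continuous.tendsto 0).comp tendsto_inv_atTop_nhds_zero_nat
    have hz : Tendsto (fun N : ℕ => ((N : ℝ) ^ (m + 1))⁻¹) atTop (nhds 0) :=
      tendsto_inv_atTop_zero.comp ((tendsto_pow_atTop (Nat.succ_ne_zero m)).comp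
        tendsto_natCast_atTop_atTop)
    have h0 : P.eval 0 = 0 := tendsto_nhds_unique hlim (h.trans_tendsto hz)
    have h1 : ∀ x : ℂ, P.eval x = x * P.divX.eval x := fun x => by
      rw [eval_eq_mul_eval_divX_add P x, h0, add_zero]
    have h2 : (fun N : ℕ => P.divX.eval (N : ℂ)⁻¹) =O[atTop] fun N : ℕ => ((N : ℝ) ^ m)⁻¹ := by
      have h3 : (fun N : ℕ => (N : ℂ)) =O[atTop] fun N : ℕ => (N : ℝ) :=
        IsBigO.of_bound 1 (Eventually.of_forall fun N => by rw [hnorm, one_mul])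
      refine (h3.mul h).congr' ?_ ?_
      · filter_upwards [eventually_ge_atTop 1] with N hN
        have hN' : (N : ℂ) ≠ 0 := Nat.cast_ne_zero.2 (by omega)
        rw [h1, mul_inv_cancel_left₀ hN']
      · filter_upwards [eventually_ge_atTop 1] with N hN
        have hN' : (N : ℝ) ≠ 0 := Nat.cast_ne_zero.2 (by omega)
        rw [pow_succ, mul_inv]
        field_simp
    obtain ⟨c, hc⟩ := ih _ h2
    refine ⟨c, ?_⟩
    have h3 : (fun N : ℕ => (N : ℂ)⁻¹) =O[atTop] fun N : ℕ => ((N : ℝ))⁻¹ :=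
      IsBigO.of_bound 1 (Eventually.of_forall fun N => by
        rw [norm_inv, norm_inv, hnorm, one_mul])
    refine (h3.mul hc).congr (fun N => ?_) fun N => ?_
    · rw [h1, pow_succ (N : ℂ), mul_inv]; ring
    · rw [pow_succ (N : ℝ) (m + 1), mul_inv, mul_comm]

theorem exists_leading {F : ℕ → ℂ⟦X⟧} {m : ℕ}
    (hP : ∀ n, ∃ P : Polynomial ℂ, ∀ᶠ N : ℕ in atTop,
      PowerSeries.coeff n (F N) = P.eval (N : ℂ)⁻¹)
    (hF : IsPerturbativeBigO F m) :
    ∃ L : ℂ⟦X⟧, IsPerturbativeBigO (fun N => F N - ((N : ℂ) ^ m)⁻¹ • L) (m + 1) := by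
  choose P hP using hP
  choose c hc using fun n => exists_leading_polynomial m (P n)
    ((hF n).congr' (hP n) EventuallyEq.rfl)
  refine ⟨PowerSeries.mk c, fun n => (hc n).congr' ?_ EventuallyEq.rfl⟩
  filter_upwards [hP n] with N hN
  rw [map_sub, PowerSeries.coeff_smul, PowerSeries.coeff_mk, hN, smul_eq_mul]

theorem eq_zero_of_isPerturbativeBigO {F : ℂ⟦X⟧} {k : ℕ}
    (h : IsPerturbativeBigO (fun _ => F) (k + 1)) : F = 0 := by
  ext n
  have hz : Tendsto (fun N : ℕ => ((N : ℝ) ^ (k + 1))⁻¹) atTop (nhds 0) :=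
    tendsto_inv_atTop_zero.comp ((tendsto_pow_atTop (Nat.succ_ne_zero k)).comp
      tendsto_natCast_atTop_atTop)
  rw [map_zero]
  exact tendsto_nhds_unique tendsto_const_nhds ((h n).trans_tendsto hz)

/-- Iterating `n + 1` times pushes the unknown beyond order `n` in `z`, so its coefficient there
comes from a finite geometric sum times `R`. No prior bound on `F` is needed. -/
theorem IsPerturbativeBigO.of_eq_mul_add {F Q R : ℕ → ℂ⟦X⟧} {k : ℕ}
    (h : ∀ᶠ N in atTop, F N = Q N * F N + R N) (hX : ∀ N, (PowerSeries.X : ℂ⟦X⟧) ∣ Q N)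
    (hQ : IsPerturbativeBigO Q 0) (hR : IsPerturbativeBigO R k) : IsPerturbativeBigO F k := by
  intro n
  have h1 : IsPerturbativeBigO (fun N => (∑ i ∈ Finset.range (n + 1), Q N ^ i) * R N) k := by
    simpa using (IsPerturbativeBigO.sum fun i _ => hQ.pow i).mul hR
  refine (h1 n).congr' ?_ EventuallyEq.rfl
  filter_upwards [h] with N hN
  have h2 : ∀ m, F N = Q N ^ m * F N + (∑ i ∈ Finset.range m, Q N ^ i) * R N := by
    intro m
    induction m with
    | zero => simp
    | succ m ih =>
      rw [Finset.sum_range_succ, pow_succ]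
      linear_combination ih + Q N ^ m * hN
  have h3 : PowerSeries.coeff n (Q N ^ (n + 1) * F N) = 0 :=
    PowerSeries.X_pow_dvd_iff.1 ((pow_dvd_pow_of_dvd (hX N) _).mul_right _) n (Nat.lt_succ_self n)
  conv_rhs => rw [h2 (n + 1), map_add, h3, zero_add]

theorem IsPerturbativeBigO.inv_pow_smul {F : ℕ → ℂ⟦X⟧} {l : ℕ} (h : IsPerturbativeBigO F l)
    (m : ℕ) : IsPerturbativeBigO (fun N => ((N : ℂ) ^ m)⁻¹ • F N) (m + l) := by
  have := h.zpow_smul (k := m + l) (e := -(m : ℤ)) (by push_cast; omega)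
  simpa [zpow_neg, zpow_natCast] using this

theorem IsPerturbativeBigO.pow_sub_pow {F : ℕ → ℂ⟦X⟧} {T : ℂ⟦X⟧} {k : ℕ}
    (hF : IsPerturbativeBigO F 0) (h : IsPerturbativeBigO (fun N => F N - T) k) (m : ℕ) :
    IsPerturbativeBigO (fun N => F N ^ m - T ^ m) k := by
  have h1 : IsPerturbativeBigO (fun N => (∑ i ∈ Finset.range m, F N ^ i * T ^ (m - 1 - i))
      * (F N - T)) (0 + k) :=
    (IsPerturbativeBigO.sum fun i _ => (hF.pow i).mul (isPerturbativeBigO_const _)).mul h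
  rw [zero_add] at h1
  exact h1.congr (Eventually.of_forall fun N => (Commute.all _ _).geom_sum₂_mul m)

/-- First-order Taylor expansion with quadratic remainder; at `m = 0` the truncated exponent is
multiplied by zero. -/
theorem IsPerturbativeBigO.pow_sub_linear {F : ℕ → ℂ⟦X⟧} {T : ℂ⟦X⟧} {k : ℕ}
    (hF : IsPerturbativeBigO F 0) (h : IsPerturbativeBigO (fun N => F N - T) k) (m : ℕ) :
    IsPerturbativeBigO (fun N => F N ^ m - T ^ m - m * T ^ (m - 1) * (F N - T)) (k + k) := by
  induction m with
  | zero => simpa using isPerturbativeBigO_zero (k + k)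
  | succ m ih =>
    have h1 := (hF.mul ih).add (by
      simpa using (isPerturbativeBigO_const ((m : ℂ⟦X⟧) * T ^ (m - 1))).mul (h.mul h))
    rw [zero_add] at h1
    refine h1.congr (Eventually.of_forall fun N => ?_)
    have h2 : (m : ℂ⟦X⟧) * T ^ m = m * (T ^ (m - 1) * T) := by
      rcases m with _ | m
      · simp
      · rw [Nat.add_sub_cancel, pow_succ]
    simp only [Nat.add_sub_cancel, Nat.cast_succ, pow_succ]
    linear_combination (F N - T) * h2

end Leading

/-! ### Fixed point equation and large-`N` coefficients of melonic models. -/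

section Melonic

open Asymptotics Filter

variable {D : ℕ} {V : Type} [Fintype V] [DecidableEq V]

theorem isPerturbativeBigO_expectation_sub_pow (hD : 3 ≤ D) {B : ColoredGraph D V}
    {σ : Equiv.Perm V} (hB : IsMelonic B σ) (M : TensorModel D) :
    IsPerturbativeBigO (fun N : ℕ => (N : ℂ)⁻¹ • M.expectation N (traceInvariant B)
      - M.K N (bubbleTwo D) ^ Fintype.card V) (D - 2) := by
  have hK2 := isPerturbativeBigO_K (by omega) M one_pos (bubbleTwo D)
  have hK4 := fun c => isPerturbativeBigO_K (by omega : 0 < D) M two_pos (bubbleFour {c})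
  have h1 := (isPerturbativeBigO_expectation hD hB M).mono (show D - 2 ≤ D - 1 by omega)
  have h2 := ((hK2.pow (Fintype.card V)).const_smul (alphaCoeff B σ : ℂ)).inv_pow_smul (D - 2)
  have h3 := (IsPerturbativeBigO.sum (s := Finset.univ) fun c _ =>
    ((hK2.pow (Fintype.card V - 2)).mul (hK4 c)).const_smul
      (alphaCoeff' B c : ℂ)).inv_pow_smul (D - 2)
  refine ((h1.add h2).add h3).congr (Eventually.of_forall fun N => ?_)
  simp only [Finset.smul_sum, smul_smul, add_smul, one_smul, div_eq_inv_mul]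
  ring

/-- A bootstrap: polynomiality in `1/N` gives a limit `T` of `K_2` with error `O(1/N)`, the
Schwinger-Dyson equation makes `T` a fixed point, and subtracting the two equations sharpens the
error to `N^(-(D-2))`. The subleading coefficient then exists, again by polynomiality. -/
theorem exists_melonic_expansion (hD : 3 ≤ D) {B : ColoredGraph D V} {σ : Equiv.Perm V}
    (hB : IsMelonic B σ) {M : TensorModel D} (hM : M.Melonic) :
    ∃ (T K₂ : ℂ⟦X⟧) (K₄ : Fin D → ℂ⟦X⟧),
        IsPerturbativeBigO (fun N : ℕ =>
          M.K N (bubbleTwo D) - (T + ((N : ℂ) ^ (D - 2))⁻¹ • K₂)) (D - 1) ∧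
        (∀ c, IsPerturbativeBigO (fun N : ℕ => M.K N (bubbleFour {c}) - K₄ c) 1) ∧
        IsPerturbativeBigO (fun N : ℕ =>
          (N : ℂ)⁻¹ • M.expectation N (traceInvariant B)
            - (T ^ Fintype.card V
              + ((N : ℂ) ^ (D - 2))⁻¹ •
                ((Fintype.card V : ℂ) • (T ^ (Fintype.card V - 1) * K₂)
                  + (alphaCoeff B σ : ℂ) • T ^ Fintype.card V
                  + T ^ (Fintype.card V - 2) * ∑ c : Fin D, (alphaCoeff' B c : ℂ) • K₄ c)))
          (D - 1) := by
  have hD0 : 0 < D := by omega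
  have hK2 := isPerturbativeBigO_K hD0 M one_pos (bubbleTwo D)
  have hK4 := fun c => isPerturbativeBigO_K hD0 M two_pos (bubbleFour {c})
  have hpoly : ∀ {p : ℕ} (_ : 0 < p) (b : ColoredGraph D (Fin p)) (n : ℕ), ∃ P : Polynomial ℂ,
      ∀ᶠ N : ℕ in atTop, PowerSeries.coeff n (M.K N b) = P.eval (N : ℂ)⁻¹ := by
    intro p hp b n
    obtain ⟨P, hP⟩ := exists_polynomial_K hD0 M hp
    exact ⟨P n b, (eventually_ge_atTop p).mono fun N hN => hP N hN b n⟩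
  obtain ⟨T, hT⟩ := exists_leading (hpoly one_pos (bubbleTwo D)) hK2
  choose K₄ hK₄ using fun c => exists_leading (hpoly two_pos (bubbleFour {c})) (hK4 c)
  simp only [pow_zero, inv_one, one_smul, zero_add] at hT hK₄
  -- the leading coefficient satisfies a fixed point equation
  have hA : ∀ i, IsPerturbativeBigO (fun N : ℕ =>
      (N : ℂ)⁻¹ • M.expectation N (traceInvariant (M.bubble i))
        - M.K N (bubbleTwo D) ^ M.p i) (D - 2) := by
    intro i
    obtain ⟨τ, hτ⟩ := hM i
    simpa using isPerturbativeBigO_expectation_sub_pow hD hτ M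
  set w : M.I → ℂ⟦X⟧ := fun i => PowerSeries.monomial (M.p i - 1) (M.t i) with hw
  have hSD : IsPerturbativeBigO (fun N : ℕ => M.K N (bubbleTwo D)
      - (1 + ∑ i, w i * M.K N (bubbleTwo D) ^ M.p i)) (D - 2) := by
    have h1 := IsPerturbativeBigO.sum (s := Finset.univ) fun i _ =>
      (isPerturbativeBigO_const (w i)).mul (hA i)
    rw [zero_add] at h1
    refine h1.congr ?_
    filter_upwards [eventually_ge_atTop 1] with N hN
    have h2 := (K_bubbleTwo_eq hD M hN).trans (expectation_bubbleTwo hD0 M hN)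
    simp only [mul_sub, Finset.sum_sub_distrib]
    linear_combination -h2
  have hfix : T = 1 + ∑ i, w i * T ^ M.p i := by
    have h1 := IsPerturbativeBigO.sum (s := Finset.univ) fun i _ =>
      (isPerturbativeBigO_const (w i)).mul (hK2.pow_sub_pow hT (M.p i))
    rw [zero_add] at h1
    have h2 := ((hSD.mono (show 1 ≤ D - 2 by omega)).sub hT).add h1
    rw [← sub_eq_zero]
    refine eq_zero_of_isPerturbativeBigO (k := 0) (h2.congr (Eventually.of_forall fun N => ?_))
    simp only [mul_sub, Finset.sum_sub_distrib]
    ring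
  -- The difference of the two equations is linear in `K_2 - T`, with a coefficient `Q` divisible by
  -- `z` because `p i ≥ 2`; the error of `hSD` therefore passes to `K_2 - T`.
  have hT2 : IsPerturbativeBigO (fun N : ℕ => M.K N (bubbleTwo D) - T) (D - 2) := by
    refine IsPerturbativeBigO.of_eq_mul_add (Q := fun N => ∑ i, w i
      * ∑ j ∈ Finset.range (M.p i), M.K N (bubbleTwo D) ^ j * T ^ (M.p i - 1 - j))
      (Eventually.of_forall fun N => ?_) (fun N => ?_) ?_ hSD
    · rw [Finset.sum_mul]
      have h1 : ∀ i, w i * (∑ j ∈ Finset.range (M.p i), M.K N (bubbleTwo D) ^ j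
          * T ^ (M.p i - 1 - j)) * (M.K N (bubbleTwo D) - T)
          = w i * M.K N (bubbleTwo D) ^ M.p i - w i * T ^ M.p i := fun i => by
        rw [mul_assoc, (Commute.all _ _).geom_sum₂_mul, mul_sub]
      simp only [h1, Finset.sum_sub_distrib]
      linear_combination -hfix
    · refine Finset.dvd_sum fun i _ => Dvd.dvd.mul_right ?_ _
      rw [PowerSeries.X_dvd_iff, ← PowerSeries.coeff_zero_eq_constantCoeff_apply,
        PowerSeries.coeff_monomial, if_neg]
      have := M.two_le i
      omega
    · simpa using IsPerturbativeBigO.sum (s := Finset.univ) fun i _ =>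
        (isPerturbativeBigO_const (w i)).mul (IsPerturbativeBigO.sum fun j _ =>
          (hK2.pow j).mul (isPerturbativeBigO_const (T ^ (M.p i - 1 - j))))
  obtain ⟨K₂, hK₂⟩ := exists_leading (F := fun N => M.K N (bubbleTwo D) - T) (m := D - 2) (by
    intro n
    obtain ⟨P, hP⟩ := hpoly one_pos (bubbleTwo D) n
    refine ⟨P - Polynomial.C (PowerSeries.coeff n T), hP.mono fun N hN => ?_⟩
    rw [map_sub, hN, Polynomial.eval_sub, Polynomial.eval_C]) hT2
  rw [show D - 2 + 1 = D - 1 by omega] at hK₂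
  refine ⟨T, K₂, K₄, hK₂.congr (Eventually.of_forall fun N => by ring), hK₄, ?_⟩
  set p := Fintype.card V with hp
  have h1 := isPerturbativeBigO_expectation hD hB M
  -- Quadratic remainders are of order `N^(-2(D-2))`, and `2 (D - 2) ≥ D - 1` is the condition `D ≥
  -- 3`.
  have h2 := (hK2.pow_sub_linear hT2 p).mono (show D - 1 ≤ D - 2 + (D - 2) by omega)
  have h3 := (isPerturbativeBigO_const ((p : ℂ⟦X⟧) * T ^ (p - 1))).mul hK₂
  rw [zero_add] at h3
  have h4 := (((hK2.pow_sub_pow hT2 p).const_smul (alphaCoeff B σ : ℂ)).inv_pow_smul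
    (D - 2)).mono (show D - 1 ≤ D - 2 + (D - 2) by omega)
  have h5 : ∀ c, IsPerturbativeBigO (fun N => M.K N (bubbleTwo D) ^ (p - 2)
      * M.K N (bubbleFour {c}) - T ^ (p - 2) * K₄ c) 1 := by
    intro c
    have h6 := (hK2.pow (p - 2)).mul (hK₄ c)
    have h7 := ((hK2.pow_sub_pow hT2 (p - 2)).mul (isPerturbativeBigO_const (K₄ c))).mono
      (show 1 ≤ D - 2 + 0 by omega)
    rw [zero_add] at h6
    exact (h6.add h7).congr (Eventually.of_forall fun N => by ring)
  have h6 := ((IsPerturbativeBigO.sum (s := Finset.univ) fun c _ =>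
    (h5 c).const_smul (alphaCoeff' B c : ℂ)).inv_pow_smul (D - 2)).mono
      (show D - 1 ≤ D - 2 + 1 by omega)
  refine ((((h1.add h2).add h3).add h4).add h6).congr (Eventually.of_forall fun N => ?_)
  have hp' : (p : ℂ) • (T ^ (p - 1) * K₂) = (p : ℂ⟦X⟧) * T ^ (p - 1) * K₂ := by
    rw [Nat.cast_smul_eq_nsmul, nsmul_eq_mul, mul_assoc]
  rw [hp']
  simp only [smul_sub, Finset.sum_sub_distrib, smul_add, Finset.smul_sum, Finset.mul_sum,
    mul_smul_comm, smul_smul, add_smul, one_smul, div_eq_inv_mul, mul_sub]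
  ring

end Melonic


end RandomTensor

theorem mainTheorem7 (D : ℕ) (hD : 3 ≤ D) (V : Type) [Fintype V] [DecidableEq V]
    (B : ColoredGraph D V) (σ : Equiv.Perm V) (hB : IsMelonic B σ) :
    -- the scaling of all the contributions to the expectation of the melonic bubble
    (scalingExponent B (gaussianPairing D σ) = 0 ∧
      ∀ G : DoubledGraph D V, G ≠ gaussianPairing D σ →
        scalingExponent B G ≤ -((D : ℤ) - 2) ∧
        (scalingExponent B G = -((D : ℤ) - 2) →
          IsNearlyCanonical σ G ∨ ∃ c, IsSingleFourPoint c G)) ∧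
    ∀ M : TensorModel D,
      -- the expansion in terms of the exact two- and four-point cumulants
      IsPerturbativeBigO (fun N : ℕ =>
        (N : ℂ)⁻¹ • M.expectation N (traceInvariant B)
          - ((1 + (alphaCoeff B σ : ℂ) / (N : ℂ) ^ (D - 2)) •
                M.K N (bubbleTwo D) ^ Fintype.card V
            + ∑ c : Fin D, ((alphaCoeff' B c : ℂ) / (N : ℂ) ^ (D - 2)) •
                (M.K N (bubbleTwo D) ^ (Fintype.card V - 2) * M.K N (bubbleFour {c}))))
        (D - 1) ∧
      -- the same for a color-invariant model
      (M.ColorInvariant → ∀ c : Fin D, IsPerturbativeBigO (fun N : ℕ =>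
        (N : ℂ)⁻¹ • M.expectation N (traceInvariant B)
          - ((1 + (alphaCoeff B σ : ℂ) / (N : ℂ) ^ (D - 2)) •
                M.K N (bubbleTwo D) ^ Fintype.card V
            + (((∑ c' : Fin D, alphaCoeff' B c' : ℕ) : ℂ) / (N : ℂ) ^ (D - 2)) •
                (M.K N (bubbleTwo D) ^ (Fintype.card V - 2) * M.K N (bubbleFour {c}))))
        (D - 1)) ∧
      -- melonic models: the expansion with the large-`N` coefficients of the cumulants
      (M.Melonic → ∃ (T K₂ : ℂ⟦X⟧) (K₄ : Fin D → ℂ⟦X⟧),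
        IsPerturbativeBigO (fun N : ℕ =>
          M.K N (bubbleTwo D) - (T + ((N : ℂ) ^ (D - 2))⁻¹ • K₂)) (D - 1) ∧
        (∀ c, IsPerturbativeBigO (fun N : ℕ => M.K N (bubbleFour {c}) - K₄ c) 1) ∧
        IsPerturbativeBigO (fun N : ℕ =>
          (N : ℂ)⁻¹ • M.expectation N (traceInvariant B)
            - (T ^ Fintype.card V
              + ((N : ℂ) ^ (D - 2))⁻¹ •
                ((Fintype.card V : ℂ) • (T ^ (Fintype.card V - 1) * K₂)
                  + (alphaCoeff B σ : ℂ) • T ^ Fintype.card V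
                  + T ^ (Fintype.card V - 2) * ∑ c : Fin D, (alphaCoeff' B c : ℂ) • K₄ c)))
          (D - 1)) :=
  ⟨scaling_of_melonic hD hB, fun M => ⟨isPerturbativeBigO_expectation hD hB M,
    fun hM c => isPerturbativeBigO_expectation_of_colorInvariant hD hB hM c,
    fun hM => exists_melonic_expansion hD hB hM⟩⟩
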